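/- For a real number $x$ and positive integers $s,t,n$, let $\mathrm{RT}(K_s,K_t,x)$ (on $n$ vertices) be the maximum number of copies of $K_s$ in a $K_t$-free $n$-vertex graph $G$ with independence number $\alpha(G)\le x$ (and $0$ if there is no such graph). For a function $f$, $\mathrm{RT}(K_s,K_t,f(n))$ is the function of $n$ obtained with $x=f(n)$, and $\mathrm{RT}(K_s,K_t,o(n))$ denotes any function of the form $$n^s\cdot\lim_{\varepsilon\to0^+}\lim_{n\to\infty}\frac{\mathrm{RT}(K_s,K_t,\varepsilon n)}{n^s}+o(n^s).$$ **Theorem.** Let $\omega:\mathbb N\to\mathbb R$ satisfy $\omega(n)\to\infty$ as $n\to\infty$, and for integers $r\ge 1$ let $g_r(n)=n\,2^{-\omega(n)(\log n)^{1-1/r}}$. 1. $\mathrm{RT}(K_3,K_5,g_3(n))=o(n^3)$ and $\mathrm{RT}(K_3,K_6,g_3(n))=o(n^3)$. Now let $\ell\ge 3$ be an integer and suppose that $\omega$ grows slowly, in the sense that $\omega(n)=o\big((\log n)^{1/(\ell+1)}\big)$, equivalently $g_{\ell+1}(n)=n^{1-o(1)}$. Then the limits that define $\mathrm{RT}(K_3,K_{2\ell+1},o(n))$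 exist, and, for every choice of its error term $o(n^3)$: 2. (Odd cliques larger than $5$ are stable.) $\mathrm{RT}(K_3,K_{2\ell+1},g_{\ell+1}(n))=(1+o(1))\,\mathrm{RT}(K_3,K_{2\ell+1},o(n))$. 3. (Even cliques exhibit a jump.) $\mathrm{RT}(K_3,K_{2\ell+2},g_{\ell+1}(n))=(1+o(1))\,\mathrm{RT}(K_3,K_{2\ell+1},o(n))$. -/

import Mathlib

open Filter Topology Asymptotics

open Classical in
/-- `RT(K_s, K_t, x)` on `n` vertices: the maximum number of copies of `K_s` in a `K_t`-free graph
on `n` vertices whose independence number is at most the real number `x`. The maximum is `0` if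
there is no such graph. -/
noncomputable def ramseyTuran (s t n : ℕ) (x : ℝ) : ℕ :=
  (Finset.univ.filter
    (fun G : SimpleGraph (Fin n) => G.CliqueFree t ∧ (G.indepNum : ℝ) ≤ x)).sup
    (fun G => (G.cliqueFinset s).card)

/-- The function `h` is (a version of) `RT(K_s, K_t, o(n))`, that is,
`h(n) = n ^ s * lim_{ε → 0+} lim_{n → ∞} RT(K_s, K_t, ε n) / n ^ s + o(n ^ s)`,
where both limits exist. This determines `h` up to the error term `o(n ^ s)`. -/
def IsRamseyTuranLittleO (s t : ℕ) (h : ℕ → ℝ) : Prop :=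
  ∃ (φ : ℝ → ℝ) (c : ℝ),
    (∀ᶠ ε in 𝓝[>] (0 : ℝ),
      Tendsto (fun n : ℕ => (ramseyTuran s t n (ε * (n : ℝ)) : ℝ) / (n : ℝ) ^ s) atTop
        (𝓝 (φ ε))) ∧
    Tendsto φ (𝓝[>] (0 : ℝ)) (𝓝 c) ∧
    (fun n : ℕ => h n - (n : ℝ) ^ s * c) =o[atTop] (fun n : ℕ => (n : ℝ) ^ s)

/-- `g_r(n) = n * 2 ^ (-ω(n) * (log n) ^ (1 - 1 / r))`. -/
noncomputable def phaseFun (ω : ℕ → ℝ) (r n : ℕ) : ℝ :=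
  (n : ℝ) * (2 : ℝ) ^ (-(ω n * (Real.log (n : ℝ)) ^ (1 - 1 / (r : ℝ))))

/-! Upper bounds. Szemerédi regularity turns a graph into a reduced graph whose pairs get weight
`0`, `1/2` or `1` according as the density is negligible, at most about `1/2`, or clearly larger.
Let `K` be a clique of positive weights and `J ⊆ K` a subclique of weights `1`. If independent sets
are small compared with the parts, an edge can be chosen inside each part of `J` and a vertex in
every other part of `K`, all completely joined (`exists_clique_of_regular`): two vertices whose
densities into a set exceed `1/2` share many neighbours. This yields a clique of order `|K| + |J|`,
so in a `K_{2ℓ+1}`-free graph the value `2ℓ+1` is excluded.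

The core is `weighted_turan`: excluding that value forces weighted triangle density at most `(1 -
1/ℓ)(1 - 2/ℓ)`. Symmetrization moves the mass onto a clique of positive weights. At a maximizer over
all half-edge graphs and all masses, vertices joined by a half edge are twins of equal mass, so the
half edges form disjoint cliques. The density is then a sum over vertices, and a tangent-line bound
at mass `1/ℓ` (`tangent_class`) estimates each term by a linear function of the mass plus a multiple
of `1 + 1/m`, with `m` the size of the class. The numbers `1 + 1/m` add up to the number of vertices
plus the number of classes, hence to at most `2ℓ`.

Even cliques. Since `J ⊆ K`, the value `2ℓ+1` forces `|K| ≥ ℓ+1`, hence a positive density of copies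
of `K_{ℓ+1}`. Dependent random choice, applied to one coordinate at a time (`exists_edge_box`),
replaces each of the `ℓ+1` vertices by an edge and produces `K_{2ℓ+2}` once the independence number
is below `n exp(-C (log n)^{1-1/(ℓ+1)})`. So `K_{2ℓ+2}`-free graphs obey the same bound. A positive
triangle density similarly forces `K_6`, which settles part 1.

Lower bound. The join of `ℓ` equal triangle-free graphs with independence number `O(n^s)`, `s < 1`,
is `K_{2ℓ+1}`-free and has the triangle density of the balanced complete `ℓ`-partite graph. Slow
growth of `ω` makes it admissible. The limit in `n` exists for each `ε` because blow-ups make the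
extremal count superadditive. -/

/-! ### Ordered triangles and basic properties of the extremal function. -/

open Finset in
/-- The number of ordered triangles of `G`. -/
noncomputable def ordTri {V : Type*} [Fintype V] (G : SimpleGraph V) : ℕ := by
  classical
  exact #{p : V × V × V | G.Adj p.1 p.2.1 ∧ G.Adj p.2.1 p.2.2 ∧ G.Adj p.1 p.2.2}

open Finset in
-- Each triangle is the underlying set of exactly six ordered triples. Ordered counts are used
-- throughout because they are plain sums over three coordinates.
theorem ordTri_eq {V : Type*} [Fintype V] [DecidableEq V] (G : SimpleGraph V) [DecidableRel G.Adj] :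
    ordTri G = 6 * #(G.cliqueFinset 3) := by
  classical
  have h : ∀ p ∈ ({p : V × V × V | G.Adj p.1 p.2.1 ∧ G.Adj p.2.1 p.2.2 ∧ G.Adj p.1 p.2.2} :
      Finset _), ({p.1, p.2.1, p.2.2} : Finset V) ∈ G.cliqueFinset 3 := by
    rintro ⟨a, b, c⟩ hp
    simp only [mem_filter, mem_univ, true_and] at hp
    simp only [SimpleGraph.mem_cliqueFinset_iff, SimpleGraph.is3Clique_triple_iff]
    exact ⟨hp.1, hp.2.2, hp.2.1⟩
  suffices key : #({p : V × V × V | G.Adj p.1 p.2.1 ∧ G.Adj p.2.1 p.2.2 ∧ G.Adj p.1 p.2.2} :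
      Finset _) = 6 * #(G.cliqueFinset 3) by
    rw [← key, ordTri]
    congr!
  rw [card_eq_sum_card_fiberwise (fun p hp => h p hp), sum_const_nat (m := 6) ?_, mul_comm]
  intro s hs
  obtain ⟨a, b, c, hab, hac, hbc, rfl⟩ :=
    SimpleGraph.is3Clique_iff.1 ((SimpleGraph.mem_cliqueFinset_iff).1 hs)
  have e : ({p ∈ ({p : V × V × V | G.Adj p.1 p.2.1 ∧ G.Adj p.2.1 p.2.2 ∧ G.Adj p.1 p.2.2} :
      Finset _) | ({p.1, p.2.1, p.2.2} : Finset V) = {a, b, c}} : Finset _) =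
      {(a, b, c), (a, c, b), (b, a, c), (b, c, a), (c, a, b), (c, b, a)} := by
    ext ⟨x, y, z⟩
    simp only [mem_filter, mem_univ, true_and, mem_insert, mem_singleton, Prod.mk.injEq]
    have h1 := hab.ne
    have h2 := hac.ne
    have h3 := hbc.ne
    constructor
    · rintro ⟨⟨h4, h5, h6⟩, h7⟩
      have h4 := h4.ne
      have h5 := h5.ne
      have h6 := h6.ne
      have hx : x ∈ ({a, b, c} : Finset V) := h7 ▸ by simp
      have hy : y ∈ ({a, b, c} : Finset V) := h7 ▸ by simp
      have hz : z ∈ ({a, b, c} : Finset V) := h7 ▸ by simp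
      simp only [mem_insert, mem_singleton] at hx hy hz
      grind
    · have := hab.symm
      have := hac.symm
      have := hbc.symm
      rintro (⟨rfl, rfl, rfl⟩ | ⟨rfl, rfl, rfl⟩ | ⟨rfl, rfl, rfl⟩ | ⟨rfl, rfl, rfl⟩ |
        ⟨rfl, rfl, rfl⟩ | ⟨rfl, rfl, rfl⟩) <;> refine ⟨⟨?_, ?_, ?_⟩, ?_⟩ <;>
        first | assumption | (ext; simp only [mem_insert, mem_singleton] <;> tauto)
  have h1 := hab.ne
  have h2 := hac.ne
  have h3 := hbc.ne
  rw [e]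
  rw [card_insert_of_notMem, card_insert_of_notMem, card_insert_of_notMem, card_insert_of_notMem,
    card_insert_of_notMem, card_singleton]
  all_goals simp [h1, h2, h3, h1.symm, h2.symm]

theorem SimpleGraph.Iso.indepNum_le {V W : Type*} [Fintype V] [Fintype W] {G : SimpleGraph V}
    {H : SimpleGraph W} (e : G ≃g H) : G.indepNum ≤ H.indepNum := by
  classical
  obtain ⟨s, hs⟩ := G.exists_isNIndepSet_indepNum
  rw [← hs.card_eq, ← Finset.card_map e.toEquiv.toEmbedding]
  apply SimpleGraph.IsIndepSet.card_le_indepNum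
  rw [SimpleGraph.isIndepSet_iff]
  rintro x hx y hy hxy
  simp only [Finset.coe_map, Set.mem_image] at hx hy
  obtain ⟨a, ha, rfl⟩ := hx
  obtain ⟨b, hb, rfl⟩ := hy
  have := hs.isIndepSet ha hb (fun h => hxy (by rw [h]))
  exact fun h => this (e.map_adj_iff.1 h)

theorem SimpleGraph.Iso.indepNum_eq {V W : Type*} [Fintype V] [Fintype W] {G : SimpleGraph V}
    {H : SimpleGraph W} (e : G ≃g H) : G.indepNum = H.indepNum :=
  le_antisymm e.indepNum_le e.symm.indepNum_le

theorem ordTri_mono_hom {V W : Type*} [Fintype V] [Fintype W] {G : SimpleGraph V}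
    {H : SimpleGraph W} (f : G ↪g H) : ordTri G ≤ ordTri H := by
  classical
  unfold ordTri
  apply Finset.card_le_card_of_injOn (fun p => (f p.1, f p.2.1, f p.2.2))
  · intro p hp
    simpa using hp
  · rintro ⟨a, b, c⟩ - ⟨x, y, z⟩ - h
    simpa using h

open Classical in
theorem card_cliqueFinset_le_ramseyTuran {r t n : ℕ} {x : ℝ} (G : SimpleGraph (Fin n))
    (hG : G.CliqueFree t) (hx : (G.indepNum : ℝ) ≤ x) :
    (G.cliqueFinset r).card ≤ ramseyTuran r t n x := by
  have hm : G ∈ (Finset.univ : Finset (SimpleGraph (Fin n))).filter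
      (fun G => G.CliqueFree t ∧ (G.indepNum : ℝ) ≤ x) :=
    Finset.mem_filter.2 ⟨Finset.mem_univ _, hG, hx⟩
  exact Finset.le_sup (f := fun G : SimpleGraph (Fin n) => (G.cliqueFinset r).card) hm

theorem ordTri_le_ramseyTuran {V : Type*} [Fintype V] (G : SimpleGraph V) {t : ℕ} {x : ℝ}
    (hG : G.CliqueFree t) (hx : (G.indepNum : ℝ) ≤ x) :
    ordTri G ≤ 6 * ramseyTuran 3 t (Fintype.card V) x := by
  classical
  obtain ⟨n, hn⟩ : ∃ n, n = Fintype.card V := ⟨_, rfl⟩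
  have e : V ≃ Fin n := hn ▸ Fintype.equivFin V
  have i : G ≃g G.map e.toEmbedding := SimpleGraph.Iso.map e G
  generalize G.map e.toEmbedding = G' at i
  rw [← hn]
  refine (ordTri_mono_hom i.toEmbedding).trans ?_
  rw [ordTri_eq]
  refine Nat.mul_le_mul_left _ ?_
  have h := card_cliqueFinset_le_ramseyTuran (r := 3) (t := t) (x := x) G'
    (hG.comap i.symm.toEmbedding.isContained) (by rwa [← i.indepNum_eq])
  refine le_trans (le_of_eq ?_) h
  congr!

/-- The condition `0 ≤ b` covers the case of no admissible graph, where the maximum is `0` by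
convention. -/
theorem ramseyTuran_le {t n : ℕ} {x : ℝ} {b : ℝ} (hb : 0 ≤ b)
    (h : ∀ G : SimpleGraph (Fin n), G.CliqueFree t → (G.indepNum : ℝ) ≤ x →
      (ordTri G : ℝ) ≤ 6 * b) :
    (ramseyTuran 3 t n x : ℝ) ≤ b := by
  classical
  rcases Finset.eq_empty_or_nonempty ((Finset.univ : Finset (SimpleGraph (Fin n))).filter
    (fun G : SimpleGraph (Fin n) => G.CliqueFree t ∧ (G.indepNum : ℝ) ≤ x)) with h0 | h0
  · have : ramseyTuran 3 t n x = 0 := by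
      unfold ramseyTuran
      rw [← Nat.bot_eq_zero]
      convert Finset.sup_empty
    simpa [this]
  · obtain ⟨G, hG, hG'⟩ := Finset.exists_mem_eq_sup _ h0
      (fun G : SimpleGraph (Fin n) => (G.cliqueFinset 3).card)
    have : ramseyTuran 3 t n x = (G.cliqueFinset 3).card := by
      rw [← hG']
      unfold ramseyTuran
      congr
    rw [this]
    rw [Finset.mem_filter] at hG
    have := h G hG.2.1 hG.2.2
    rw [ordTri_eq] at this
    push_cast at this
    linarith

theorem exists_graph_of_ramseyTuran_pos {t n : ℕ} {x : ℝ} (h : 0 < ramseyTuran 3 t n x) :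
    ∃ G : SimpleGraph (Fin n), G.CliqueFree t ∧ (G.indepNum : ℝ) ≤ x ∧
      ordTri G = 6 * ramseyTuran 3 t n x := by
  by_contra! hc
  -- If no graph attains the maximum, every ordered count is short of it by at least `1`, that is,
  -- by `1 / 6` of a triangle.
  have key : (ramseyTuran 3 t n x : ℝ) ≤ ramseyTuran 3 t n x - 1 / 6 := by
    refine ramseyTuran_le ?_ ?_
    · have : (1 : ℝ) ≤ ramseyTuran 3 t n x := by exact_mod_cast h
      linarith
    · intro G hG hx
      have h1 := hc G hG hx
      have h2 := ordTri_le_ramseyTuran G hG hx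
      rw [Fintype.card_fin] at h2
      have : ordTri G + 1 ≤ 6 * ramseyTuran 3 t n x := by omega
      have : ((ordTri G + 1 : ℕ) : ℝ) ≤ (6 * ramseyTuran 3 t n x : ℕ) := by exact_mod_cast this
      push_cast at this
      linarith
  linarith

theorem ramseyTuran_mono {t t' n : ℕ} {x x' : ℝ} (ht : t ≤ t') (hx : x ≤ x') :
    ramseyTuran 3 t n x ≤ ramseyTuran 3 t' n x' := by
  have : (ramseyTuran 3 t n x : ℝ) ≤ ramseyTuran 3 t' n x' := by
    refine ramseyTuran_le (by positivity) ?_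
    intro G hG hGx
    have := ordTri_le_ramseyTuran G (hG.mono ht) (hGx.trans hx)
    rw [Fintype.card_fin] at this
    exact_mod_cast this
  exact_mod_cast this

theorem SimpleGraph.indepNum_le_of_forall {V : Type*} [Fintype V] {G : SimpleGraph V} {k : ℕ}
    (h : ∀ s : Finset V, G.IsIndepSet s → s.card ≤ k) : G.indepNum ≤ k := by
  obtain ⟨s, hs⟩ := G.exists_isNIndepSet_indepNum
  rw [← hs.card_eq]
  exact h s hs.isIndepSet

theorem SimpleGraph.IsIndepSet.image_of_comap {V W : Type*} [DecidableEq W] {H : SimpleGraph W}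
    {f : V → W} {s : Finset V} (hs : (H.comap f).IsIndepSet (s : Set V)) :
    H.IsIndepSet (s.image f : Set W) := by
  rintro x hx y hy hxy hadj
  simp only [Finset.coe_image, Set.mem_image] at hx hy
  obtain ⟨a, ha, rfl⟩ := hx
  obtain ⟨b, hb, rfl⟩ := hy
  exact hs ha hb (fun h => hxy (by rw [h])) hadj

theorem SimpleGraph.indepNum_comap_le {V W : Type*} [Fintype V] [Fintype W] (H : SimpleGraph W)
    (f : V ↪ W) : (H.comap f).indepNum ≤ H.indepNum := by
  classical
  refine SimpleGraph.indepNum_le_of_forall fun s hs => ?_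
  rw [← Finset.card_image_of_injective s f.injective]
  exact hs.image_of_comap.card_le_indepNum

/-! ### Triangle-free graphs with polynomially small independence number. -/

/-- The six-fold fibration of a graph: its triangle-freeness is inherited from the base, while the
independence number grows by a factor of at most `9 / 2` only. -/
def sixFold {V : Type*} (G : SimpleGraph V) : SimpleGraph (V × Fin 6) where
  Adj p q := (G.Adj p.1 q.1 ∧ (p.2 = q.2 ∨ p.2 = q.2 + 1 ∨ q.2 = p.2 + 1)) ∨
    (p.1 = q.1 ∧ p.2 = q.2 + 3)
  symm := ⟨by
    have h3 : ∀ i j : Fin 6, i = j + 3 → j = i + 3 := by decide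
    rintro p q (⟨h, h'⟩ | ⟨h, h'⟩)
    · exact Or.inl ⟨h.symm, by tauto⟩
    · exact Or.inr ⟨h.symm, h3 _ _ h'⟩⟩
  loopless := ⟨by
    have h3 : ∀ i : Fin 6, i ≠ i + 3 := by decide
    rintro p (⟨h, -⟩ | ⟨-, h⟩)
    · exact h.ne rfl
    · exact h3 _ h⟩

/-- A triangle without fibre edges projects to a triangle of the base. A fibre edge joins antipodal
points of the 6-cycle, and no position is equal or cyclically adjacent to both of them, nor
antipodal to both. -/
theorem sixFold_cliqueFree {V : Type*} {G : SimpleGraph V} (hG : G.CliqueFree 3) :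
    (sixFold G).CliqueFree 3 := by
  classical
  have key : ∀ p q r : V × Fin 6, p.1 = q.1 → p.2 = q.2 + 3 → (sixFold G).Adj p r →
      (sixFold G).Adj q r → False := by
    have h1 : ∀ i j k : Fin 6, i = j + 3 → (i = k ∨ i = k + 1 ∨ k = i + 1) →
      (j = k ∨ j = k + 1 ∨ k = j + 1) → False := by decide
    have h2 : ∀ i j k : Fin 6, i = j + 3 → i = k + 3 → j = k + 3 → False := by decide
    rintro ⟨u, i⟩ ⟨v, j⟩ ⟨w, k⟩ huv hij (⟨h, h'⟩ | ⟨h, h'⟩) (⟨g, g'⟩ | ⟨g, g'⟩)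
    · exact h1 _ _ _ hij h' g'
    · simp only at *
      subst g huv
      exact h.ne rfl
    · simp only at *
      subst h huv
      exact g.ne rfl
    · exact h2 _ _ _ hij h' g'
  intro s hs
  obtain ⟨a, b, c, hab, hac, hbc, rfl⟩ := SimpleGraph.is3Clique_iff.1 hs
  have hab0 := hab
  have hac0 := hac
  have hbc0 := hbc
  rcases hab0 with ⟨h1, -⟩ | ⟨h1, h1'⟩
  · rcases hac0 with ⟨h2, -⟩ | ⟨h2, h2'⟩
    · rcases hbc0 with ⟨h3, -⟩ | ⟨h3, h3'⟩
      · exact hG {a.1, b.1, c.1} (SimpleGraph.is3Clique_triple_iff.2 ⟨h1, h2, h3⟩)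
      · exact key _ _ _ h3 h3' hab.symm hac.symm
    · exact key _ _ _ h2 h2' hab hbc.symm
  · exact key _ _ _ h1 h1' hac hbc

/-- For an independent set, the vertices whose fibre meets a window of two consecutive positions are
independent in the base. A fibre holds no antipodal pair, so `f` chosen positions meet at least
`4f/3` of the six windows. Double counting gives the factor `6 · 3/4 = 9/2`. -/
theorem sixFold_indepNum {V : Type*} [Fintype V] (G : SimpleGraph V) :
    2 * (sixFold G).indepNum ≤ 9 * G.indepNum := by
  classical
  obtain ⟨S, hS⟩ := (sixFold G).exists_isNIndepSet_indepNum
  rw [← hS.card_eq]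
  have hI := hS.isIndepSet
  let U : Fin 6 → Finset V := fun i => {v | (v, i) ∈ S ∨ (v, i + 1) ∈ S}
  have hU : ∀ i, (U i).card ≤ G.indepNum := by
    intro i
    apply SimpleGraph.IsIndepSet.card_le_indepNum
    have hne : ∀ u v : V, G.Adj u v → ∀ k l : Fin 6, (u, k) ≠ (v, l) := by
      intro u v h k l h'
      exact h.ne (Prod.ext_iff.1 h').1
    intro u hu v hv huv hadj
    simp only [U, Finset.coe_filter, Finset.mem_univ, true_and, Set.mem_ofPred_eq] at hu hv
    rcases hu with hu | hu <;> rcases hv with hv | hv <;>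
      exact hI hu hv (hne _ _ hadj _ _) (Or.inl ⟨hadj, by simp⟩)
  let F : V → Finset (Fin 6) := fun v => {i | (v, i) ∈ S}
  have hF : ∀ v, 4 * (F v).card ≤ 3 * (Finset.univ.filter fun i => i ∈ F v ∨ i + 1 ∈ F v).card := by
    intro v
    -- A finite check; three consecutive positions meet exactly four windows, so `4/3` is sharp.
    have hd : ∀ F : Finset (Fin 6), (∀ i ∈ F, i + 3 ∉ F) →
        4 * F.card ≤ 3 * (Finset.univ.filter fun i => i ∈ F ∨ i + 1 ∈ F).card := by decide
    refine hd _ fun i hi hi' => ?_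
    simp only [F, Finset.mem_filter, Finset.mem_univ, true_and] at hi hi'
    have h3 : ∀ i : Fin 6, i + 3 ≠ i := by decide
    exact hI hi' hi (fun h => h3 i (Prod.ext_iff.1 h).2) (Or.inr ⟨rfl, rfl⟩)
  have h1 : S.card = ∑ v, (F v).card := by
    rw [Finset.card_eq_sum_card_fiberwise (f := Prod.fst) (t := Finset.univ) (by simp)]
    refine Finset.sum_congr rfl fun v _ => ?_
    rw [← Finset.card_map ⟨fun i : Fin 6 => (v, i), Prod.mk_right_injective v⟩]
    congr 1
    ext ⟨w, i⟩
    simp only [Finset.mem_filter, Finset.mem_map, Function.Embedding.coeFn_mk, F, Finset.mem_univ,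
      true_and, Prod.mk.injEq]
    constructor
    · rintro ⟨h, rfl⟩
      exact ⟨i, h, rfl, rfl⟩
    · rintro ⟨j, h, rfl, rfl⟩
      exact ⟨h, rfl⟩
  have h2 : ∑ v, (Finset.univ.filter fun i => i ∈ F v ∨ i + 1 ∈ F v).card = ∑ i, (U i).card := by
    simp only [Finset.card_filter, U, F, Finset.mem_filter, Finset.mem_univ, true_and]
    exact Finset.sum_comm
  have h3 : ∑ i, (U i).card ≤ 6 * G.indepNum := by
    refine (Finset.sum_le_card_nsmul _ _ _ fun i _ => hU i).trans ?_
    simp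
  have h4 : 4 * ∑ v, (F v).card ≤
      3 * ∑ v, (Finset.univ.filter fun i => i ∈ F v ∨ i + 1 ∈ F v).card := by
    rw [Finset.mul_sum, Finset.mul_sum]
    exact Finset.sum_le_sum fun v _ => hF v
  omega

theorem exists_triangleFree_pow (k : ℕ) :
    ∃ G : SimpleGraph (Fin (6 ^ k)), G.CliqueFree 3 ∧ 2 ^ k * G.indepNum ≤ 9 ^ k := by
  induction k with
  | zero =>
    refine ⟨⊥, SimpleGraph.cliqueFree_bot (by norm_num), ?_⟩
    have : (⊥ : SimpleGraph (Fin (6 ^ 0))).indepNum ≤ 1 :=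
      SimpleGraph.indepNum_le_of_forall fun s _ => (Finset.card_le_univ s).trans (by simp)
    simpa using this
  | succ k ih =>
    obtain ⟨G, hG, hα⟩ := ih
    let e : Fin (6 ^ k) × Fin 6 ≃ Fin (6 ^ (k + 1)) :=
      finProdFinEquiv.trans (finCongr (pow_succ 6 k).symm)
    let i := SimpleGraph.Iso.map e (sixFold G)
    refine ⟨(sixFold G).map e,
      (sixFold_cliqueFree hG).comap i.symm.toEmbedding.isContained, ?_⟩
    rw [← i.indepNum_eq]
    have := sixFold_indepNum G
    rw [pow_succ, pow_succ]
    calc 2 ^ k * 2 * (sixFold G).indepNum = 2 ^ k * (2 * (sixFold G).indepNum) := by ring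
      _ ≤ 2 ^ k * (9 * G.indepNum) := by gcongr
      _ = 2 ^ k * G.indepNum * 9 := by ring
      _ ≤ _ := by gcongr

/-- The exponent `log (9/2) / log 6` is below `1` because the independence number grows by `9/2`
while the order grows by `6`. Passing from `m` to the next power of `6` enlarges the order by at
most `6` and the bound by at most `6^s = 9/2`. -/
theorem exists_triangleFree_indepNum_le_rpow :
    ∃ s : ℝ, 0 < s ∧ s < 1 ∧ ∀ m : ℕ, 0 < m →
      ∃ G : SimpleGraph (Fin m), G.CliqueFree 3 ∧ (G.indepNum : ℝ) ≤ 6 * (m : ℝ) ^ s := by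
  have h6 : 0 < Real.log 6 := Real.log_pos (by norm_num)
  have h9 : 0 < Real.log (9 / 2) := Real.log_pos (by norm_num)
  refine ⟨Real.log (9 / 2) / Real.log 6, by positivity, ?_, ?_⟩
  · rw [div_lt_one h6]
    exact Real.log_lt_log (by norm_num) (by norm_num)
  intro m hm
  set s := Real.log (9 / 2) / Real.log 6 with hs
  have hs1 : s < 1 := by
    rw [div_lt_one h6]
    exact Real.log_lt_log (by norm_num) (by norm_num)
  have hs0 : 0 < s := by positivity
  have h6s : (6 : ℝ) ^ s = 9 / 2 := by
    rw [Real.rpow_def_of_pos (by norm_num), hs, mul_div_cancel₀ _ h6.ne', Real.exp_log (by norm_num)]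
  obtain ⟨k, hk1, hk2⟩ : ∃ k : ℕ, m ≤ 6 ^ k ∧ 6 ^ k ≤ 6 * m := by
    refine ⟨Nat.clog 6 m, Nat.le_pow_clog (by norm_num) m, ?_⟩
    rcases Nat.lt_or_ge 1 m with h | h
    · have := Nat.pow_pred_clog_lt_self (b := 6) (by norm_num) h
      have h0 : 0 < Nat.clog 6 m := Nat.clog_pos (by norm_num) h
      obtain ⟨c, hc⟩ : ∃ c, Nat.clog 6 m = c + 1 := ⟨Nat.clog 6 m - 1, by omega⟩
      rw [hc] at this ⊢
      rw [pow_succ]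
      simp at this
      omega
    · have : m = 1 := by omega
      subst this
      simp
  obtain ⟨G, hG, hα⟩ := exists_triangleFree_pow k
  let f : Fin m ↪ Fin (6 ^ k) := (Fin.castLEEmb hk1)
  refine ⟨G.comap f, hG.comap (SimpleGraph.Embedding.comap f G).isContained, ?_⟩
  have h1 : ((G.comap f).indepNum : ℝ) ≤ G.indepNum := by exact_mod_cast G.indepNum_comap_le f
  have h2 : (2 : ℝ) ^ k * G.indepNum ≤ 9 ^ k := by exact_mod_cast hα
  have h3 : (G.indepNum : ℝ) ≤ (9 / 2) ^ k := by
    rw [div_pow, le_div_iff₀ (by positivity)]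
    linarith
  refine h1.trans (h3.trans ?_)
  calc ((9 : ℝ) / 2) ^ k = ((6 : ℝ) ^ k) ^ s := by
        rw [← h6s, ← Real.rpow_natCast, ← Real.rpow_natCast, ← Real.rpow_mul (by norm_num),
          ← Real.rpow_mul (by norm_num), mul_comm]
    _ ≤ ((6 : ℝ) * m) ^ s := by
        refine Real.rpow_le_rpow (by positivity) (by exact_mod_cast hk2) hs0.le
    _ = 6 ^ s * (m : ℝ) ^ s := Real.mul_rpow (by norm_num) (by positivity)
    _ ≤ 6 * (m : ℝ) ^ s := by
        gcongr
        rw [h6s]; norm_num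

/-! ### Blow-ups, disjoint unions and joins. -/

theorem SimpleGraph.CliqueFree.comap_fun {V W : Type*} {H : SimpleGraph W} {t : ℕ}
    (hH : H.CliqueFree t) (f : V → W) : (H.comap f).CliqueFree t := by
  classical
  intro s hs
  have hinj : Set.InjOn f s := by
    intro a ha b hb hab
    by_contra hne
    have h : H.Adj (f a) (f b) := hs.isClique ha hb hne
    exact h.ne hab
  refine hH (s.image f) ⟨?_, ?_⟩
  · rintro x hx y hy hxy
    simp only [Finset.coe_image, Set.mem_image] at hx hy
    obtain ⟨a, ha, rfl⟩ := hx
    obtain ⟨b, hb, rfl⟩ := hy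
    exact hs.isClique ha hb (fun h => hxy (by rw [h]))
  · rw [Finset.card_image_of_injOn hinj, hs.card_eq]

theorem blowUp_indepNum_le {V : Type*} [Fintype V] (G : SimpleGraph V) (k : ℕ) :
    (G.comap (Prod.snd : Fin k × V → V)).indepNum ≤ k * G.indepNum := by
  classical
  refine SimpleGraph.indepNum_le_of_forall fun s hs => ?_
  have h : s ⊆ Finset.univ ×ˢ (s.image Prod.snd) := by
    intro p hp
    exact Finset.mem_product.2 ⟨Finset.mem_univ _, Finset.mem_image_of_mem _ hp⟩
  refine (Finset.card_le_card h).trans ?_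
  rw [Finset.card_product, Finset.card_univ, Fintype.card_fin]
  exact Nat.mul_le_mul_left _ hs.image_of_comap.card_le_indepNum

theorem ordTri_blowUp {V : Type*} [Fintype V] (G : SimpleGraph V) (k : ℕ) :
    k ^ 3 * ordTri G ≤ ordTri (G.comap (Prod.snd : Fin k × V → V)) := by
  classical
  have : k ^ 3 * ordTri G = ((Finset.univ : Finset (Fin k × Fin k × Fin k)) ×ˢ
      ({p : V × V × V | G.Adj p.1 p.2.1 ∧ G.Adj p.2.1 p.2.2 ∧ G.Adj p.1 p.2.2} :
        Finset _)).card := by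
    rw [Finset.card_product, Finset.card_univ, ordTri]
    simp only [Fintype.card_prod, Fintype.card_fin]
    congr 1
    ring
  rw [this, ordTri]
  refine Finset.card_le_card_of_injOn
    (fun p => ((p.1.1, p.2.1), (p.1.2.1, p.2.2.1), (p.1.2.2, p.2.2.2))) ?_ ?_
  · intro p hp
    simpa using hp
  · rintro ⟨⟨i, j, k⟩, a, b, c⟩ - ⟨⟨i', j', k'⟩, a', b', c'⟩ - h
    simp only [Prod.mk.injEq] at h ⊢
    tauto

open SimpleGraph in
theorem SimpleGraph.CliqueFree.sum {V W : Type*} {G : SimpleGraph V} {H : SimpleGraph W} {t : ℕ}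
    (hG : G.CliqueFree t) (hH : H.CliqueFree t) : (G ⊕g H).CliqueFree t := by
  classical
  intro s hs
  rcases s.eq_empty_or_nonempty with rfl | ⟨p, hp⟩
  · have := hs.card_eq
    simp only [Finset.card_empty] at this
    subst this
    exact hG ∅ (by simp)
  rcases p with a | b
  · have hl : ∀ q ∈ s, ∃ v, q = Sum.inl v := by
      rintro (v | w) hq
      · exact ⟨v, rfl⟩
      · have := hs.isClique hp hq (by simp)
        simp at this
    refine hG (s.preimage Sum.inl Sum.inl_injective.injOn) ⟨?_, ?_⟩
    · intro x hx y hy hxy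
      have := hs.isClique (x := Sum.inl x) (y := Sum.inl y) (by simpa using hx) (by simpa using hy)
        (by simpa using hxy)
      simpa using this
    · rw [Finset.card_preimage, Finset.filter_true_of_mem, hs.card_eq]
      intro q hq
      obtain ⟨v, rfl⟩ := hl q hq
      exact ⟨v, rfl⟩
  · have hl : ∀ q ∈ s, ∃ v, q = Sum.inr v := by
      rintro (v | w) hq
      · have := hs.isClique hp hq (by simp)
        simp at this
      · exact ⟨w, rfl⟩
    refine hH (s.preimage Sum.inr Sum.inr_injective.injOn) ⟨?_, ?_⟩
    · intro x hx y hy hxy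
      have := hs.isClique (x := Sum.inr x) (y := Sum.inr y) (by simpa using hx) (by simpa using hy)
        (by simpa using hxy)
      simpa using this
    · rw [Finset.card_preimage, Finset.filter_true_of_mem, hs.card_eq]
      intro q hq
      obtain ⟨v, rfl⟩ := hl q hq
      exact ⟨v, rfl⟩

open SimpleGraph in
theorem SimpleGraph.indepNum_sum_le {V W : Type*} [Fintype V] [Fintype W] (G : SimpleGraph V)
    (H : SimpleGraph W) : (G ⊕g H).indepNum ≤ G.indepNum + H.indepNum := by
  classical
  refine SimpleGraph.indepNum_le_of_forall fun s hs => ?_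
  rw [← Finset.card_toLeft_add_card_toRight (u := s)]
  refine Nat.add_le_add (IsIndepSet.card_le_indepNum ?_) (IsIndepSet.card_le_indepNum ?_)
  · intro x hx y hy hxy
    have := hs (x := Sum.inl x) (y := Sum.inl y) (by simpa using hx) (by simpa using hy)
      (by simpa using hxy)
    simpa using this
  · intro x hx y hy hxy
    have := hs (x := Sum.inr x) (y := Sum.inr y) (by simpa using hx) (by simpa using hy)
      (by simpa using hxy)
    simpa using this

open SimpleGraph in
-- The second graph only pads the construction to a prescribed number of vertices.
theorem ordTri_le_ramseyTuran_add {V W : Type*} [Fintype V] [Fintype W] {G : SimpleGraph V}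
    {H : SimpleGraph W} {t : ℕ} {x : ℝ} (hG : G.CliqueFree t) (hH : H.CliqueFree t)
    (hx : (G.indepNum : ℝ) + H.indepNum ≤ x) :
    ordTri G ≤ 6 * ramseyTuran 3 t (Fintype.card V + Fintype.card W) x := by
  rw [← Fintype.card_sum]
  refine (ordTri_mono_hom (Embedding.sumInl (G := G) (H := H))).trans
    (ordTri_le_ramseyTuran _ (hG.sum hH) (le_trans ?_ hx))
  exact_mod_cast G.indepNum_sum_le H

/-- The join of `ℓ` copies of the graph `T`. -/
def joinCopies {V : Type*} (T : SimpleGraph V) (ℓ : ℕ) : SimpleGraph (Fin ℓ × V) where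
  Adj p q := p.1 ≠ q.1 ∨ T.Adj p.2 q.2
  symm := ⟨fun _ _ h => h.imp Ne.symm SimpleGraph.Adj.symm⟩
  loopless := ⟨fun _ h => h.elim (fun h => h rfl) (fun h => h.ne rfl)⟩

/-- By pigeonhole, `2ℓ+1` clique vertices put three into one copy, where they form a triangle of
`T`. -/
theorem joinCopies_cliqueFree {V : Type*} {T : SimpleGraph V} (hT : T.CliqueFree 3) (ℓ : ℕ) :
    (joinCopies T ℓ).CliqueFree (2 * ℓ + 1) := by
  classical
  intro s hs
  obtain ⟨i, -, hi⟩ := Finset.exists_lt_card_fiber_of_mul_lt_card_of_maps_to (s := s)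
    (t := (Finset.univ : Finset (Fin ℓ))) (f := Prod.fst) (n := 2) (fun _ _ => Finset.mem_univ _)
    (by rw [hs.card_eq, Finset.card_univ, Fintype.card_fin]; omega)
  obtain ⟨a, b, c, ha, hb, hc, hab, hac, hbc⟩ := Finset.two_lt_card_iff.1 hi
  simp only [Finset.mem_filter] at ha hb hc
  have key : ∀ {p q : Fin ℓ × V}, p ∈ s → q ∈ s → p ≠ q → p.1 = q.1 → T.Adj p.2 q.2 := by
    intro p q hp hq hpq h
    exact (hs.isClique hp hq hpq).resolve_left (fun h' => h' h)
  exact hT {a.2, b.2, c.2} (SimpleGraph.is3Clique_triple_iff.2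
    ⟨key ha.1 hb.1 hab (ha.2.trans hb.2.symm), key ha.1 hc.1 hac (ha.2.trans hc.2.symm),
      key hb.1 hc.1 hbc (hb.2.trans hc.2.symm)⟩)

/-- Different copies are completely joined, so an independent set lies in a single copy. -/
theorem joinCopies_indepNum_le {V : Type*} [Fintype V] (T : SimpleGraph V) (ℓ : ℕ) :
    (joinCopies T ℓ).indepNum ≤ T.indepNum := by
  classical
  refine SimpleGraph.indepNum_le_of_forall fun s hs => ?_
  have h1 : ∀ p ∈ s, ∀ q ∈ s, p.1 = q.1 := by
    intro p hp q hq
    by_contra h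
    exact hs hp hq (fun h' => h (by rw [h'])) (Or.inl h)
  have h2 : Set.InjOn Prod.snd (s : Set (Fin ℓ × V)) := by
    intro p hp q hq h
    exact Prod.ext (h1 p hp q hq) h
  rw [← Finset.card_image_of_injOn h2]
  apply SimpleGraph.IsIndepSet.card_le_indepNum
  rintro x hx y hy hxy hadj
  simp only [Finset.coe_image, Set.mem_image] at hx hy
  obtain ⟨a, ha, rfl⟩ := hx
  obtain ⟨b, hb, rfl⟩ := hy
  exact hs ha hb (fun h => hxy (by rw [h])) (Or.inr hadj)

/-- Any three vertices from three distinct copies form a triangle; `descFactorial` counts the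
ordered choices of copies. -/
theorem ordTri_joinCopies {V : Type*} [Fintype V] (T : SimpleGraph V) (ℓ : ℕ) :
    ℓ.descFactorial 3 * Fintype.card V ^ 3 ≤ ordTri (joinCopies T ℓ) := by
  classical
  have : ℓ.descFactorial 3 * Fintype.card V ^ 3 =
      ((Finset.univ : Finset ((Fin 3 ↪ Fin ℓ) × (Fin 3 → V)))).card := by
    rw [Finset.card_univ, Fintype.card_prod, Fintype.card_embedding_eq]
    simp
  rw [this, ordTri]
  refine Finset.card_le_card_of_injOn
    (fun p => ((p.1 0, p.2 0), (p.1 1, p.2 1), (p.1 2, p.2 2))) ?_ ?_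
  · intro p _
    simp only [Finset.coe_filter, Finset.mem_univ, true_and, Set.mem_ofPred_eq]
    refine ⟨Or.inl ?_, Or.inl ?_, Or.inl ?_⟩ <;> simp
  · rintro ⟨f, g⟩ - ⟨f', g'⟩ - h
    simp only [Prod.mk.injEq] at h ⊢
    constructor
    · ext i
      fin_cases i <;> simp [h]
    · ext i
      fin_cases i <;> simp [h]

/-- The `n % ℓ` leftover vertices are added as isolated ones, which costs at most `ℓ` in the
independence number. -/
theorem join_le_ramseyTuran (ℓ : ℕ) (hℓ : 0 < ℓ) :
    ∃ s : ℝ, 0 < s ∧ s < 1 ∧ ∀ (n : ℕ) (x : ℝ), 6 * (n : ℝ) ^ s + ℓ ≤ x →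
      ℓ.descFactorial 3 * (n / ℓ) ^ 3 ≤ 6 * ramseyTuran 3 (2 * ℓ + 1) n x := by
  obtain ⟨s, hs0, hs1, h⟩ := exists_triangleFree_indepNum_le_rpow
  refine ⟨s, hs0, hs1, fun n x hx => ?_⟩
  rcases Nat.eq_zero_or_pos (n / ℓ) with h0 | h0
  · simp [h0]
  obtain ⟨T, hT, hα⟩ := h _ h0
  have h1 := ordTri_joinCopies T ℓ
  rw [Fintype.card_fin] at h1
  refine h1.trans ?_
  have hn : n = Fintype.card (Fin ℓ × Fin (n / ℓ)) + Fintype.card (Fin (n % ℓ)) := by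
    simp [Nat.div_add_mod]
  have h2 := ordTri_le_ramseyTuran_add (joinCopies_cliqueFree hT ℓ)
    (H := (⊥ : SimpleGraph (Fin (n % ℓ)))) (x := x)
    (SimpleGraph.cliqueFree_bot (by omega)) ?_
  · rwa [← hn] at h2
  refine le_trans ?_ hx
  have h3 : ((joinCopies T ℓ).indepNum : ℝ) ≤ T.indepNum := by
    exact_mod_cast joinCopies_indepNum_le T ℓ
  have h4 : ((⊥ : SimpleGraph (Fin (n % ℓ))).indepNum : ℝ) ≤ ℓ := by
    have : (⊥ : SimpleGraph (Fin (n % ℓ))).indepNum ≤ ℓ :=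
      SimpleGraph.indepNum_le_of_forall fun s _ => (Finset.card_le_univ s).trans (by
        rw [Fintype.card_fin]; exact (Nat.mod_lt _ hℓ).le)
    exact_mod_cast this
  have h5 : ((n / ℓ : ℕ) : ℝ) ^ s ≤ (n : ℝ) ^ s :=
    Real.rpow_le_rpow (by positivity) (by exact_mod_cast Nat.div_le_self n ℓ) hs0.le
  linarith

/-! ### Superadditivity and existence of the limiting density. -/

/-- A `k`-fold blow-up scales the order and the independence bound by `k` and the ordered triangles
by `k^3`. The `M` padding vertices may only add `εM` to the independence number, so they carry a
triangle-free graph with sublinear independence number; this exists once `M` is large. -/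
theorem ramseyTuran_superadditive {t : ℕ} (ht : 3 ≤ t) {ε : ℝ} (hε : 0 < ε) :
    ∃ M₀ : ℕ, ∀ M ≥ M₀, ∀ k n : ℕ,
      k ^ 3 * ramseyTuran 3 t n (ε * n) ≤ ramseyTuran 3 t (k * n + M) (ε * (k * n + M : ℕ)) := by
  obtain ⟨s, hs0, hs1, h⟩ := exists_triangleFree_indepNum_le_rpow
  have hlim : ∀ᶠ m : ℕ in atTop, 6 * (m : ℝ) ^ s ≤ ε * m ∧ 0 < m := by
    have h1 : Tendsto (fun m : ℕ => (m : ℝ) ^ (1 - s)) atTop atTop :=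
      (tendsto_rpow_atTop (by linarith)).comp tendsto_natCast_atTop_atTop
    filter_upwards [h1.eventually_ge_atTop (6 / ε), eventually_gt_atTop 0] with m hm hm0
    refine ⟨?_, hm0⟩
    have hmr : (0 : ℝ) < m := by exact_mod_cast hm0
    rw [div_le_iff₀ hε] at hm
    have e : (m : ℝ) = (m : ℝ) ^ (1 - s) * (m : ℝ) ^ s := by
      rw [← Real.rpow_add hmr]; simp
    calc 6 * (m : ℝ) ^ s ≤ ((m : ℝ) ^ (1 - s) * ε) * (m : ℝ) ^ s := by gcongr
      _ = ε * ((m : ℝ) ^ (1 - s) * (m : ℝ) ^ s) := by ring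
      _ = ε * m := by rw [← e]
  obtain ⟨M₀, hM₀⟩ := eventually_atTop.1 hlim
  refine ⟨M₀, fun M hM k n => ?_⟩
  obtain ⟨h1, h2⟩ := hM₀ M hM
  obtain ⟨H, hH, hα⟩ := h M h2
  rcases Nat.eq_zero_or_pos (ramseyTuran 3 t n (ε * n)) with h0 | h0
  · simp [h0]
  obtain ⟨G, hG, hGα, hGt⟩ := exists_graph_of_ramseyTuran_pos h0
  have h3 := ordTri_le_ramseyTuran_add (G := G.comap (Prod.snd : Fin k × Fin n → Fin n)) (H := H)
    (x := ε * (k * n + M : ℕ)) (hG.comap_fun _) (hH.mono ht) ?_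
  · have h4 := (ordTri_blowUp G k).trans h3
    rw [hGt] at h4
    simp only [Fintype.card_prod, Fintype.card_fin] at h4
    have : 6 * (k ^ 3 * ramseyTuran 3 t n (ε * n)) ≤
      6 * ramseyTuran 3 t (k * n + M) (ε * (k * n + M : ℕ)) := by linarith
    exact Nat.le_of_mul_le_mul_left this (by norm_num)
  · have h5 : ((G.comap (Prod.snd : Fin k × Fin n → Fin n)).indepNum : ℝ) ≤ k * G.indepNum := by
      exact_mod_cast blowUp_indepNum_le G k
    have h6 : (k : ℝ) * G.indepNum ≤ k * (ε * n) := by gcongr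
    push_cast
    linarith

theorem ramseyTuran_le_cube (t n : ℕ) (x : ℝ) : (ramseyTuran 3 t n x : ℝ) ≤ (n : ℝ) ^ 3 := by
  classical
  refine ramseyTuran_le (by positivity) fun G _ _ => ?_
  have : ordTri G ≤ n ^ 3 := by
    unfold ordTri
    refine (Finset.card_le_univ _).trans (le_of_eq ?_)
    simp only [Fintype.card_prod, Fintype.card_fin]
    ring
  have h : (ordTri G : ℝ) ≤ (n : ℝ) ^ 3 := by exact_mod_cast this
  have : (0 : ℝ) ≤ (n : ℝ) ^ 3 := by positivity
  linarith

/-- The triangle density of the extremal graphs with independence number at most `ε n`. -/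
noncomputable def rtDensity (t : ℕ) (ε : ℝ) : ℝ :=
  ⨆ n : ℕ, (ramseyTuran 3 t n (ε * (n : ℝ)) : ℝ) / (n : ℝ) ^ 3

theorem rtDensity_bddAbove (t : ℕ) (ε : ℝ) :
    BddAbove (Set.range fun n : ℕ => (ramseyTuran 3 t n (ε * (n : ℝ)) : ℝ) / (n : ℝ) ^ 3) := by
  refine ⟨1, ?_⟩
  rintro _ ⟨n, rfl⟩
  exact div_le_one_of_le₀ (ramseyTuran_le_cube _ _ _) (by positivity)

/-- A Fekete argument: choose `m` nearly attaining the supremum and write each large `n` as `k m +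
M` with `M₀ ≤ M < M₀ + m`. The bounded remainder does not affect the limit. -/
theorem tendsto_rtDensity {t : ℕ} (ht : 3 ≤ t) {ε : ℝ} (hε : 0 < ε) :
    Tendsto (fun n : ℕ => (ramseyTuran 3 t n (ε * (n : ℝ)) : ℝ) / (n : ℝ) ^ 3) atTop
      (𝓝 (rtDensity t ε)) := by
  obtain ⟨M₀, hM⟩ := ramseyTuran_superadditive ht hε
  refine tendsto_order.2 ⟨fun b hb => ?_, fun b hb => Eventually.of_forall fun n =>
    (le_ciSup (rtDensity_bddAbove t ε) n).trans_lt hb⟩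
  obtain ⟨m, hm⟩ := exists_lt_of_lt_ciSup hb
  rcases Nat.eq_zero_or_pos m with rfl | hm0
  -- At `m = 0` the quotient is `0` by convention, and every later quotient is at least that.
  · simp only [CharP.cast_eq_zero, ne_eq, OfNat.ofNat_ne_zero, not_false_eq_true, zero_pow,
      div_zero] at hm
    exact Eventually.of_forall fun n => hm.trans_le (by positivity)
  set a : ℝ := (ramseyTuran 3 t m (ε * (m : ℝ)) : ℝ) / (m : ℝ) ^ 3 with ha
  have hmr : (0 : ℝ) < m := by exact_mod_cast hm0
  have hl : Tendsto (fun n : ℕ => (1 - ((M₀ + m : ℕ) : ℝ) / n) ^ 3 * a) atTop (𝓝 ((1 - 0) ^ 3 * a)) :=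
    (((tendsto_const_nhds).sub (tendsto_const_div_atTop_nhds_zero_nat _)).pow 3).mul_const a
  have hl' := (tendsto_order.1 hl).1 b (by simpa using hm)
  filter_upwards [hl', eventually_gt_atTop (M₀ + m)] with n hn hnM
  refine hn.trans_le ?_
  have hnr : (0 : ℝ) < n := by exact_mod_cast (by omega : 0 < n)
  set k := (n - M₀) / m with hk
  have hk1 : k * m ≤ n - M₀ := Nat.div_mul_le_self _ _
  have hk2 : n - M₀ < k * m + m := by
    have := Nat.lt_div_mul_add (a := n - M₀) hm0
    rw [hk]
    omega
  have h1 := hM (n - k * m) (by omega) k m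
  rw [show k * m + (n - k * m) = n by omega] at h1
  have h2 : (k : ℝ) ^ 3 * ramseyTuran 3 t m (ε * m) ≤ ramseyTuran 3 t n (ε * n) := by
    exact_mod_cast h1
  rw [le_div_iff₀ (by positivity)]
  refine le_trans ?_ h2
  have h3 : (n : ℝ) - (M₀ + m : ℕ) ≤ k * m := by
    have : n ≤ k * m + (M₀ + m) := by omega
    have : (n : ℝ) ≤ ((k * m + (M₀ + m) : ℕ) : ℝ) := by exact_mod_cast this
    push_cast at this ⊢
    linarith
  have h4 : (0 : ℝ) ≤ (n : ℝ) - (M₀ + m : ℕ) := by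
    have : ((M₀ + m : ℕ) : ℝ) ≤ n := by exact_mod_cast hnM.le
    linarith
  have e : (1 - ((M₀ + m : ℕ) : ℝ) / n) ^ 3 * a * (n : ℝ) ^ 3 =
      ((n : ℝ) - (M₀ + m : ℕ)) ^ 3 * a := by
    field_simp
  rw [e]
  calc ((n : ℝ) - (M₀ + m : ℕ)) ^ 3 * a ≤ (k * m) ^ 3 * a := by gcongr
    _ = _ := by rw [ha]; field_simp

/-! ### Polynomial inequalities behind the tangent-line bound. -/

/-- The case of a class of two twins, `y` being the mass of the class. The restriction `y ≤ 2/3`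
matters: at `z = 1/3`, `y = 1` the left side equals `1/18`. This is why maximizers are first shown
to have no coordinate above `1/3`. -/
theorem tangent_two {y z : ℝ} (hy1 : y ≤ 2 / 3) (hz1 : z ≤ 1 / 3) :
    -(9 / 4) * y ^ 2 + 5 / 4 * y ^ 3 + 6 * z * (1 - z) * y - (3 * z ^ 2 - 4 * z ^ 3) * (3 / 2) ≤ 0 := by
  have h1 : 0 ≤ 2 / 3 - y := by linarith
  have h2 : 0 ≤ 1 / 3 - z := by linarith
  nlinarith [mul_nonneg h1 (sq_nonneg (y - 4 / 3 * z)), mul_nonneg h2 (sq_nonneg (y - 4 / 3 *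
    z)), mul_nonneg h2 (sq_nonneg z), mul_nonneg h1 (sq_nonneg z), mul_nonneg h1 (sq_nonneg (y -
    z)), mul_nonneg h2 (sq_nonneg (y - z)), mul_nonneg h1 (sq_nonneg (y - 2 * z)), mul_nonneg h2
    (sq_nonneg (y - 2 * z)), mul_nonneg h1 (sq_nonneg y), mul_nonneg h2 (sq_nonneg y), sq_nonneg
    (y - 4 / 3 * z), sq_nonneg (y - z)]

theorem tangent_three {y z : ℝ} (hy1 : y ≤ 1) (hz1 : z ≤ 1 / 3) :
    -2 * y ^ 2 + 37 / 36 * y ^ 3 + 6 * z * (1 - z) * y - (3 * z ^ 2 - 4 * z ^ 3) * 2 ≤ 0 := by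
  have h1 : 0 ≤ 1 - y := by linarith
  have h2 : 0 ≤ 1 / 3 - z := by linarith
  nlinarith [mul_nonneg h1 (sq_nonneg (y - 3 / 2 * z)), mul_nonneg h2 (sq_nonneg (y - 3 / 2 *
    z)), mul_nonneg h2 (sq_nonneg z), mul_nonneg h1 (sq_nonneg z), mul_nonneg h1 (sq_nonneg (y -
    z)), mul_nonneg h2 (sq_nonneg (y - z)), mul_nonneg h1 (sq_nonneg (y - 2 * z)), mul_nonneg h2
    (sq_nonneg (y - 2 * z)), mul_nonneg h1 (sq_nonneg y), mul_nonneg h2 (sq_nonneg y), sq_nonneg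
    (y - 3 / 2 * z), mul_nonneg h1 (sq_nonneg (y - 3 * z)), mul_nonneg h2 (sq_nonneg (y - 3 * z))]

/-- This serves all classes of at least four twins; the terms that depend on the size of the class
are split off in `tangent_class`. -/
theorem tangent_four {y z : ℝ} (hy1 : y ≤ 1) (hz1 : z ≤ 1 / 3) :
    -(3 / 2) * y ^ 2 + 5 / 8 * y ^ 3 + 6 * z * (1 - z) * y - (3 * z ^ 2 - 4 * z ^ 3) * (5 / 2) ≤ 0 := by
  have h1 : 0 ≤ 1 - y := by linarith
  have h2 : 0 ≤ 1 / 3 - z := by linarith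
  nlinarith [mul_nonneg h1 (sq_nonneg (y - 3 / 2 * z)), mul_nonneg h2 (sq_nonneg (y - 3 / 2 *
    z)), mul_nonneg h2 (sq_nonneg z), mul_nonneg h1 (sq_nonneg z), mul_nonneg h1 (sq_nonneg (y -
    z)), mul_nonneg h2 (sq_nonneg (y - z)), mul_nonneg h1 (sq_nonneg (y - 2 * z)), mul_nonneg h2
    (sq_nonneg (y - 2 * z)), mul_nonneg h1 (sq_nonneg y), mul_nonneg h2 (sq_nonneg y), sq_nonneg
    (y - 3 / 2 * z), mul_nonneg h1 (sq_nonneg (y - 3 * z)), mul_nonneg h2 (sq_nonneg (y - 3 * z))]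

theorem eq_add_single_add_single {ι : Type*} [DecidableEq ι] {u v : ι} (huv : u ≠ v) (x : ι → ℝ) :
    ∃ r : ι → ℝ, x = r + Pi.single u (x u) + Pi.single v (x v) ∧ r u = 0 ∧ r v = 0 ∧
      ∀ c, c ≠ u → c ≠ v → r c = x c := by
  refine ⟨fun c => if c = u then 0 else if c = v then 0 else x c, ?_, by simp, by simp, ?_⟩
  · ext c
    by_cases h1 : c = u
    · subst h1
      simp [huv]
    · by_cases h2 : c = v
      · subst h2
        simp [Ne.symm huv]
      · simp [h1, h2]
  · intro c h1 h2
    simp [h1, h2]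

/-! ### The weighted triangle form and symmetrization. -/

section TriForm
variable {ι : Type*} [Fintype ι] [DecidableEq ι]

/-- The cubic form counting weighted triangles. -/
def triForm {ι : Type*} [Fintype ι] (w : ι → ι → ℝ) (x : ι → ℝ) : ℝ :=
  ∑ a, ∑ b, ∑ c, w a b * w b c * w a c * (x a * x b * x c)

/-- The quadratic form counting weighted triangles through `u`. -/
def linkForm {ι : Type*} [Fintype ι] (w : ι → ι → ℝ) (u : ι) (x : ι → ℝ) : ℝ :=
  ∑ b, ∑ c, w u b * w b c * w u c * (x b * x c)

/-- The linear form counting weighted triangles through `u` and `v`. -/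
def pairForm {ι : Type*} [Fintype ι] (w : ι → ι → ℝ) (u v : ι) (x : ι → ℝ) : ℝ :=
  ∑ c, w u c * w v c * x c

/-- The vanishing diagonal forbids a repeated vertex in a triangle, so the form is affine in every
single coordinate. -/
theorem triForm_add_single {w : ι → ι → ℝ} (hs : ∀ a b, w a b = w b a) (h0 : ∀ a, w a a = 0)
    (u : ι) (p : ℝ) (r : ι → ℝ) :
    triForm w (r + Pi.single u p) = triForm w r + 3 * p * linkForm w u r := by
  have hx : ∀ a, (r + Pi.single u p : ι → ℝ) a = r a + if a = u then p else 0 := by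
    intro a
    simp [Pi.single_apply]
  have e1 : ∀ a b c, w a b * w b c * w a c * ((r a + if a = u then p else 0) *
      (r b + if b = u then p else 0) * (r c + if c = u then p else 0)) =
      w a b * w b c * w a c * (r a * r b * r c) +
      (if a = u then w a b * w b c * w a c * (p * r b * r c) else 0) +
      (if b = u then w a b * w b c * w a c * (r a * p * r c) else 0) +
      (if c = u then w a b * w b c * w a c * (r a * r b * p) else 0) := by
    intro a b c
    split_ifs <;> subst_vars <;> simp [h0] <;> ring
  simp only [triForm, hx, e1, Finset.sum_add_distrib]
  have s1 : ∑ a, ∑ b, ∑ c, (if a = u then w a b * w b c * w a c * (p * r b * r c) else 0) =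
      p * linkForm w u r := by
    rw [Finset.sum_eq_single u (by intro a _ ha; simp [ha]) (by simp)]
    simp only [if_true, linkForm, Finset.mul_sum]
    refine Finset.sum_congr rfl fun b _ => Finset.sum_congr rfl fun c _ => by ring
  have s2 : ∑ a, ∑ b, ∑ c, (if b = u then w a b * w b c * w a c * (r a * p * r c) else 0) =
      p * linkForm w u r := by
    simp only [linkForm, Finset.mul_sum]
    refine Finset.sum_congr rfl fun a _ => ?_
    rw [Finset.sum_eq_single u (by intro b _ hb; simp [hb]) (by simp)]
    refine Finset.sum_congr rfl fun c _ => ?_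
    rw [if_pos rfl, hs a u]
    ring
  have s3 : ∑ a, ∑ b, ∑ c, (if c = u then w a b * w b c * w a c * (r a * r b * p) else 0) =
      p * linkForm w u r := by
    simp only [linkForm, Finset.mul_sum]
    refine Finset.sum_congr rfl fun a _ => Finset.sum_congr rfl fun b _ => ?_
    rw [Finset.sum_eq_single u (by intro b _ hb; simp [hb]) (by simp), if_pos rfl, hs a u, hs b u]
    ring
  rw [s1, s2, s3]
  ring

theorem linkForm_add_single {w : ι → ι → ℝ} (hs : ∀ a b, w a b = w b a) (h0 : ∀ a, w a a = 0)
    (u v : ι) (p : ℝ) (r : ι → ℝ) :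
    linkForm w v (r + Pi.single u p) = linkForm w v r + 2 * p * w u v * pairForm w u v r := by
  have hx : ∀ a, (r + Pi.single u p : ι → ℝ) a = r a + if a = u then p else 0 := by
    intro a
    simp [Pi.single_apply]
  have e1 : ∀ b c, w v b * w b c * w v c * ((r b + if b = u then p else 0) *
      (r c + if c = u then p else 0)) =
      w v b * w b c * w v c * (r b * r c) +
      (if b = u then w v b * w b c * w v c * (p * r c) else 0) +
      (if c = u then w v b * w b c * w v c * (r b * p) else 0) := by
    intro b c
    split_ifs <;> subst_vars <;> simp [h0] <;> ring
  simp only [linkForm, hx, e1, Finset.sum_add_distrib]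
  have s2 : ∑ b, ∑ c, (if b = u then w v b * w b c * w v c * (p * r c) else 0) =
      p * w u v * pairForm w u v r := by
    rw [Finset.sum_eq_single u (by intro b _ hb; simp [hb]) (by simp)]
    simp only [if_true, pairForm, Finset.mul_sum]
    refine Finset.sum_congr rfl fun c _ => ?_
    rw [hs v u]
    ring
  have s3 : ∑ b, ∑ c, (if c = u then w v b * w b c * w v c * (r b * p) else 0) =
      p * w u v * pairForm w u v r := by
    simp only [pairForm, Finset.mul_sum]
    refine Finset.sum_congr rfl fun b _ => ?_
    rw [Finset.sum_eq_single u (by intro b _ hb; simp [hb]) (by simp), if_pos rfl, hs v u, hs b u]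
    ring
  rw [s2, s3]
  ring

theorem triForm_add_single_add_single {w : ι → ι → ℝ} (hs : ∀ a b, w a b = w b a)
    (h0 : ∀ a, w a a = 0) (u v : ι) (p q : ℝ) (r : ι → ℝ) :
    triForm w (r + Pi.single u p + Pi.single v q) = triForm w r + 3 * p * linkForm w u r +
      3 * q * linkForm w v r + 6 * p * q * w u v * pairForm w u v r := by
  rw [triForm_add_single hs h0, triForm_add_single hs h0, linkForm_add_single hs h0]
  ring

/-- Mass can be moved onto the support of a clique without decreasing the number of triangles. -/
theorem exists_clique_support {w : ι → ι → ℝ} (hs : ∀ a b, w a b = w b a) (h0 : ∀ a, w a a = 0)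
    (x : ι → ℝ) (hx : ∀ a, 0 ≤ x a) :
    ∃ y : ι → ℝ, (∀ a, 0 ≤ y a) ∧ ∑ a, y a = ∑ a, x a ∧ triForm w x ≤ triForm w y ∧
      ∀ a b, a ≠ b → y a ≠ 0 → y b ≠ 0 → w a b ≠ 0 := by
  induction hn : (Finset.univ.filter fun a => x a ≠ 0).card using Nat.strong_induction_on
    generalizing x with
  | _ n ih =>
    by_cases hc : ∀ a b, a ≠ b → x a ≠ 0 → x b ≠ 0 → w a b ≠ 0
    · exact ⟨x, hx, rfl, le_rfl, hc⟩
    push Not at hc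
    obtain ⟨u, v, huv, hu, hv, hw⟩ := hc
    have main : ∀ u v, u ≠ v → x u ≠ 0 → x v ≠ 0 → w u v = 0 →
        (∀ r : ι → ℝ, x = r + Pi.single u (x u) + Pi.single v (x v) →
          linkForm w v r ≤ linkForm w u r) →
        ∃ y : ι → ℝ, (∀ a, 0 ≤ y a) ∧ ∑ a, y a = ∑ a, x a ∧ triForm w x ≤ triForm w y ∧
          ∀ a b, a ≠ b → y a ≠ 0 → y b ≠ 0 → w a b ≠ 0 := by
      intro u v huv hu hv hw hl
      obtain ⟨r, hr, hru, hrv, hrc⟩ := eq_add_single_add_single huv x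
      have hl := hl r hr
      have hr0 : ∀ a, 0 ≤ r a := by
        intro a
        by_cases h1 : a = u
        · rw [h1, hru]
        · by_cases h2 : a = v
          · rw [h2, hrv]
          · rw [hrc a h1 h2]
            exact hx a
      -- Zykov symmetrization: as `w u v = 0`, no triangle uses both vertices, and the form is
      -- linear in the way the mass `x u + x v` is divided. All of it goes to `u`, the vertex with
      -- the larger link, and the support shrinks.
      obtain ⟨y, hy0, hy1, hy2, hy3⟩ := ih _ (by
        rw [← hn]
        apply Finset.card_lt_card
        refine Finset.ssubset_iff_of_subset ?_ |>.2 ⟨v, by simpa using hv, ?_⟩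
        · intro a
          simp only [Finset.mem_filter, Finset.mem_univ, true_and, Pi.add_apply]
          contrapose!
          intro ha
          have hau : a ≠ u := by rintro rfl; exact hu ha
          have hav : a ≠ v := by rintro rfl; exact hv ha
          have : r a = 0 := by rw [hrc a hau hav, ha]
          simp [this, hau]
        · simp [hrv, Ne.symm huv]) (r + Pi.single u (x u + x v)) (by
          intro a
          have h1 := hx u
          have h2 := hx v
          have h3 := hr0 a
          rw [Pi.add_apply, Pi.single_apply]
          split_ifs <;> linarith) rfl
      refine ⟨y, hy0, ?_, le_trans ?_ hy2, hy3⟩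
      · rw [hy1]
        conv_rhs => rw [hr]
        simp only [Pi.add_apply, Finset.sum_add_distrib, Finset.sum_pi_single', Finset.mem_univ,
          if_true]
        ring
      · conv_lhs => rw [hr]
        rw [triForm_add_single_add_single hs h0, triForm_add_single hs h0, hw]
        nlinarith [mul_le_mul_of_nonneg_left hl (hx v)]
    obtain ⟨r, hr, hru, hrv, hrc⟩ := eq_add_single_add_single huv x
    have huniq : ∀ r' : ι → ℝ, x = r' + Pi.single u (x u) + Pi.single v (x v) → r' = r := by
      intro r' h
      have : r' + Pi.single u (x u) + Pi.single v (x v) =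
        r + Pi.single u (x u) + Pi.single v (x v) := h.symm.trans hr
      exact add_right_cancel (add_right_cancel this)
    rcases le_total (linkForm w v r) (linkForm w u r) with h | h
    · exact main u v huv hu hv hw fun r' hr' => by rw [huniq r' hr']; exact h
    · refine main v u huv.symm hv hu (by rw [hs, hw]) fun r' hr' => ?_
      rw [huniq r' (hr'.trans (add_right_comm _ _ _))]
      exact h

end TriForm

/-! ### Half-edge graphs and their maximizers. -/

open Classical in
/-- The weights of a complete weighted graph: `1 / 2` on the edges of `H`, and `1` otherwise. -/
noncomputable def halfWeight {κ : Type*} (H : SimpleGraph κ) (a b : κ) : ℝ :=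
  if a = b then 0 else if H.Adj a b then 1 / 2 else 1

section HalfWeight
variable {κ : Type*} {H : SimpleGraph κ}

@[simp] theorem halfWeight_self (a : κ) : halfWeight H a a = 0 := by simp [halfWeight]

theorem halfWeight_congr {κ' : Type*} {H' : SimpleGraph κ'} {a b : κ} {a' b' : κ'}
    (h : a = b ↔ a' = b') (h' : H.Adj a b ↔ H'.Adj a' b') :
    halfWeight H a b = halfWeight H' a' b' := by
  unfold halfWeight
  split_ifs <;> first | rfl | tauto

theorem halfWeight_comm (a b : κ) : halfWeight H a b = halfWeight H b a :=
  halfWeight_congr eq_comm (H.adj_comm a b)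

theorem halfWeight_of_adj {a b : κ} (h : H.Adj a b) : halfWeight H a b = 1 / 2 := by
  simp [halfWeight, h.ne, h]

theorem halfWeight_of_not_adj {a b : κ} (hab : a ≠ b) (h : ¬H.Adj a b) : halfWeight H a b = 1 := by
  simp [halfWeight, hab, h]

theorem halfWeight_nonneg (a b : κ) : 0 ≤ halfWeight H a b := by
  unfold halfWeight
  split_ifs <;> norm_num

theorem halfWeight_eq_or {a b : κ} (hab : a ≠ b) :
    halfWeight H a b = 1 / 2 ∨ halfWeight H a b = 1 := by
  by_cases h : H.Adj a b
  · exact Or.inl (halfWeight_of_adj h)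
  · exact Or.inr (halfWeight_of_not_adj hab h)

end HalfWeight

theorem triForm_nonneg {ι : Type*} [Fintype ι] {w : ι → ι → ℝ} (hw : ∀ a b, 0 ≤ w a b) {x : ι → ℝ}
    (hx : ∀ a, 0 ≤ x a) : 0 ≤ triForm w x :=
  Finset.sum_nonneg fun _ _ => Finset.sum_nonneg fun _ _ => Finset.sum_nonneg fun _ _ =>
    mul_nonneg (mul_nonneg (mul_nonneg (hw _ _) (hw _ _)) (hw _ _))
      (mul_nonneg (mul_nonneg (hx _) (hx _)) (hx _))

theorem linkForm_nonneg {ι : Type*} [Fintype ι] {w : ι → ι → ℝ} (hw : ∀ a b, 0 ≤ w a b) {x : ι → ℝ}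
    (hx : ∀ a, 0 ≤ x a) (u : ι) : 0 ≤ linkForm w u x :=
  Finset.sum_nonneg fun _ _ => Finset.sum_nonneg fun _ _ =>
    mul_nonneg (mul_nonneg (mul_nonneg (hw _ _) (hw _ _)) (hw _ _)) (mul_nonneg (hx _) (hx _))

theorem triForm_smul {ι : Type*} [Fintype ι] (w : ι → ι → ℝ) (s : ℝ) (x : ι → ℝ) :
    triForm w (s • x) = s ^ 3 * triForm w x := by
  simp only [triForm, Finset.mul_sum, Pi.smul_apply, smul_eq_mul]
  refine Finset.sum_congr rfl fun a _ => Finset.sum_congr rfl fun b _ =>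
    Finset.sum_congr rfl fun c _ => by ring

theorem linkForm_smul {ι : Type*} [Fintype ι] (w : ι → ι → ℝ) (u : ι) (s : ℝ) (x : ι → ℝ) :
    linkForm w u (s • x) = s ^ 2 * linkForm w u x := by
  simp only [linkForm, Finset.mul_sum, Pi.smul_apply, smul_eq_mul]
  refine Finset.sum_congr rfl fun b _ => Finset.sum_congr rfl fun c _ => by ring

/-- A maximizer with a positive value has no coordinate above `1 / 3`. -/
theorem le_third_of_isMax {ι : Type*} [Fintype ι] [DecidableEq ι] {w : ι → ι → ℝ}
    (hs : ∀ a b, w a b = w b a) (h0 : ∀ a, w a a = 0) (hw : ∀ a b, 0 ≤ w a b) {x : ι → ℝ}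
    (hx : ∀ a, 0 ≤ x a) (hx1 : ∑ a, x a = 1) (hpos : 0 < triForm w x)
    (hmax : ∀ y : ι → ℝ, (∀ a, 0 ≤ y a) → ∑ a, y a = 1 → triForm w y ≤ triForm w x) (i : ι) :
    x i ≤ 1 / 3 := by
  by_contra! hi
  let r : ι → ℝ := fun c => if c = i then 0 else x c
  have hr : x = r + Pi.single i (x i) := by
    ext c
    by_cases h : c = i
    · subst h; simp [r]
    · simp [r, h]
  have hr0 : ∀ a, 0 ≤ r a := by
    intro a
    simp only [r]
    split_ifs
    · exact le_rfl
    · exact hx a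
  have hrs : ∑ a, r a = 1 - x i := by
    have : ∑ a, x a = ∑ a, r a + x i := by
      conv_lhs => rw [hr]
      simp [Finset.sum_add_distrib]
    linarith
  have hf : triForm w x = triForm w r + 3 * x i * linkForm w i r := by
    conv_lhs => rw [hr]
    exact triForm_add_single hs h0 i _ r
  have hR := triForm_nonneg hw hr0
  have hA := linkForm_nonneg hw hr0 i
  have hle : 0 ≤ 1 - x i := hrs ▸ Finset.sum_nonneg fun a _ => hr0 a
  rcases hle.eq_or_lt with h1 | h1
  · have : r = 0 := by
      ext a
      have := (Finset.sum_eq_zero_iff_of_nonneg (fun a _ => hr0 a)).1 (hrs.trans h1.symm) a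
        (Finset.mem_univ _)
      simpa using this
    rw [hf, this] at hpos
    simp [triForm, linkForm] at hpos
  -- The competitor gives `i` the mass `1/3` and rescales the rest to total `2/3`.
  set s : ℝ := (2 / 3) / (1 - x i) with hsdef
  have hs1 : 1 < s := by
    rw [hsdef, lt_div_iff₀ h1]
    linarith
  have hy := hmax (s • r + Pi.single i (1 / 3)) (by
    intro a
    rw [Pi.add_apply, Pi.single_apply, Pi.smul_apply, smul_eq_mul]
    have := mul_nonneg (by linarith : 0 ≤ s) (hr0 a)
    split_ifs <;> linarith) (by
    simp only [Pi.add_apply, Pi.smul_apply, smul_eq_mul, Finset.sum_add_distrib,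
      ← Finset.mul_sum, hrs, Finset.sum_pi_single', Finset.mem_univ, if_true, hsdef]
    rw [div_mul_cancel₀ _ h1.ne']
    norm_num)
  rw [triForm_add_single hs h0, triForm_smul, linkForm_smul, hf] at hy
  -- Equivalent to `3x(1-x)^2 < 4/9`; the difference is `3(x - 1/3)^2 (4/3 - x)`.
  have hs2 : 3 * x i < s ^ 2 := by
    rw [hsdef, div_pow, lt_div_iff₀ (by positivity)]
    nlinarith [mul_pos (pow_pos (sub_pos.2 hi) 2) (by linarith : 0 < 4 / 3 - x i)]
  have hs3 : 1 < s ^ 3 := one_lt_pow₀ hs1 (by norm_num)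
  rw [hf] at hpos
  have h5 : 0 ≤ (s ^ 3 - 1) * triForm w r := mul_nonneg (by linarith) hR
  have h6 : 0 ≤ (s ^ 2 - 3 * x i) * linkForm w i r := mul_nonneg (by linarith) hA
  have h7 : (s ^ 3 - 1) * triForm w r = 0 := by nlinarith
  have h8 : (s ^ 2 - 3 * x i) * linkForm w i r = 0 := by nlinarith
  rcases mul_eq_zero.1 h7 with h9 | h9
  · linarith
  rcases mul_eq_zero.1 h8 with h10 | h10
  · linarith
  rw [h9, h10] at hpos
  simp at hpos

/-- The graph obtained from `H` by replacing `v` with a twin of `u` that is adjacent to `u`. -/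
def cloneGraph {κ : Type*} [DecidableEq κ] (H : SimpleGraph κ) (u v : κ) : SimpleGraph κ :=
  H.comap (Function.update id v u) ⊔ SimpleGraph.edge u v

section Clone
variable {κ : Type*} [DecidableEq κ] {H : SimpleGraph κ} {u v : κ}

/-- The new twin is adjacent to `u`, so an independent set contains at most one of the two, and
collapsing the twin onto `u` is injective on it. Cloning therefore creates no larger independent
sets and preserves the constraint of the optimization. -/
theorem cloneGraph_isIndepSet (huv : u ≠ v) {J : Finset κ}
    (hJ : (cloneGraph H u v).IsIndepSet (J : Set κ)) :
    ∃ J' : Finset κ, H.IsIndepSet (J' : Set κ) ∧ J'.card = J.card := by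
  have hinj : Set.InjOn (Function.update id v u) (J : Set κ) := by
    intro a ha b hb hab
    by_contra hne
    have hE := hJ ha hb hne
    simp only [cloneGraph, SimpleGraph.sup_adj, SimpleGraph.edge_adj, not_or] at hE
    by_cases h1 : a = v <;> by_cases h2 : b = v
    · exact hne (h1.trans h2.symm)
    · subst h1
      simp only [Function.update_self, Function.update_of_ne h2, id] at hab
      exact hE.2 ⟨Or.inr ⟨rfl, hab.symm⟩, hne⟩
    · subst h2
      simp only [Function.update_self, Function.update_of_ne h1, id] at hab
      exact hE.2 ⟨Or.inl ⟨hab, rfl⟩, hne⟩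
    · simp only [Function.update_of_ne h1, Function.update_of_ne h2, id] at hab
      exact hne hab
  refine ⟨J.image (Function.update id v u), ?_, Finset.card_image_of_injOn hinj⟩
  apply SimpleGraph.IsIndepSet.image_of_comap
  intro a ha b hb hab h
  exact hJ ha hb hab (Or.inl h)

theorem halfWeight_clone_of_ne {a b : κ} (ha : a ≠ v) (hb : b ≠ v) :
    halfWeight (cloneGraph H u v) a b = halfWeight H a b := by
  have : (cloneGraph H u v).Adj a b ↔ H.Adj a b := by
    simp only [cloneGraph, SimpleGraph.sup_adj, SimpleGraph.edge_adj, SimpleGraph.comap_adj,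
      Function.update_of_ne ha, Function.update_of_ne hb, id]
    tauto
  exact halfWeight_congr Iff.rfl this

theorem halfWeight_clone_twin {c : κ} (hu : c ≠ u) (hv : c ≠ v) :
    halfWeight (cloneGraph H u v) v c = halfWeight H u c := by
  have : (cloneGraph H u v).Adj v c ↔ H.Adj u c := by
    simp only [cloneGraph, SimpleGraph.sup_adj, SimpleGraph.edge_adj, SimpleGraph.comap_adj,
      Function.update_self, Function.update_of_ne hv, id]
    tauto
  exact halfWeight_congr (by simp [hu.symm, hv.symm]) this

theorem halfWeight_clone_edge (huv : u ≠ v) : halfWeight (cloneGraph H u v) u v = 1 / 2 := by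
  apply halfWeight_of_adj
  right
  rw [SimpleGraph.edge_adj]
  exact ⟨Or.inl ⟨rfl, rfl⟩, huv⟩

theorem triForm_clone [Fintype κ] (huv : u ≠ v) {r : κ → ℝ} (hru : r u = 0) (hrv : r v = 0)
    (m : ℝ) :
    triForm (halfWeight (cloneGraph H u v)) (r + Pi.single u (m / 2) + Pi.single v (m / 2)) =
      triForm (halfWeight H) r + 3 * m * linkForm (halfWeight H) u r +
        3 / 4 * m ^ 2 * pairForm (halfWeight H) u u r := by
  have hne : ∀ c, r c ≠ 0 → c ≠ u ∧ c ≠ v := by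
    intro c hc
    exact ⟨by rintro rfl; exact hc hru, by rintro rfl; exact hc hrv⟩
  have h1 : triForm (halfWeight (cloneGraph H u v)) r = triForm (halfWeight H) r := by
    refine Finset.sum_congr rfl fun a _ => Finset.sum_congr rfl fun b _ =>
      Finset.sum_congr rfl fun c _ => ?_
    by_cases ha : r a = 0
    · simp [ha]
    by_cases hb : r b = 0
    · simp [hb]
    by_cases hc : r c = 0
    · simp [hc]
    rw [halfWeight_clone_of_ne (hne a ha).2 (hne b hb).2,
      halfWeight_clone_of_ne (hne b hb).2 (hne c hc).2,
      halfWeight_clone_of_ne (hne a ha).2 (hne c hc).2]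
  have h2 : linkForm (halfWeight (cloneGraph H u v)) u r = linkForm (halfWeight H) u r := by
    refine Finset.sum_congr rfl fun b _ => Finset.sum_congr rfl fun c _ => ?_
    by_cases hb : r b = 0
    · simp [hb]
    by_cases hc : r c = 0
    · simp [hc]
    rw [halfWeight_clone_of_ne huv (hne b hb).2,
      halfWeight_clone_of_ne (hne b hb).2 (hne c hc).2,
      halfWeight_clone_of_ne huv (hne c hc).2]
  have h3 : linkForm (halfWeight (cloneGraph H u v)) v r = linkForm (halfWeight H) u r := by
    refine Finset.sum_congr rfl fun b _ => Finset.sum_congr rfl fun c _ => ?_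
    by_cases hb : r b = 0
    · simp [hb]
    by_cases hc : r c = 0
    · simp [hc]
    rw [halfWeight_clone_twin (hne b hb).1 (hne b hb).2,
      halfWeight_clone_of_ne (hne b hb).2 (hne c hc).2,
      halfWeight_clone_twin (hne c hc).1 (hne c hc).2]
  have h4 : pairForm (halfWeight (cloneGraph H u v)) u v r = pairForm (halfWeight H) u u r := by
    refine Finset.sum_congr rfl fun c _ => ?_
    by_cases hc : r c = 0
    · simp [hc]
    rw [halfWeight_clone_of_ne huv (hne c hc).2, halfWeight_clone_twin (hne c hc).1 (hne c hc).2]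
  rw [triForm_add_single_add_single halfWeight_comm halfWeight_self, h1, h2, h3, h4,
    halfWeight_clone_edge huv]
  ring

/-- At a maximizer over all half graphs, adjacent vertices of the half graph are twins of equal
mass. -/
theorem twins_of_isMax [Fintype κ] {x : κ → ℝ} (hx : ∀ a, 0 < x a) (hx1 : ∑ a, x a = 1)
    (hpos : 0 < triForm (halfWeight H) x) (huv : H.Adj u v)
    (hmax : ∀ H' : SimpleGraph κ, (∀ J : Finset κ, H'.IsIndepSet (J : Set κ) →
      ∃ J' : Finset κ, H.IsIndepSet (J' : Set κ) ∧ J'.card = J.card) →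
      ∀ y : κ → ℝ, (∀ a, 0 ≤ y a) → ∑ a, y a = 1 →
        triForm (halfWeight H') y ≤ triForm (halfWeight H) x) :
    x u = x v ∧ ∀ c, c ≠ u → c ≠ v → (H.Adj u c ↔ H.Adj v c) := by
  have hne := huv.ne
  obtain ⟨r, hr, hru, hrv, hrc⟩ := eq_add_single_add_single hne x
  have hr0 : ∀ a, 0 ≤ r a := by
    intro a
    by_cases h1 : a = u
    · rw [h1, hru]
    · by_cases h2 : a = v
      · rw [h2, hrv]
      · rw [hrc a h1 h2]
        exact (hx a).le
  have hsum : ∑ a, r a + (x u + x v) = 1 := by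
    rw [← hx1]
    conv_rhs => rw [hr]
    simp only [Pi.add_apply, Finset.sum_add_distrib, Finset.sum_pi_single', Finset.mem_univ,
      if_true]
    ring
  have hf : triForm (halfWeight H) x = triForm (halfWeight H) r +
      3 * x u * linkForm (halfWeight H) u r + 3 * x v * linkForm (halfWeight H) v r +
      3 * x u * x v * pairForm (halfWeight H) u v r := by
    conv_lhs => rw [hr]
    rw [triForm_add_single_add_single halfWeight_comm halfWeight_self, halfWeight_of_adj huv]
    ring
  set p := x u with hp
  set q := x v with hq
  have hp0 : 0 < p := hx u
  have hq0 : 0 < q := hx v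
  have hsimp : ∀ (a b : κ), a ≠ b → (∀ c, 0 ≤ (r + Pi.single a ((p + q) / 2) +
      Pi.single b ((p + q) / 2) : κ → ℝ) c) ∧
      ∑ c, (r + Pi.single a ((p + q) / 2) + Pi.single b ((p + q) / 2) : κ → ℝ) c = 1 := by
    intro a b hab
    constructor
    · intro c
      simp only [Pi.add_apply, Pi.single_apply]
      have := hr0 c
      split_ifs <;> linarith
    · simp only [Pi.add_apply, Finset.sum_add_distrib, Finset.sum_pi_single', Finset.mem_univ,
        if_true]
      linarith
  have h1 := hmax (cloneGraph H u v) (fun J hJ => cloneGraph_isIndepSet hne hJ) _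
    (hsimp u v hne).1 (hsimp u v hne).2
  have h2 := hmax (cloneGraph H v u) (fun J hJ => cloneGraph_isIndepSet hne.symm hJ) _
    (hsimp v u hne.symm).1 (hsimp v u hne.symm).2
  rw [triForm_clone hne hru hrv, hf] at h1
  rw [triForm_clone hne.symm hrv hru, hf] at h2
  -- Both clonings, of `u` over `v` and of `v` over `u`, are compared with the maximizer. Weighting
  -- the two inequalities by `p` and `q` cancels the link terms and leaves only the pair terms.
  have h3 : (p + q) * (p * pairForm (halfWeight H) u u r + q * pairForm (halfWeight H) v v r) ≤
      4 * p * q * pairForm (halfWeight H) u v r := by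
    have h4 := mul_le_mul_of_nonneg_left h1 hp0.le
    have h5 := mul_le_mul_of_nonneg_left h2 hq0.le
    have h6 : 0 < p + q := by linarith
    have h7 : 3 / 4 * (p + q) * ((p + q) * (p * pairForm (halfWeight H) u u r +
        q * pairForm (halfWeight H) v v r)) ≤
        3 / 4 * (p + q) * (4 * p * q * pairForm (halfWeight H) u v r) := by
      linarith
    exact le_of_mul_le_mul_left h7 (by positivity)
  let g : κ → ℝ := fun c => ((p + q) * (p * halfWeight H u c ^ 2 + q * halfWeight H v c ^ 2) -
    4 * p * q * (halfWeight H u c * halfWeight H v c)) * r c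
  have hg : ∑ c, g c ≤ 0 := by
    have : ∑ c, g c = (p + q) * (p * pairForm (halfWeight H) u u r +
        q * pairForm (halfWeight H) v v r) - 4 * p * q * pairForm (halfWeight H) u v r := by
      simp only [pairForm, Finset.mul_sum, ← Finset.sum_add_distrib, ← Finset.sum_sub_distrib, g]
      exact Finset.sum_congr rfl fun c _ => by ring
    linarith
  -- With `a`, `b` the weights from `c` to `u`, `v`, the coefficient is nonnegative since `(p+q)(pa²
  -- + qb²) ≥ (pa + qb)² ≥ 4pqab`. Equality in both forces `a = b` and `p = q`.
  have hcoef : ∀ c, c ≠ u → c ≠ v →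
      0 ≤ ((p + q) * (p * halfWeight H u c ^ 2 + q * halfWeight H v c ^ 2) -
        4 * p * q * (halfWeight H u c * halfWeight H v c)) ∧
      (((p + q) * (p * halfWeight H u c ^ 2 + q * halfWeight H v c ^ 2) -
        4 * p * q * (halfWeight H u c * halfWeight H v c)) = 0 →
        p = q ∧ halfWeight H u c = halfWeight H v c) := by
    intro c hcu hcv
    have hpq : 0 < p * q := by positivity
    rcases halfWeight_eq_or (H := H) hcu.symm with h | h <;>
      rcases halfWeight_eq_or (H := H) hcv.symm with h' | h' <;> rw [h, h']
    · refine ⟨by nlinarith [sq_nonneg (p - q)], fun h8 => ⟨?_, rfl⟩⟩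
      have : (p - q) ^ 2 = 0 := by linarith
      linarith [pow_eq_zero_iff (two_ne_zero) |>.1 this]
    · have : 0 < (p + q) * (p * (1 / 2) ^ 2 + q * 1 ^ 2) - 4 * p * q * (1 / 2 * 1) := by
        nlinarith [sq_nonneg (p - 2 * q)]
      exact ⟨this.le, fun h8 => absurd h8 this.ne'⟩
    · have : 0 < (p + q) * (p * 1 ^ 2 + q * (1 / 2) ^ 2) - 4 * p * q * (1 * (1 / 2)) := by
        nlinarith [sq_nonneg (2 * p - q)]
      exact ⟨this.le, fun h8 => absurd h8 this.ne'⟩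
    · refine ⟨by nlinarith [sq_nonneg (p - q)], fun h8 => ⟨?_, rfl⟩⟩
      have : (p - q) ^ 2 = 0 := by linarith
      linarith [pow_eq_zero_iff (two_ne_zero) |>.1 this]
  have hg0 : ∀ c, 0 ≤ g c := by
    intro c
    by_cases h1 : c = u
    · simp [g, h1, hru]
    · by_cases h2 : c = v
      · simp [g, h2, hrv]
      · exact mul_nonneg (hcoef c h1 h2).1 (hr0 c)
  have hg1 : ∀ c, g c = 0 := by
    have h9 := (Finset.sum_eq_zero_iff_of_nonneg (fun c _ => hg0 c)).1
      (le_antisymm hg (Finset.sum_nonneg fun c _ => hg0 c))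
    exact fun c => h9 c (Finset.mem_univ c)
  have hkey : ∀ c, c ≠ u → c ≠ v → p = q ∧ halfWeight H u c = halfWeight H v c := by
    intro c h1 h2
    refine (hcoef c h1 h2).2 ?_
    have h10 := hg1 c
    simp only [g] at h10
    refine (mul_eq_zero.1 h10).resolve_right ?_
    rw [hrc c h1 h2]
    exact (hx c).ne'
  refine ⟨?_, ?_⟩
  · by_contra hpq
    -- Any third vertex would force `p = q`. With only two vertices there is no triangle, against
    -- positivity.
    have : r = 0 := by
      ext c
      by_cases h1 : c = u
      · rw [h1, hru]; rfl
      · by_cases h2 : c = v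
        · rw [h2, hrv]; rfl
        · exact absurd (hkey c h1 h2).1 hpq
    rw [hf, this] at hpos
    simp [triForm, linkForm, pairForm] at hpos
  · intro c h1 h2
    have h11 := (hkey c h1 h2).2
    by_cases h12 : H.Adj u c <;> by_cases h13 : H.Adj v c
    · tauto
    · rw [halfWeight_of_adj h12, halfWeight_of_not_adj h2.symm h13] at h11
      norm_num at h11
    · rw [halfWeight_of_adj h13, halfWeight_of_not_adj h1.symm h12] at h11
      norm_num at h11
    · tauto

end Clone

/-! ### Evaluation of the form on classes of twins. -/

/-- Inclusion–exclusion over the three edges of a triangle. In terms of the deficits `D = 1 - w`,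
which vanish between different classes, the form becomes a sum of contributions of single classes.
-/
theorem sum_one_sub_mul_eq {κ : Type*} [Fintype κ] {D : κ → κ → ℝ} (hD : ∀ a b, D a b = D b a)
    {x : κ → ℝ} (hx1 : ∑ a, x a = 1) :
    triForm (fun a b => 1 - D a b) x = 1 - 3 * ∑ a, x a * ∑ b, D a b * x b +
      3 * ∑ a, x a * (∑ b, D a b * x b) ^ 2 - triForm D x := by
  set R : κ → ℝ := fun a => ∑ b, D a b * x b with hR
  have h0 : ∑ a, ∑ b, ∑ c, x a * x b * x c = 1 := by
    simp only [← Finset.mul_sum, hx1, mul_one]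
  have h1 : ∑ a, ∑ b, ∑ c, D a b * (x a * x b * x c) = ∑ a, x a * R a := by
    simp only [← Finset.mul_sum, hx1, mul_one, hR]
    refine Finset.sum_congr rfl fun a _ => ?_
    rw [Finset.mul_sum]
    exact Finset.sum_congr rfl fun b _ => by ring
  have h2 : ∑ a, ∑ b, ∑ c, D b c * (x a * x b * x c) = ∑ a, x a * R a := by
    have : ∀ a, ∑ b, ∑ c, D b c * (x a * x b * x c) = x a * ∑ b, x b * R b := by
      intro a
      simp only [Finset.mul_sum, hR]
      exact Finset.sum_congr rfl fun b _ => Finset.sum_congr rfl fun c _ => by ring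
    simp only [this]
    rw [← Finset.sum_mul, hx1, one_mul]
  have h3 : ∑ a, ∑ b, ∑ c, D a c * (x a * x b * x c) = ∑ a, x a * R a := by
    rw [← h1]
    refine Finset.sum_congr rfl fun a _ => ?_
    rw [Finset.sum_comm]
    exact Finset.sum_congr rfl fun b _ => Finset.sum_congr rfl fun c _ => by ring
  have h4 : ∑ a, ∑ b, ∑ c, D a b * D a c * (x a * x b * x c) = ∑ a, x a * R a ^ 2 := by
    refine Finset.sum_congr rfl fun a _ => ?_
    rw [sq, hR]
    simp only [Finset.sum_mul_sum]
    rw [Finset.mul_sum]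
    refine Finset.sum_congr rfl fun b _ => ?_
    rw [Finset.mul_sum]
    exact Finset.sum_congr rfl fun c _ => by ring
  have h5 : ∑ a, ∑ b, ∑ c, D a b * D b c * (x a * x b * x c) = ∑ a, x a * R a ^ 2 := by
    rw [← h4, Finset.sum_comm]
    refine Finset.sum_congr rfl fun a _ => Finset.sum_congr rfl fun b _ =>
      Finset.sum_congr rfl fun c _ => ?_
    rw [hD b a]
    ring
  have h6 : ∑ a, ∑ b, ∑ c, D a c * D b c * (x a * x b * x c) = ∑ a, x a * R a ^ 2 := by
    rw [← h5]
    refine Finset.sum_congr rfl fun a _ => ?_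
    rw [Finset.sum_comm]
    refine Finset.sum_congr rfl fun b _ => Finset.sum_congr rfl fun c _ => ?_
    rw [hD c b]
    ring
  have h7 : triForm (fun a b => 1 - D a b) x = ∑ a, ∑ b, ∑ c, (x a * x b * x c -
      D a b * (x a * x b * x c) - D b c * (x a * x b * x c) - D a c * (x a * x b * x c) +
      D a b * D a c * (x a * x b * x c) + D a b * D b c * (x a * x b * x c) +
      D a c * D b c * (x a * x b * x c) - D a b * D b c * D a c * (x a * x b * x c)) :=
    Finset.sum_congr rfl fun a _ => Finset.sum_congr rfl fun b _ =>
      Finset.sum_congr rfl fun c _ => by ring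
  rw [h7]
  simp only [Finset.sum_add_distrib, Finset.sum_sub_distrib, h0, h1, h2, h3, h4, h5, h6]
  rw [triForm]
  ring

section Classes
variable {κ : Type*} [Fintype κ] [DecidableEq κ] {H : SimpleGraph κ}

open Classical in
/-- The closed neighbourhood of a vertex. -/
noncomputable def closedNbhd (H : SimpleGraph κ) (v : κ) : Finset κ :=
  Finset.univ.filter fun b => b = v ∨ H.Adj v b

theorem mem_closedNbhd {v b : κ} : b ∈ closedNbhd H v ↔ b = v ∨ H.Adj v b := by
  simp [closedNbhd]

theorem self_mem_closedNbhd (v : κ) : v ∈ closedNbhd H v := mem_closedNbhd.2 (Or.inl rfl)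

theorem closedNbhd_eq (htr : ∀ u v w, H.Adj u v → H.Adj v w → u ≠ w → H.Adj u w) {v b : κ}
    (h : b ∈ closedNbhd H v) : closedNbhd H b = closedNbhd H v := by
  rcases mem_closedNbhd.1 h with rfl | h
  · rfl
  ext c
  rw [mem_closedNbhd, mem_closedNbhd]
  constructor
  · rintro (rfl | hc)
    · exact Or.inr h
    · by_cases hcv : c = v
      · exact Or.inl hcv
      · exact Or.inr (htr _ _ _ h hc (Ne.symm hcv))
  · rintro (rfl | hc)
    · exact Or.inr h.symm
    · by_cases hcb : c = b
      · exact Or.inl hcb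
      · exact Or.inr (htr _ _ _ h.symm hc (Ne.symm hcb))

theorem one_sub_halfWeight (a b : κ) : 1 - halfWeight H a b =
    if b ∈ closedNbhd H a then 1 / 2 + (if a = b then 1 / 2 else 0) else 0 := by
  by_cases hab : a = b
  · subst hab
    norm_num [self_mem_closedNbhd]
  · by_cases h : H.Adj a b
    · rw [halfWeight_of_adj h, if_pos (mem_closedNbhd.2 (Or.inr h)), if_neg hab]
      norm_num
    · rw [halfWeight_of_not_adj hab h, if_neg]
      · norm_num
      · rw [mem_closedNbhd]
        tauto

/-- In a class of `m` twins the deficit is `1` at the vertex itself and `1/2` at the other `m - 1`,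
in total `(m + 1)/2`. -/
theorem sum_one_sub_halfWeight {x : κ → ℝ} (hc : ∀ u v, H.Adj u v → x u = x v) (a : κ) :
    ∑ b, (1 - halfWeight H a b) * x b = x a * ((closedNbhd H a).card + 1) / 2 := by
  simp only [one_sub_halfWeight, ite_mul, zero_mul]
  rw [← Finset.sum_filter, Finset.filter_mem_eq_inter, Finset.univ_inter]
  have : ∀ b ∈ closedNbhd H a, (1 / 2 + (if a = b then 1 / 2 else 0 : ℝ)) * x b =
      (1 / 2 + (if a = b then 1 / 2 else 0)) * x a := by
    intro b hb
    rcases mem_closedNbhd.1 hb with rfl | h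
    · rfl
    · rw [hc _ _ h]
  rw [Finset.sum_congr rfl this, ← Finset.sum_mul, Finset.sum_add_distrib, Finset.sum_const,
    Finset.sum_ite_eq, if_pos (self_mem_closedNbhd a)]
  simp only [nsmul_eq_mul]
  ring

theorem sum_one_sub_halfWeight_mul
    (htr : ∀ u v w, H.Adj u v → H.Adj v w → u ≠ w → H.Adj u w) {x : κ → ℝ}
    (hc : ∀ u v, H.Adj u v → x u = x v) (a : κ) :
    ∑ b, ∑ c, (1 - halfWeight H a b) * (1 - halfWeight H b c) * (1 - halfWeight H a c) *
      (x a * x b * x c) =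
    x a * (x a ^ 2 * (((closedNbhd H a).card : ℝ) ^ 2 + 3 * (closedNbhd H a).card + 4) / 8) := by
  set K := closedNbhd H a with hK
  have hxK : ∀ b ∈ K, x b = x a := by
    intro b hb
    rcases mem_closedNbhd.1 hb with rfl | h
    · rfl
    · exact (hc _ _ h).symm
  have h1 : ∀ b c, (1 - halfWeight H a b) * (1 - halfWeight H b c) * (1 - halfWeight H a c) *
      (x a * x b * x c) = if b ∈ K then (if c ∈ K then x a ^ 3 *
        ((1 / 2 + if a = b then 1 / 2 else 0) * ((1 / 2 + if b = c then 1 / 2 else 0) *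
        (1 / 2 + if a = c then 1 / 2 else 0))) else 0) else 0 := by
    intro b c
    rw [one_sub_halfWeight a b, one_sub_halfWeight a c, one_sub_halfWeight b c, ← hK]
    by_cases hb : b ∈ K
    · by_cases hcK : c ∈ K
      · have : c ∈ closedNbhd H b := by rwa [closedNbhd_eq htr hb]
        rw [if_pos hb, if_pos hcK, if_pos this, if_pos hb, if_pos hcK, hxK b hb, hxK c hcK]
        ring
      · simp [hcK]
    · simp [hb]
  have h2 : ∀ b ∈ K, ∑ c ∈ K, ((1 / 2 + if b = c then 1 / 2 else 0) *
      (1 / 2 + if a = c then 1 / 2 else 0) : ℝ) = (K.card + 2) / 4 + if a = b then 1 / 4 else 0 := by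
    intro b hb
    have h3 : ∀ c, ((1 / 2 + if b = c then 1 / 2 else 0) *
      (1 / 2 + if a = c then 1 / 2 else 0) : ℝ) = 1 / 4 + (if b = c then 1 / 4 else 0) +
        (if a = c then 1 / 4 else 0) + (if a = c then (if a = b then 1 / 4 else 0) else 0) := by
      intro c
      by_cases h4 : b = c <;> by_cases h5 : a = c
      · subst h4 h5; norm_num
      · subst h4; norm_num [h5]
      · subst h5; norm_num [h4, Ne.symm h4]
      · norm_num [h4, h5]
    rw [Finset.sum_congr rfl fun c _ => h3 c]
    simp only [Finset.sum_add_distrib, Finset.sum_const, Finset.sum_ite_eq,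
      if_pos (self_mem_closedNbhd (H := H) a), hK, nsmul_eq_mul]
    rw [if_pos (by rwa [← hK])]
    ring
  simp only [h1]
  have h6 : ∀ b, ∑ c, (if b ∈ K then (if c ∈ K then x a ^ 3 *
        ((1 / 2 + if a = b then 1 / 2 else 0) * ((1 / 2 + if b = c then 1 / 2 else 0) *
        (1 / 2 + if a = c then 1 / 2 else 0))) else 0) else 0 : ℝ) =
      if b ∈ K then x a ^ 3 * (1 / 2 * (((K.card : ℝ) + 2) / 4) + (if a = b then
        1 / 2 * (((K.card : ℝ) + 2) / 4) + 1 / 4 else 0)) else 0 := by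
    intro b
    by_cases hb : b ∈ K
    · simp only [if_pos hb]
      rw [← Finset.sum_filter, Finset.filter_mem_eq_inter, Finset.univ_inter, ← Finset.mul_sum,
        ← Finset.mul_sum, h2 b hb]
      congr 1
      split_ifs <;> ring
    · simp [hb]
  simp only [h6]
  rw [← Finset.sum_filter, Finset.filter_mem_eq_inter, Finset.univ_inter, ← Finset.mul_sum,
    Finset.sum_add_distrib, Finset.sum_const, Finset.sum_ite_eq, if_pos (self_mem_closedNbhd a),
    nsmul_eq_mul]
  ring

theorem triForm_halfWeight_eq (htr : ∀ u v w, H.Adj u v → H.Adj v w → u ≠ w → H.Adj u w)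
    {x : κ → ℝ} (hc : ∀ u v, H.Adj u v → x u = x v) (hx1 : ∑ a, x a = 1) :
    triForm (halfWeight H) x = 1 + ∑ a, x a *
      (-3 * (x a * ((closedNbhd H a).card + 1) / 2) +
        3 * (x a * ((closedNbhd H a).card + 1) / 2) ^ 2 -
        x a ^ 2 * (((closedNbhd H a).card : ℝ) ^ 2 + 3 * (closedNbhd H a).card + 4) / 8) := by
  have h1 := sum_one_sub_mul_eq (D := fun a b => 1 - halfWeight H a b)
    (fun a b => by rw [halfWeight_comm]) hx1
  simp only [sub_sub_cancel] at h1
  rw [show triForm (halfWeight H) x = triForm (fun a b => halfWeight H a b) x from rfl, h1]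
  simp only [sum_one_sub_halfWeight hc, triForm, sum_one_sub_halfWeight_mul htr hc,
    Finset.mul_sum]
  rw [add_sub_assoc, sub_add, sub_eq_add_neg, ← Finset.sum_sub_distrib, ← Finset.sum_sub_distrib,
    ← Finset.sum_neg_distrib]
  congr 1
  exact Finset.sum_congr rfl fun a _ => by ring

/-- One representative from each class; a class of size `m` contributes `m · (1/m) = 1` to the sum.
-/
theorem exists_isIndepSet_card (htr : ∀ u v w, H.Adj u v → H.Adj v w → u ≠ w → H.Adj u w) :
    ∃ J : Finset κ, H.IsIndepSet (J : Set κ) ∧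
      ∑ v, (1 : ℝ) / (closedNbhd H v).card = J.card := by
  classical
  obtain ⟨U, -, hinj, him⟩ := Set.SurjOn.exists_subset_injOn_image_eq
    (Set.surjOn_image (closedNbhd H) Set.univ)
  refine ⟨U.toFinset, ?_, ?_⟩
  · intro a ha b hb hab h
    simp only [Set.coe_toFinset] at ha hb
    exact hab (hinj ha hb (closedNbhd_eq htr (mem_closedNbhd.2 (Or.inr h))).symm)
  · have h1 : U.toFinset.card = (Finset.univ.image (closedNbhd H)).card := by
      rw [← Finset.card_image_of_injOn (f := closedNbhd H) (s := U.toFinset) (by simpa using hinj)]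
      congr 1
      apply Finset.coe_injective
      simpa using him
    rw [h1, ← Finset.sum_fiberwise_of_maps_to (s := Finset.univ)
      (t := Finset.univ.image (closedNbhd H)) (g := closedNbhd H)
      (fun v hv => Finset.mem_image_of_mem _ hv)]
    rw [Finset.card_eq_sum_ones, Nat.cast_sum]
    refine Finset.sum_congr rfl fun s hs => ?_
    obtain ⟨w, -, rfl⟩ := Finset.mem_image.1 hs
    have h2 : (Finset.univ.filter fun v => closedNbhd H v = closedNbhd H w) = closedNbhd H w := by
      ext v
      simp only [Finset.mem_filter, Finset.mem_univ, true_and]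
      exact ⟨fun h => h ▸ self_mem_closedNbhd v, closedNbhd_eq htr⟩
    rw [Finset.sum_congr rfl (g := fun _ => (1 : ℝ) / (closedNbhd H w).card)
      (fun v hv => by rw [(Finset.mem_filter.1 hv).2]), h2, Finset.sum_const, nsmul_eq_mul,
      mul_one_div_cancel]
    · simp
    · have : 0 < (closedNbhd H w).card := Finset.card_pos.2 ⟨w, self_mem_closedNbhd w⟩
      positivity

end Classes

/-! ### The weighted Turán theorem for triangles. -/

/-- The tangent-line trick at `z = 1/ℓ`, for a vertex of mass `x` in a class of size `m`. For `m =
1` the difference of the two sides is `(x - z)^2 (2x + 4z - 3)`, with equality at `x = z`, the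
balanced complete `ℓ`-partite graph. Larger classes are handled through the class mass `y = m x`. -/
theorem tangent_class {m : ℕ} (hm : 1 ≤ m) {x z : ℝ} (hx1 : x ≤ 1 / 3)
    (hmx : m * x ≤ 1) (hz1 : z ≤ 1 / 3) :
    x * (-3 * (x * (m + 1) / 2) + 3 * (x * (m + 1) / 2) ^ 2 -
      x ^ 2 * ((m : ℝ) ^ 2 + 3 * m + 4) / 8) ≤
      -(6 * z * (1 - z)) * x + (3 * z ^ 2 - 4 * z ^ 3) / 2 * (1 + 1 / m) := by
  have hm0 : (0 : ℝ) < m := by exact_mod_cast hm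
  suffices h : m * (x * (-3 * (x * (m + 1) / 2) + 3 * (x * (m + 1) / 2) ^ 2 -
      x ^ 2 * ((m : ℝ) ^ 2 + 3 * m + 4) / 8)) ≤
      m * (-(6 * z * (1 - z)) * x) + (3 * z ^ 2 - 4 * z ^ 3) / 2 * (m + 1) by
    have e : (3 * z ^ 2 - 4 * z ^ 3) / 2 * ((m : ℝ) + 1) =
        m * ((3 * z ^ 2 - 4 * z ^ 3) / 2 * (1 + 1 / m)) := by
      field_simp
    rw [e, ← mul_add] at h
    exact le_of_mul_le_mul_left h hm0
  have hz3 : 0 ≤ 3 * z ^ 2 - 4 * z ^ 3 := by nlinarith [sq_nonneg z]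
  rcases (by omega : m = 1 ∨ m = 2 ∨ m = 3 ∨ 4 ≤ m) with rfl | rfl | rfl | h4
  · have : (x - z) ^ 2 * (2 * x + 4 * z - 3) ≤ 0 :=
      mul_nonpos_of_nonneg_of_nonpos (sq_nonneg _) (by linarith)
    push_cast
    linarith
  · have := tangent_two (y := 2 * x) (z := z) (by linarith) hz1
    push_cast
    linarith
  · have := tangent_three (y := 3 * x) (z := z) (by linarith) hz1
    push_cast
    linarith
  · have h1 := tangent_four (y := m * x) (z := z) hmx hz1
    have h4' : (4 : ℝ) ≤ m := by exact_mod_cast h4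
    have h2 : 0 ≤ (3 * z ^ 2 - 4 * z ^ 3) * (m - 4) := mul_nonneg hz3 (by linarith)
    have h3 : m * x ^ 2 * (-(3 / 2) + 9 / 8 * (m * x) + x / 4) ≤ 0 :=
      mul_nonpos_of_nonneg_of_nonpos (by positivity) (by linarith)
    nlinarith

/-- Summing the tangent bounds, the masses add up to `1` and the terms `1 + 1/m` to `|κ| + |J| ≤
2ℓ`, where `J` consists of representatives. The result is `1 - 6z(1 - z) + 3z - 4z² = (1 - z)(1 -
2z)` with `z = 1/ℓ`. -/
theorem triForm_halfWeight_le_of_twins {κ : Type*} [Fintype κ] [DecidableEq κ]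
    {H : SimpleGraph κ} {ℓ : ℕ} (hℓ : 3 ≤ ℓ)
    (hH : ∀ J : Finset κ, H.IsIndepSet (J : Set κ) → Fintype.card κ + J.card ≤ 2 * ℓ)
    (htr : ∀ u v w, H.Adj u v → H.Adj v w → u ≠ w → H.Adj u w)
    {x : κ → ℝ} (hx : ∀ a, 0 ≤ x a) (hx1 : ∑ a, x a = 1) (hx3 : ∀ a, x a ≤ 1 / 3)
    (hc : ∀ u v, H.Adj u v → x u = x v) :
    triForm (halfWeight H) x ≤ (1 - 1 / (ℓ : ℝ)) * (1 - 2 / (ℓ : ℝ)) := by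
  set z : ℝ := 1 / ℓ with hz
  have hℓ' : (3 : ℝ) ≤ ℓ := by exact_mod_cast hℓ
  have hz0 : 0 < z := by positivity
  have hz1 : z ≤ 1 / 3 := one_div_le_one_div_of_le (by norm_num) hℓ'
  have hz3 : 0 ≤ 3 * z ^ 2 - 4 * z ^ 3 := by nlinarith [sq_nonneg z]
  rw [triForm_halfWeight_eq htr hc hx1]
  have h1 : ∀ a, x a *
      (-3 * (x a * ((closedNbhd H a).card + 1) / 2) +
        3 * (x a * ((closedNbhd H a).card + 1) / 2) ^ 2 -
        x a ^ 2 * (((closedNbhd H a).card : ℝ) ^ 2 + 3 * (closedNbhd H a).card + 4) / 8) ≤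
      -(6 * z * (1 - z)) * x a +
        (3 * z ^ 2 - 4 * z ^ 3) / 2 * (1 + 1 / (closedNbhd H a).card) := by
    intro a
    refine tangent_class (Finset.card_pos.2 ⟨a, self_mem_closedNbhd a⟩) (hx3 a) ?_ hz1
    rw [← hx1, ← nsmul_eq_mul, ← Finset.sum_const]
    refine le_trans (le_of_eq ?_) (Finset.sum_le_sum_of_subset_of_nonneg
      (Finset.subset_univ (closedNbhd H a)) fun b _ _ => hx b)
    refine Finset.sum_congr rfl fun b hb => ?_
    rcases mem_closedNbhd.1 hb with rfl | h
    · rfl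
    · exact hc _ _ h
  obtain ⟨J, hJ, hJc⟩ := exists_isIndepSet_card htr
  have h2 := Finset.sum_le_sum fun a (_ : a ∈ Finset.univ) => h1 a
  rw [Finset.sum_add_distrib, ← Finset.mul_sum, ← Finset.mul_sum, Finset.sum_add_distrib, hx1, hJc,
    Finset.sum_const, Finset.card_univ, nsmul_eq_mul, mul_one] at h2
  have h3 : (Fintype.card κ : ℝ) + J.card ≤ 2 * ℓ := by exact_mod_cast hH J hJ
  have h4 : (3 * z ^ 2 - 4 * z ^ 3) / 2 * ((Fintype.card κ : ℝ) + J.card) ≤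
      (3 * z ^ 2 - 4 * z ^ 3) / 2 * (2 * ℓ) := by gcongr
  have h5 : (3 * z ^ 2 - 4 * z ^ 3) / 2 * (2 * ℓ) = 3 * z - 4 * z ^ 2 := by
    rw [hz]
    field_simp
  have h6 : (2 : ℝ) / ℓ = 2 * z := by rw [hz]; ring
  rw [h6]
  linarith

/-- Maximize over the finitely many admissible graphs and the compact simplex together. A vanishing
coordinate allows induction on the number of vertices; at an interior maximizer `twins_of_isMax`
makes nonequality-free adjacency transitive with constant masses, and the class computation applies.
-/
theorem triForm_halfWeight_le {ℓ : ℕ} (hℓ : 3 ≤ ℓ) : ∀ (k : ℕ) (H : SimpleGraph (Fin k)),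
    (∀ J : Finset (Fin k), H.IsIndepSet (J : Set (Fin k)) → k + J.card ≤ 2 * ℓ) →
    ∀ x : Fin k → ℝ, (∀ a, 0 ≤ x a) → ∑ a, x a = 1 →
      triForm (halfWeight H) x ≤ (1 - 1 / (ℓ : ℝ)) * (1 - 2 / (ℓ : ℝ)) := by
  intro k
  induction k with
  | zero =>
    intro H _ x _ hx1
    simp at hx1
  | succ k ih =>
    intro H₀ hH₀ x₀ hx₀ hx₀1
    have hℓ' : (3 : ℝ) ≤ ℓ := by exact_mod_cast hℓ
    have hB : 0 < (1 - 1 / (ℓ : ℝ)) * (1 - 2 / (ℓ : ℝ)) := by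
      have h1 : 1 / (ℓ : ℝ) < 1 := by rw [div_lt_one (by linarith)]; linarith
      have h2 : 2 / (ℓ : ℝ) < 1 := by rw [div_lt_one (by linarith)]; linarith
      exact mul_pos (by linarith) (by linarith)
    let Adm : SimpleGraph (Fin (k + 1)) → Prop := fun H =>
      ∀ J : Finset (Fin (k + 1)), H.IsIndepSet (J : Set (Fin (k + 1))) → (k + 1) + J.card ≤ 2 * ℓ
    have hex : ∀ H : SimpleGraph (Fin (k + 1)), ∃ y ∈ stdSimplex ℝ (Fin (k + 1)),
        ∀ y' ∈ stdSimplex ℝ (Fin (k + 1)), triForm (halfWeight H) y' ≤ triForm (halfWeight H) y := by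
      intro H
      have hcont : Continuous fun y : Fin (k + 1) → ℝ => triForm (halfWeight H) y := by
        unfold triForm
        fun_prop
      obtain ⟨y, hy, hmax⟩ := (isCompact_stdSimplex ℝ (Fin (k + 1))).exists_isMaxOn
        ⟨x₀, hx₀, hx₀1⟩ hcont.continuousOn
      exact ⟨y, hy, fun y' hy' => hmax hy'⟩
    choose y hy hymax using hex
    have : Nonempty {H // Adm H} := ⟨⟨H₀, hH₀⟩⟩
    obtain ⟨⟨H, hH⟩, hmax⟩ := Finite.exists_max
      (fun H : {H // Adm H} => triForm (halfWeight H.1) (y H.1))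
    set x := y H with hxdef
    have hx0 : ∀ a, 0 ≤ x a := (hy H).1
    have hx1 : ∑ a, x a = 1 := (hy H).2
    have hmax' : ∀ H', Adm H' → ∀ y' : Fin (k + 1) → ℝ, (∀ a, 0 ≤ y' a) → ∑ a, y' a = 1 →
        triForm (halfWeight H') y' ≤ triForm (halfWeight H) x := by
      intro H' hH' y' hy0 hy1
      exact (hymax H' y' ⟨hy0, hy1⟩).trans (hmax ⟨H', hH'⟩)
    refine (hmax' H₀ hH₀ x₀ hx₀ hx₀1).trans ?_
    by_contra! hlt
    have hpos : 0 < triForm (halfWeight H) x := hB.trans hlt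
    by_cases hz : ∃ i, x i = 0
    · obtain ⟨i, hi⟩ := hz
      have h1 := ih (H.comap i.succAbove) (by
        intro J hJ
        have hind : H.IsIndepSet ((J.image i.succAbove : Finset (Fin (k + 1))) :
            Set (Fin (k + 1))) := hJ.image_of_comap
        have := hH _ hind
        rw [Finset.card_image_of_injective _ Fin.succAbove_right_injective] at this
        omega) (fun a => x (i.succAbove a)) (fun a => hx0 _) (by
        rw [Fin.sum_univ_succAbove _ i, hi, zero_add] at hx1
        exact hx1)
      have h2 : triForm (halfWeight (H.comap i.succAbove)) (fun a => x (i.succAbove a)) =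
          triForm (halfWeight H) x := by
        have h3 : ∀ a b, halfWeight (H.comap i.succAbove) a b =
            halfWeight H (i.succAbove a) (i.succAbove b) := fun a b =>
          halfWeight_congr (by simp) (by simp)
        simp only [triForm, h3, Fin.sum_univ_succAbove _ i, hi]
        simp
      rw [h2] at h1
      linarith
    · push Not at hz
      have hxp : ∀ a, 0 < x a := fun a => (hx0 a).lt_of_ne (hz a).symm
      have htw : ∀ u v, H.Adj u v → x u = x v ∧
          ∀ c, c ≠ u → c ≠ v → (H.Adj u c ↔ H.Adj v c) := by
        intro u v huv
        refine twins_of_isMax hxp hx1 hpos huv fun H' hH' y' hy0 hy1 => hmax' H' ?_ y' hy0 hy1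
        intro J hJ
        obtain ⟨J', hJ', hc⟩ := hH' J hJ
        rw [← hc]
        exact hH J' hJ'
      have := triForm_halfWeight_le_of_twins hℓ (by simpa using hH)
        (fun u v w huv hvw huw => ((htw u v huv).2 w huw.symm hvw.ne').2 hvw) hx0 hx1
        (le_third_of_isMax halfWeight_comm halfWeight_self halfWeight_nonneg hx0 hx1 hpos
          (hmax' H hH)) (fun u v h => (htw u v h).1)
      linarith

/-- The weighted Turán theorem for triangles: if the number of vertices of a clique of positive
edges plus the number of vertices in a subclique of edges of weight `1` never equals `2ℓ + 1`, then
the weighted triangle density is at most that of the balanced complete `ℓ`-partite graph. -/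
theorem weighted_turan {ℓ : ℕ} (hℓ : 3 ≤ ℓ) {ι : Type*} [Fintype ι] [DecidableEq ι]
    {w : ι → ι → ℝ} (hs : ∀ a b, w a b = w b a) (h0 : ∀ a, w a a = 0)
    (hw : ∀ a b, w a b = 0 ∨ w a b = 1 / 2 ∨ w a b = 1)
    (hfree : ∀ K J : Finset ι, J ⊆ K → (∀ a ∈ K, ∀ b ∈ K, a ≠ b → w a b ≠ 0) →
      (∀ a ∈ J, ∀ b ∈ J, a ≠ b → w a b = 1) → K.card + J.card ≠ 2 * ℓ + 1) :
    ∑ a, ∑ b, ∑ c, w a b * w b c * w a c ≤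
      (1 - 1 / (ℓ : ℝ)) * (1 - 2 / (ℓ : ℝ)) * (Fintype.card ι : ℝ) ^ 3 := by
  have hfree' : ∀ K J : Finset ι, J ⊆ K → (∀ a ∈ K, ∀ b ∈ K, a ≠ b → w a b ≠ 0) →
      (∀ a ∈ J, ∀ b ∈ J, a ≠ b → w a b = 1) → K.card + J.card ≤ 2 * ℓ := by
    intro K J hJK hK hJ
    by_contra! hlt
    -- A larger configuration contains one of size exactly `2ℓ+1`: shrink `J` if `K` is small
    -- enough, otherwise shrink `K` and take `J` empty.
    rcases le_or_gt K.card (2 * ℓ + 1) with h | h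
    · obtain ⟨J', hJ', hc⟩ := Finset.exists_subset_card_eq (s := J) (n := 2 * ℓ + 1 - K.card)
        (by omega)
      exact hfree K J' (hJ'.trans hJK) hK
        (fun a ha b hb => hJ a (hJ' ha) b (hJ' hb)) (by omega)
    · obtain ⟨K', hK', hc⟩ := Finset.exists_subset_card_eq (s := K) (n := 2 * ℓ + 1) h.le
      exact hfree K' ∅ (by simp) (fun a ha b hb => hK a (hK' ha) b (hK' hb)) (by simp)
        (by simpa using hc)
  rcases isEmpty_or_nonempty ι with hι | hι
  · simp
  have hN : (0 : ℝ) < Fintype.card ι := by exact_mod_cast Fintype.card_pos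
  obtain ⟨y, hy0, hy1, hy2, hy3⟩ := exists_clique_support hs h0
    (fun _ : ι => 1 / (Fintype.card ι : ℝ)) (fun _ => by positivity)
  have hsum : ∑ a, y a = 1 := by
    rw [hy1, Finset.sum_const, Finset.card_univ, nsmul_eq_mul]
    field_simp
  have hL : triForm w (fun _ : ι => 1 / (Fintype.card ι : ℝ)) * (Fintype.card ι : ℝ) ^ 3 =
      ∑ a, ∑ b, ∑ c, w a b * w b c * w a c := by
    simp only [triForm, Finset.sum_mul]
    refine Finset.sum_congr rfl fun a _ => Finset.sum_congr rfl fun b _ =>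
      Finset.sum_congr rfl fun c _ => ?_
    field_simp
  rw [← hL]
  refine mul_le_mul_of_nonneg_right (hy2.trans ?_) (by positivity)
  let S := {a // y a ≠ 0}
  let e := Fintype.equivFin S
  let f : Fin (Fintype.card S) → ι := fun i => (e.symm i).1
  have hf : Function.Injective f := Subtype.val_injective.comp e.symm.injective
  have hfne : ∀ i, y (f i) ≠ 0 := fun i => (e.symm i).2
  have hrange : ∀ a, a ∉ Set.range f → y a = 0 := by
    intro a ha
    by_contra hne
    exact ha ⟨e ⟨a, hne⟩, by simp [f]⟩
  let H : SimpleGraph (Fin (Fintype.card S)) := SimpleGraph.mk (fun i j => w (f i) (f j) = 1 / 2)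
    ⟨fun i j h => by rw [hs]; exact h⟩ ⟨fun i h => by rw [h0] at h; norm_num at h⟩
  have hHw : ∀ i j, halfWeight H i j = w (f i) (f j) := by
    intro i j
    by_cases hij : i = j
    · subst hij
      simp [h0]
    · rcases hw (f i) (f j) with h | h | h
      · exact absurd h (hy3 _ _ (hf.ne hij) (hfne i) (hfne j))
      · rw [halfWeight_of_adj (show H.Adj i j from h), h]
      · rw [halfWeight_of_not_adj hij, h]
        intro h'
        have : w (f i) (f j) = 1 / 2 := h'
        rw [h] at this
        norm_num at this
  have key := triForm_halfWeight_le hℓ _ H (by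
    intro J hJ
    have := hfree' (Finset.univ.image f) (J.image f) (Finset.image_subset_image (Finset.subset_univ _))
      (by
        intro a ha b hb hab
        obtain ⟨i, -, rfl⟩ := Finset.mem_image.1 ha
        obtain ⟨j, -, rfl⟩ := Finset.mem_image.1 hb
        exact hy3 _ _ hab (hfne i) (hfne j))
      (by
        intro a ha b hb hab
        obtain ⟨i, hi, rfl⟩ := Finset.mem_image.1 ha
        obtain ⟨j, hj, rfl⟩ := Finset.mem_image.1 hb
        have hij : i ≠ j := fun h => hab (by rw [h])
        rw [← hHw, halfWeight_of_not_adj hij (hJ hi hj hij)])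
    rwa [Finset.card_image_of_injective _ hf, Finset.card_image_of_injective _ hf,
      Finset.card_univ, Fintype.card_fin] at this) (fun i => y (f i)) (fun i => hy0 _) (by
    rw [← hsum]
    exact Fintype.sum_of_injective f hf _ _ hrange fun i => rfl)
  refine le_trans (le_of_eq ?_) key
  symm
  refine Fintype.sum_of_injective f hf _ _ (fun a ha => by simp [hrange a ha]) fun i => ?_
  refine Fintype.sum_of_injective f hf _ _ (fun a ha => by simp [hrange a ha]) fun j => ?_
  refine Fintype.sum_of_injective f hf _ _ (fun a ha => by simp [hrange a ha]) fun k => ?_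
  rw [hHw, hHw, hHw]

/-! ### Degrees and triangles in regular pairs. -/

section Uniform
variable {V : Type*} {G : SimpleGraph V} [DecidableRel G.Adj] {ε : ℝ} {A B S T : Finset V}

theorem edgeDensity_mul_card (G : SimpleGraph V) [DecidableRel G.Adj] (S T : Finset V) :
    (G.edgeDensity S T : ℝ) * (S.card * T.card) =
      ∑ x ∈ S, ((T.filter fun y => G.Adj x y).card : ℝ) := by
  have h1 : (G.interedges S T).card = ∑ x ∈ S, (T.filter fun y => G.Adj x y).card := by
    simp only [SimpleGraph.interedges, Rel.interedges, Finset.card_filter, Finset.sum_product]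
  rw [SimpleGraph.edgeDensity_def, ← Nat.cast_sum, ← h1]
  push_cast
  rcases eq_or_ne ((S.card : ℝ) * T.card) 0 with h | h
  · rw [h, mul_zero]
    have : (G.interedges S T).card ≤ S.card * T.card := G.card_interedges_le_mul S T
    have h2 : ((G.interedges S T).card : ℝ) ≤ S.card * T.card := by exact_mod_cast this
    rw [h] at h2
    exact (le_antisymm h2 (by positivity)).symm
  · rw [div_mul_cancel₀ _ h]

/-- If the exceptional vertices exceeded `ε|A|`, the pair they form with `T` would have density off
by more than `ε`, against regularity. -/
theorem card_high_degree_le (hU : G.IsUniform ε A B) (hS : S ⊆ A) (hT : T ⊆ B)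
    (hTc : B.card * ε ≤ T.card) :
    ((S.filter fun x => (G.edgeDensity A B + ε) * T.card <
      ((T.filter fun y => G.Adj x y).card : ℝ)).card : ℝ) ≤ A.card * ε := by
  set X := S.filter fun x => (G.edgeDensity A B + ε) * T.card <
      ((T.filter fun y => G.Adj x y).card : ℝ) with hX
  by_contra! hlt
  have h1 := hU ((Finset.filter_subset _ _).trans hS : X ⊆ A) hT hlt.le hTc
  rw [abs_lt] at h1
  have hX0 : (0 : ℝ) < X.card := lt_of_le_of_lt (mul_nonneg (by positivity) hU.pos.le) hlt
  have hXne : X.Nonempty := Finset.card_pos.1 (by exact_mod_cast hX0)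
  have h2 := edgeDensity_mul_card G X T
  have h3 : ∑ x ∈ X, (G.edgeDensity A B + ε) * (T.card : ℝ) <
      ∑ x ∈ X, ((T.filter fun y => G.Adj x y).card : ℝ) :=
    Finset.sum_lt_sum_of_nonempty hXne fun x hx => (Finset.mem_filter.1 hx).2
  rw [Finset.sum_const, nsmul_eq_mul, ← h2] at h3
  have h4 : (0 : ℝ) ≤ T.card := by positivity
  nlinarith [mul_nonneg hX0.le h4]

theorem card_low_degree_le (hU : G.IsUniform ε A B) (hS : S ⊆ A) (hT : T ⊆ B)
    (hTc : B.card * ε ≤ T.card) :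
    ((S.filter fun x => ((T.filter fun y => G.Adj x y).card : ℝ) <
      (G.edgeDensity A B - ε) * T.card).card : ℝ) ≤ A.card * ε := by
  set X := S.filter fun x => ((T.filter fun y => G.Adj x y).card : ℝ) <
      (G.edgeDensity A B - ε) * T.card with hX
  by_contra! hlt
  have h1 := hU ((Finset.filter_subset _ _).trans hS : X ⊆ A) hT hlt.le hTc
  rw [abs_lt] at h1
  have hX0 : (0 : ℝ) < X.card := lt_of_le_of_lt (mul_nonneg (by positivity) hU.pos.le) hlt
  have hXne : X.Nonempty := Finset.card_pos.1 (by exact_mod_cast hX0)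
  have h2 := edgeDensity_mul_card G X T
  have h3 : ∑ x ∈ X, ((T.filter fun y => G.Adj x y).card : ℝ) <
      ∑ x ∈ X, (G.edgeDensity A B - ε) * (T.card : ℝ) :=
    Finset.sum_lt_sum_of_nonempty hXne fun x hx => (Finset.mem_filter.1 hx).2
  rw [Finset.sum_const, nsmul_eq_mul, ← h2] at h3
  have h4 : (0 : ℝ) ≤ T.card := by positivity
  nlinarith [mul_nonneg hX0.le h4]

/-- The number of triangles with one vertex in each of three sets. -/
def triBetween (G : SimpleGraph V) [DecidableRel G.Adj] (A B C : Finset V) : ℝ :=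
  ∑ x ∈ A, ∑ y ∈ B, ∑ z ∈ C, if G.Adj x y ∧ G.Adj y z ∧ G.Adj x z then 1 else 0

theorem triBetween_le_mul (A B C : Finset V) :
    triBetween G A B C ≤ A.card * B.card * C.card := by
  have : triBetween G A B C ≤ ∑ x ∈ A, ∑ y ∈ B, ∑ z ∈ C, (1 : ℝ) :=
    Finset.sum_le_sum fun x _ => Finset.sum_le_sum fun y _ => Finset.sum_le_sum fun z _ => by
      split_ifs <;> norm_num
  refine this.trans (le_of_eq ?_)
  simp
  ring

/-- For typical `x ∈ A` both neighbourhoods have about the expected size, and regularity of `(B, C)`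
bounds the edges between them. The error `5ε` covers two exceptional sets of size at most `ε|A|` and
the case of a neighbourhood too small for regularity. -/
theorem triBetween_le {C : Finset V} (hε : ε ≤ 1) (hAB : G.IsUniform ε A B)
    (hAC : G.IsUniform ε A C) (hBC : G.IsUniform ε B C) :
    triBetween G A B C ≤ ((G.edgeDensity A B + ε) * (G.edgeDensity A C + ε) *
      (G.edgeDensity B C + ε) + 5 * ε) * (A.card * B.card * C.card) := by
  have hε0 := hAB.pos
  set nB : V → Finset V := fun x => B.filter fun y => G.Adj x y with hnB
  set nC : V → Finset V := fun x => C.filter fun z => G.Adj x z with hnC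
  set dAB : ℝ := (G.edgeDensity A B : ℝ)
  set dAC : ℝ := (G.edgeDensity A C : ℝ)
  set dBC : ℝ := (G.edgeDensity B C : ℝ)
  have hd0 : ∀ X Y, (0 : ℝ) ≤ G.edgeDensity X Y := fun X Y => by
    exact_mod_cast G.edgeDensity_nonneg X Y
  have hd1 : ∀ X Y, (G.edgeDensity X Y : ℝ) ≤ 1 := fun X Y => by
    exact_mod_cast G.edgeDensity_le_one X Y
  have hAB0 : 0 ≤ dAB := hd0 _ _
  have hAC0 : 0 ≤ dAC := hd0 _ _
  have hBC0 : 0 ≤ dBC := hd0 _ _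
  have hBC1 : dBC ≤ 1 := hd1 _ _
  have hBle : ∀ x, ((nB x).card : ℝ) ≤ B.card := fun x => by
    exact_mod_cast Finset.card_filter_le _ _
  have hCle : ∀ x, ((nC x).card : ℝ) ≤ C.card := fun x => by
    exact_mod_cast Finset.card_filter_le _ _
  have hx1 : ∀ x, ∑ y ∈ B, ∑ z ∈ C, (if G.Adj x y ∧ G.Adj y z ∧ G.Adj x z then (1 : ℝ) else 0) =
      G.edgeDensity (nB x) (nC x) * ((nB x).card * (nC x).card) := by
    intro x
    rw [edgeDensity_mul_card, hnB, Finset.sum_filter]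
    refine Finset.sum_congr rfl fun y _ => ?_
    by_cases hxy : G.Adj x y
    · simp only [hxy, true_and, if_true, hnC, Finset.filter_filter]
      rw [Finset.card_filter, Nat.cast_sum]
      refine Finset.sum_congr rfl fun z _ => ?_
      by_cases h1 : G.Adj y z <;> by_cases h2 : G.Adj x z <;> simp [h1, h2]
    · simp [hxy]
  have hx2 : ∀ x, (G.edgeDensity (nB x) (nC x) : ℝ) * ((nB x).card * (nC x).card) ≤
      (dBC + ε) * ((nB x).card * (nC x).card) + ε * (B.card * C.card) := by
    intro x
    have hb : (0 : ℝ) ≤ (nB x).card := by positivity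
    have hc : (0 : ℝ) ≤ (nC x).card := by positivity
    have hB : (0 : ℝ) ≤ B.card := by positivity
    have hC : (0 : ℝ) ≤ C.card := by positivity
    have hmain : (nB x).card * (nC x).card ≤ ε * (B.card * C.card) →
        (G.edgeDensity (nB x) (nC x) : ℝ) * ((nB x).card * (nC x).card) ≤
        (dBC + ε) * ((nB x).card * (nC x).card) + ε * (B.card * C.card) := by
      intro h
      have h1 : (G.edgeDensity (nB x) (nC x) : ℝ) * ((nB x).card * (nC x).card) ≤
          1 * ((nB x).card * (nC x).card) := by
        gcongr
        exact hd1 _ _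
      have : 0 ≤ (dBC + ε) * ((nB x).card * (nC x).card) := by positivity
      linarith
    by_cases h1 : B.card * ε ≤ (nB x).card
    · by_cases h2 : C.card * ε ≤ (nC x).card
      · have h3 := hBC (Finset.filter_subset _ _ : nB x ⊆ B) (Finset.filter_subset _ _ : nC x ⊆ C)
          h1 h2
        rw [abs_lt] at h3
        have h4 : (G.edgeDensity (nB x) (nC x) : ℝ) * ((nB x).card * (nC x).card) ≤
            (dBC + ε) * ((nB x).card * (nC x).card) := by
          gcongr
          linarith [h3.2]
        have : 0 ≤ ε * (B.card * C.card) := by positivity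
        linarith
      · push Not at h2
        refine hmain ?_
        calc ((nB x).card : ℝ) * (nC x).card ≤ B.card * (C.card * ε) := by
              exact mul_le_mul (hBle x) h2.le hc hB
          _ = _ := by ring
    · push Not at h1
      refine hmain ?_
      calc ((nB x).card : ℝ) * (nC x).card ≤ (B.card * ε) * C.card := by
            exact mul_le_mul h1.le (hCle x) hc (mul_nonneg hB hε0.le)
        _ = _ := by ring
  set XB := A.filter fun x => (dAB + ε) * B.card < ((nB x).card : ℝ) with hXB
  set XC := A.filter fun x => (dAC + ε) * C.card < ((nC x).card : ℝ) with hXC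
  have hXB1 : (XB.card : ℝ) ≤ A.card * ε :=
    card_high_degree_le hAB subset_rfl subset_rfl (mul_le_of_le_one_right (by positivity) hε)
  have hXC1 : (XC.card : ℝ) ≤ A.card * ε :=
    card_high_degree_le hAC subset_rfl subset_rfl (mul_le_of_le_one_right (by positivity) hε)
  have hx3 : ∀ x ∈ A, ((nB x).card : ℝ) * (nC x).card ≤ (dAB + ε) * (dAC + ε) * (B.card * C.card) +
      ((if (dAB + ε) * B.card < ((nB x).card : ℝ) then 1 else 0) +
        (if (dAC + ε) * C.card < ((nC x).card : ℝ) then 1 else 0)) * (B.card * C.card) := by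
    intro x _
    have h1 : ((nB x).card : ℝ) * (nC x).card ≤ B.card * C.card := by
      exact mul_le_mul (hBle x) (hCle x) (by positivity) (by positivity)
    have h2 : 0 ≤ (dAB + ε) * (dAC + ε) * (B.card * C.card) := by positivity
    have h3 : (0 : ℝ) ≤ B.card * C.card := by positivity
    split_ifs with h4 h5 h5
    · linarith
    · linarith
    · linarith
    · push Not at h4 h5
      calc ((nB x).card : ℝ) * (nC x).card ≤ ((dAB + ε) * B.card) * ((dAC + ε) * C.card) := by
            gcongr
        _ = _ := by ring
  have hsum : ∑ x ∈ A, ((nB x).card : ℝ) * (nC x).card ≤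
      (dAB + ε) * (dAC + ε) * (A.card * B.card * C.card) +
        (XB.card + XC.card) * (B.card * C.card) := by
    refine (Finset.sum_le_sum hx3).trans (le_of_eq ?_)
    rw [Finset.sum_add_distrib, ← Finset.sum_mul (f := fun x =>
      ((if (dAB + ε) * B.card < ((nB x).card : ℝ) then (1 : ℝ) else 0) +
        (if (dAC + ε) * C.card < ((nC x).card : ℝ) then 1 else 0))), Finset.sum_add_distrib,
      Finset.sum_const, nsmul_eq_mul, hXB, hXC, Finset.card_filter, Finset.card_filter]
    push_cast
    ring
  have hP : (0 : ℝ) ≤ B.card * C.card := by positivity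
  have hP' : (0 : ℝ) ≤ A.card * B.card * C.card := by positivity
  calc triBetween G A B C
      = ∑ x ∈ A, (G.edgeDensity (nB x) (nC x) : ℝ) * ((nB x).card * (nC x).card) :=
        Finset.sum_congr rfl fun x _ => hx1 x
    _ ≤ ∑ x ∈ A, ((dBC + ε) * ((nB x).card * (nC x).card) + ε * (B.card * C.card)) :=
        Finset.sum_le_sum fun x _ => hx2 x
    _ = (dBC + ε) * ∑ x ∈ A, ((nB x).card : ℝ) * (nC x).card +
        ε * (A.card * B.card * C.card) := by
        rw [Finset.sum_add_distrib, ← Finset.mul_sum, Finset.sum_const, nsmul_eq_mul]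
        ring
    _ ≤ (dBC + ε) * ((dAB + ε) * (dAC + ε) * (A.card * B.card * C.card) +
        (A.card * ε + A.card * ε) * (B.card * C.card)) + ε * (A.card * B.card * C.card) := by
        gcongr
        refine hsum.trans ?_
        gcongr
    _ = (dAB + ε) * (dAC + ε) * (dBC + ε) * (A.card * B.card * C.card) +
        (2 * (dBC + ε) * ε + ε) * (A.card * B.card * C.card) := by ring
    _ ≤ _ := by
        have : (2 * (dBC + ε) * ε + ε) * (A.card * B.card * C.card : ℝ) ≤
            5 * ε * (A.card * B.card * C.card) := by
          gcongr
          nlinarith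
        linarith

end Uniform

/-! ### The reduced weighted graph. -/

theorem sum_univ_eq_sum_parts {V : Type*} [Fintype V] [DecidableEq V]
    (P : Finpartition (Finset.univ : Finset V)) (f : V → ℝ) :
    ∑ x, f x = ∑ A : {A // A ∈ P.parts}, ∑ x ∈ A.1, f x := by
  rw [Finset.sum_coe_sort P.parts (fun A => ∑ x ∈ A, f x)]
  conv_lhs => rw [← P.biUnion_parts]
  rw [Finset.sum_biUnion]
  · rfl
  · exact P.supIndep.pairwiseDisjoint

theorem ordTri_eq_sum_parts {V : Type*} [Fintype V] [DecidableEq V] (G : SimpleGraph V)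
    [DecidableRel G.Adj] (P : Finpartition (Finset.univ : Finset V)) :
    (ordTri G : ℝ) = ∑ A : {A // A ∈ P.parts}, ∑ B : {A // A ∈ P.parts},
      ∑ C : {A // A ∈ P.parts}, triBetween G A.1 B.1 C.1 := by
  have h1 : (ordTri G : ℝ) = ∑ x, ∑ y, ∑ z, if G.Adj x y ∧ G.Adj y z ∧ G.Adj x z then 1 else 0 := by
    unfold ordTri
    rw [Finset.card_filter, Nat.cast_sum, ← Finset.univ_product_univ, Finset.sum_product]
    refine Finset.sum_congr rfl fun x _ => ?_
    rw [← Finset.univ_product_univ, Finset.sum_product]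
    refine Finset.sum_congr rfl fun y _ => Finset.sum_congr rfl fun z _ => ?_
    simp
  rw [h1, sum_univ_eq_sum_parts P]
  refine Finset.sum_congr rfl fun A _ => ?_
  have h2 : ∀ x, ∑ y, ∑ z, (if G.Adj x y ∧ G.Adj y z ∧ G.Adj x z then (1 : ℝ) else 0) =
      ∑ B : {A // A ∈ P.parts}, ∑ C : {A // A ∈ P.parts}, ∑ y ∈ B.1, ∑ z ∈ C.1,
        if G.Adj x y ∧ G.Adj y z ∧ G.Adj x z then (1 : ℝ) else 0 := by
    intro x
    rw [sum_univ_eq_sum_parts P]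
    refine Finset.sum_congr rfl fun B _ => ?_
    rw [Finset.sum_comm (s := (Finset.univ : Finset {A // A ∈ P.parts}))]
    exact Finset.sum_congr rfl fun y _ => sum_univ_eq_sum_parts P _
  simp only [h2]
  rw [Finset.sum_comm]
  refine Finset.sum_congr rfl fun B _ => ?_
  rw [Finset.sum_comm]
  rfl

theorem mul_add_const_le {x y z η : ℝ} (hx : 0 ≤ x) (hx1 : x ≤ 1) (hy : 0 ≤ y) (hy1 : y ≤ 1)
    (hz : 0 ≤ z) (hz1 : z ≤ 1) (hη : 0 ≤ η) (hη1 : η ≤ 1) :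
    (x + η) * (z + η) * (y + η) ≤ x * y * z + 7 * η := by
  have p1 : x * z ≤ 1 := mul_le_one₀ hx1 hz hz1
  have p2 : z * y ≤ 1 := mul_le_one₀ hz1 hy hy1
  have p3 : x * y ≤ 1 := mul_le_one₀ hx1 hy hy1
  have p4 : η * (x + y + z) ≤ 1 * 3 := mul_le_mul hη1 (by linarith) (by linarith) (by norm_num)
  have p5 : η * η ≤ 1 := mul_le_one₀ hη1 hη hη1
  have q1 : η * (x * z + z * y + x * y) ≤ η * 3 := mul_le_mul_of_nonneg_left (by linarith) hη
  have q2 : η * (η * (x + y + z)) ≤ η * (1 * 3) := mul_le_mul_of_nonneg_left p4 hη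
  have q3 : η * (η * η) ≤ η * 1 := mul_le_mul_of_nonneg_left p5 hη
  have e : (x + η) * (z + η) * (y + η) = x * y * z + η * (x * z + z * y + x * y) +
    η * (η * (x + y + z)) + η * (η * η) := by ring
  linarith

open Classical in
/-- In a regular partition few pairs of parts are equal or irregular. -/
theorem sum_bad_pairs_le {V : Type*} [Fintype V] [DecidableEq V] {G : SimpleGraph V}
    {P : Finpartition (Finset.univ : Finset V)} {ε : ℝ} (hε : 0 ≤ ε) (hP : P.IsUniform G ε) :
    ∑ A : {A // A ∈ P.parts}, ∑ B : {A // A ∈ P.parts},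
      (if A = B ∨ ¬G.IsUniform ε A.1 B.1 then (1 : ℝ) else 0) ≤
      P.parts.card + ε * (P.parts.card : ℝ) ^ 2 := by
  have h1 : ∀ A B : {A // A ∈ P.parts},
      (if A = B ∨ ¬G.IsUniform ε A.1 B.1 then (1 : ℝ) else 0) ≤ (if A = B then 1 else 0) +
      (if (A.1, B.1) ∈ P.nonUniforms G ε then 1 else 0) := by
    intro A B
    by_cases hAB : A = B
    · simp only [hAB, true_or, if_true]
      split_ifs <;> norm_num
    · by_cases hu : G.IsUniform ε A.1 B.1
      · simp only [hAB, hu, not_true, or_self, if_false]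
        split_ifs <;> norm_num
      · have : (A.1, B.1) ∈ P.nonUniforms G ε :=
          (Finpartition.mk_mem_nonUniforms _ _).2 ⟨A.2, B.2, fun h => hAB (Subtype.ext h), hu⟩
        simp [hAB, hu, this]
  refine (Finset.sum_le_sum fun A _ => Finset.sum_le_sum fun B _ => h1 A B).trans ?_
  simp only [Finset.sum_add_distrib, Finset.sum_ite_eq, Finset.mem_univ, if_true]
  have h2 : ∑ A : {A // A ∈ P.parts}, (1 : ℝ) = P.parts.card := by simp
  have h3 : ∑ A : {A // A ∈ P.parts}, ∑ B : {A // A ∈ P.parts},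
      (if (A.1, B.1) ∈ P.nonUniforms G ε then (1 : ℝ) else 0) = (P.nonUniforms G ε).card := by
    rw [Finset.sum_coe_sort P.parts (fun A => ∑ B : {A // A ∈ P.parts},
      (if (A, B.1) ∈ P.nonUniforms G ε then (1 : ℝ) else 0))]
    have : ∀ A, ∑ B : {A // A ∈ P.parts}, (if (A, B.1) ∈ P.nonUniforms G ε then (1 : ℝ) else 0) =
        ∑ B ∈ P.parts, (if (A, B) ∈ P.nonUniforms G ε then (1 : ℝ) else 0) := fun A =>
      Finset.sum_coe_sort P.parts (fun B => (if (A, B) ∈ P.nonUniforms G ε then (1 : ℝ) else 0))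
    simp only [this]
    rw [← Finset.sum_product', ← Finset.sum_filter, Finset.sum_const, nsmul_eq_mul, mul_one]
    congr 2
    ext ⟨A, B⟩
    simp only [Finset.mem_filter, Finset.mem_product, Finpartition.mk_mem_nonUniforms]
    tauto
  rw [h2, h3]
  have h4 : ((P.nonUniforms G ε).card : ℝ) ≤
      ((P.parts.card * (P.parts.card - 1) : ℕ) : ℝ) * ε := hP
  have h5 : ((P.parts.card * (P.parts.card - 1) : ℕ) : ℝ) ≤ (P.parts.card : ℝ) ^ 2 := by
    have : P.parts.card * (P.parts.card - 1) ≤ P.parts.card ^ 2 := by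
      rw [sq]
      exact Nat.mul_le_mul_left _ (Nat.sub_le _ _)
    exact_mod_cast this
  have h6 := mul_le_mul_of_nonneg_right h5 hε
  linarith

/-- Here `b` marks bad pairs. Each bad pair spoils at most one triple for every third index and
position, whence the term `3β|ι|`. -/
theorem sum_triples_le {ι : Type*} [Fintype ι] {τ w : ι → ι → ι → ℝ} {b : ι → ι → ℝ}
    {s c W β : ℝ} (hs : 0 ≤ s)
    (hτ : ∀ A B C, τ A B C ≤ s * (w A B C + c + (b A B + b B C + b A C)))
    (hw : ∑ A, ∑ B, ∑ C, w A B C ≤ W) (hb : ∑ A, ∑ B, b A B ≤ β) :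
    ∑ A, ∑ B, ∑ C, τ A B C ≤
      s * (W + c * (Fintype.card ι : ℝ) ^ 3 + 3 * (β * Fintype.card ι)) := by
  have hk : (0 : ℝ) ≤ Fintype.card ι := by positivity
  have hb1 : ∑ A, ∑ B, ∑ C : ι, b A B ≤ β * Fintype.card ι := by
    have : ∑ A, ∑ B, ∑ C : ι, b A B = (∑ A, ∑ B, b A B) * Fintype.card ι := by
      simp only [Finset.sum_const, Finset.card_univ, nsmul_eq_mul, Finset.sum_mul]
      exact Finset.sum_congr rfl fun _ _ => Finset.sum_congr rfl fun _ _ => mul_comm _ _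
    rw [this]
    exact mul_le_mul_of_nonneg_right hb hk
  have hb2 : ∑ A : ι, ∑ B, ∑ C, b B C ≤ β * Fintype.card ι := by
    have : ∑ A : ι, ∑ B, ∑ C, b B C = (∑ A, ∑ B, b A B) * Fintype.card ι := by
      rw [Finset.sum_const, Finset.card_univ, nsmul_eq_mul, mul_comm]
    rw [this]
    exact mul_le_mul_of_nonneg_right hb hk
  have hb3 : ∑ A, ∑ B : ι, ∑ C, b A C ≤ β * Fintype.card ι := by
    have : ∑ A, ∑ B : ι, ∑ C, b A C = (∑ A, ∑ B, b A B) * Fintype.card ι := by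
      simp only [Finset.sum_const, Finset.card_univ, nsmul_eq_mul]
      rw [← Finset.mul_sum, mul_comm]
    rw [this]
    exact mul_le_mul_of_nonneg_right hb hk
  have hc : ∑ A : ι, ∑ B : ι, ∑ C : ι, c = c * (Fintype.card ι : ℝ) ^ 3 := by
    simp only [Finset.sum_const, Finset.card_univ, nsmul_eq_mul]
    ring
  calc ∑ A, ∑ B, ∑ C, τ A B C
      ≤ ∑ A, ∑ B, ∑ C, s * (w A B C + c + (b A B + b B C + b A C)) :=
        Finset.sum_le_sum fun A _ => Finset.sum_le_sum fun B _ => Finset.sum_le_sum fun C _ =>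
          hτ A B C
    _ = s * (∑ A, ∑ B, ∑ C, w A B C + ∑ A : ι, ∑ B : ι, ∑ C : ι, c + (∑ A, ∑ B, ∑ C : ι, b A B +
          ∑ A : ι, ∑ B, ∑ C, b B C + ∑ A, ∑ B : ι, ∑ C, b A C)) := by
        simp only [← Finset.mul_sum, Finset.sum_add_distrib]
    _ ≤ _ := by
        rw [hc]
        exact mul_le_mul_of_nonneg_left (by linarith) hs

theorem triBetween_le_of_weights {V : Type*} {G : SimpleGraph V} [DecidableRel G.Adj]
    {A B C : Finset V} {ε γ s x y z : ℝ} (hε : γ + ε ≤ 1) (hAB : G.IsUniform ε A B)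
    (hAC : G.IsUniform ε A C) (hBC : G.IsUniform ε B C)
    (hs : (A.card : ℝ) * B.card * C.card ≤ s) (hx : 0 ≤ x) (hx1 : x ≤ 1) (hy : 0 ≤ y) (hy1 : y ≤ 1)
    (hz : 0 ≤ z) (hz1 : z ≤ 1) (hγ : 0 ≤ γ) (hdx : (G.edgeDensity A B : ℝ) ≤ x + γ)
    (hdy : (G.edgeDensity B C : ℝ) ≤ y + γ) (hdz : (G.edgeDensity A C : ℝ) ≤ z + γ) :
    triBetween G A B C ≤ (x * y * z + (7 * γ + 12 * ε)) * s := by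
  have hε0 := hAB.pos
  have hd0 : ∀ X Y : Finset V, (0 : ℝ) ≤ G.edgeDensity X Y := fun X Y => by
    exact_mod_cast G.edgeDensity_nonneg X Y
  refine (triBetween_le (by linarith) hAB hAC hBC).trans ?_
  have d1 := hd0 A B
  have d2 := hd0 B C
  have d3 := hd0 A C
  have h5 : (G.edgeDensity A B + ε : ℝ) * (G.edgeDensity A C + ε) * (G.edgeDensity B C + ε) ≤
      (x + (γ + ε)) * (z + (γ + ε)) * (y + (γ + ε)) := by
    refine mul_le_mul (mul_le_mul ?_ ?_ ?_ ?_) ?_ ?_ ?_ <;>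
      first | linarith | exact mul_nonneg (by linarith) (by linarith)
  have h6 := mul_add_const_le hx hx1 hy hy1 hz hz1 (by positivity : 0 ≤ γ + ε) hε
  have h7 : 0 ≤ x * y * z := by positivity
  exact mul_le_mul (by linarith) hs (by positivity) (by positivity)

/-- The error budget: `1/ε ≤ k` turns `k²` into `εk³`, so the errors total `7γ + 18ε ≤ δ/4`.
Rounding of part sizes costs a factor `(1 + δ/28)^3 ≤ 1 + δ/4`, and `(1 + δ/4)(B + δ/4) < B + δ`. -/
theorem density_increment_arith {B δ γ ε k s n : ℝ} (hB0 : 0 ≤ B) (hB1 : B ≤ 1) (hδ : 0 < δ)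
    (hδ1 : δ ≤ 1) (hγδ : 100 * γ ≤ δ) (hε : 0 < ε) (hεδ : 100 * ε ≤ δ) (hk : 1 / ε ≤ k)
    (hk0 : 0 < k) (hs : 0 ≤ s) (hsk : s * k ≤ n * (1 + δ / 28)) (hn : 0 < n) :
    s ^ 3 * (B * k ^ 3 + (7 * γ + 12 * ε) * k ^ 3 + 3 * ((k + ε * k ^ 2) * k)) <
      (B + δ) * n ^ 3 := by
  have hk3 : 0 < k ^ 3 := by positivity
  have hk2 : k ^ 2 ≤ ε * k ^ 3 := by
    rw [div_le_iff₀ hε] at hk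
    nlinarith [sq_nonneg k]
  have h1 : 100 * γ * k ^ 3 ≤ δ * k ^ 3 := mul_le_mul_of_nonneg_right hγδ hk3.le
  have h2 : 100 * ε * k ^ 3 ≤ δ * k ^ 3 := mul_le_mul_of_nonneg_right hεδ hk3.le
  have e : (k + ε * k ^ 2) * k = k ^ 2 + ε * k ^ 3 := by ring
  have h9 : (1 + δ / 28) ^ 3 ≤ 1 + δ / 4 := by
    have h3 : δ ^ 2 ≤ δ := by nlinarith
    have h4 : δ ^ 3 ≤ δ := by nlinarith [pow_nonneg hδ.le 2]
    nlinarith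
  calc s ^ 3 * (B * k ^ 3 + (7 * γ + 12 * ε) * k ^ 3 + 3 * ((k + ε * k ^ 2) * k))
      ≤ s ^ 3 * ((B + δ / 4) * k ^ 3) := by
        refine mul_le_mul_of_nonneg_left ?_ (by positivity)
        rw [e]
        linarith
    _ = (s * k) ^ 3 * (B + δ / 4) := by ring
    _ ≤ (n * (1 + δ / 28)) ^ 3 * (B + δ / 4) := by gcongr
    _ = (1 + δ / 28) ^ 3 * (B + δ / 4) * n ^ 3 := by ring
    _ ≤ (1 + δ / 4) * (B + δ / 4) * n ^ 3 := by gcongr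
    _ < _ := by
        refine mul_lt_mul_of_pos_right ?_ (by positivity)
        nlinarith

open Classical in
theorem exists_regular_partition {ε : ℝ} (hε : 0 < ε) (l : ℕ) :
    ∃ M : ℕ, 0 < M ∧ ∀ n ≥ l, ∀ G : SimpleGraph (Fin n),
      ∃ P : Finpartition (Finset.univ : Finset (Fin n)), P.IsEquipartition ∧ l ≤ P.parts.card ∧
        P.parts.card ≤ M ∧ P.IsUniform G ε :=
  ⟨SzemerediRegularity.bound ε l, SzemerediRegularity.bound_pos ε l, fun n hn G =>
    szemeredi_regularity G hε (by rwa [Fintype.card_fin])⟩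

open Classical in
-- Triples of parts with an equal or irregular pair are bounded trivially and are few; the others
-- are bounded by the counting lemma, with densities replaced by the weights.
theorem ordTri_le_of_weights {V : Type*} [Fintype V] [DecidableEq V] {G : SimpleGraph V}
    {P : Finpartition (Finset.univ : Finset V)} {ε γ s W : ℝ} (hε : 0 ≤ ε) (hγ : 0 ≤ γ)
    (hγε : γ + ε ≤ 1) (hPU : P.IsUniform G ε) (hs0 : 0 ≤ s)
    (hcard : ∀ A : {A // A ∈ P.parts}, (A.1.card : ℝ) ≤ s)
    {w : {A // A ∈ P.parts} → {A // A ∈ P.parts} → ℝ} (hw0 : ∀ A B, 0 ≤ w A B)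
    (hw1 : ∀ A B, w A B ≤ 1)
    (hw : ∀ A B, ¬(A = B ∨ ¬G.IsUniform ε A.1 B.1) → (G.edgeDensity A.1 B.1 : ℝ) ≤ w A B + γ)
    (hT : ∑ A, ∑ B, ∑ C, w A B * w B C * w A C ≤ W) :
    (ordTri G : ℝ) ≤ s ^ 3 * (W + (7 * γ + 12 * ε) * (P.parts.card : ℝ) ^ 3 +
      3 * ((P.parts.card + ε * (P.parts.card : ℝ) ^ 2) * P.parts.card)) := by
  obtain ⟨b, hb⟩ : ∃ b : {A // A ∈ P.parts} → {A // A ∈ P.parts} → ℝ,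
      ∀ A B, b A B = if A = B ∨ ¬G.IsUniform ε A.1 B.1 then (1 : ℝ) else 0 := ⟨_, fun _ _ => rfl⟩
  have hb0 : ∀ A B, 0 ≤ b A B := fun A B => by rw [hb]; split_ifs <;> norm_num
  have hbsum : ∑ A, ∑ B, b A B ≤ P.parts.card + ε * (P.parts.card : ℝ) ^ 2 := by
    simp only [hb]
    exact sum_bad_pairs_le hε hPU
  have hτ : ∀ A B C : {A // A ∈ P.parts}, triBetween G A.1 B.1 C.1 ≤
      s ^ 3 * (w A B * w B C * w A C + (7 * γ + 12 * ε) + (b A B + b B C + b A C)) := by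
    intro A B C
    have hABC : (A.1.card : ℝ) * B.1.card * C.1.card ≤ s ^ 3 := by
      calc (A.1.card : ℝ) * B.1.card * C.1.card ≤ s * s * s := by
            gcongr <;> exact hcard _
        _ = s ^ 3 := by ring
    have hwww : 0 ≤ w A B * w B C * w A C :=
      mul_nonneg (mul_nonneg (hw0 _ _) (hw0 _ _)) (hw0 _ _)
    have h2 := hb0 A B
    have h3 := hb0 B C
    have h4 := hb0 A C
    by_cases hbad : (A = B ∨ ¬G.IsUniform ε A.1 B.1) ∨ (B = C ∨ ¬G.IsUniform ε B.1 C.1) ∨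
        (A = C ∨ ¬G.IsUniform ε A.1 C.1)
    · have h1 : 1 ≤ b A B + b B C + b A C := by
        rcases hbad with h | h | h
        · have : b A B = 1 := (hb _ _).trans (if_pos h)
          linarith
        · have : b B C = 1 := (hb _ _).trans (if_pos h)
          linarith
        · have : b A C = 1 := (hb _ _).trans (if_pos h)
          linarith
      refine (triBetween_le_mul _ _ _).trans (hABC.trans ?_)
      exact le_mul_of_one_le_right (by positivity) (by linarith)
    · obtain ⟨h5, h67⟩ := not_or.1 hbad
      obtain ⟨h6, h7⟩ := not_or.1 h67
      have hU : ∀ X Y : {A // A ∈ P.parts}, ¬(X = Y ∨ ¬G.IsUniform ε X.1 Y.1) →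
          G.IsUniform ε X.1 Y.1 := by
        intro X Y h
        rw [not_or, not_not] at h
        exact h.2
      calc _ ≤ (w A B * w B C * w A C + (7 * γ + 12 * ε)) * s ^ 3 :=
            triBetween_le_of_weights hγε (hU _ _ h5) (hU _ _ h7) (hU _ _ h6)
              hABC (hw0 _ _) (hw1 _ _) (hw0 _ _) (hw1 _ _) (hw0 _ _) (hw1 _ _) hγ
              (hw _ _ h5) (hw _ _ h6) (hw _ _ h7)
        _ ≤ _ := by
            rw [mul_comm]
            exact mul_le_mul_of_nonneg_left (by linarith) (by positivity)
  rw [ordTri_eq_sum_parts G P]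
  have h1 := sum_triples_le (τ := fun A B C : {A // A ∈ P.parts} => triBetween G A.1 B.1 C.1)
    (w := fun A B C => w A B * w B C * w A C) (b := b) (s := s ^ 3) (by positivity) hτ hT hbsum
  rwa [Fintype.card_coe] at h1

open Classical in
-- Densities below `γ` become `0`, those below `1/2 + γ` become `1/2`, and the rest `1`. Each
-- density thus exceeds its weight by at most `γ`, while a positive weight certifies density `γ` and
-- weight `1` certifies density `1/2 + γ`.
theorem exists_weights {ℓ : ℕ} (hℓ : 3 ≤ ℓ) {V : Type*} (G : SimpleGraph V)
    (ε : ℝ) {γ : ℝ} (hγ : 0 ≤ γ) (parts : Finset (Finset V))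
    (hno : ∀ K J : Finset (Finset V), J ⊆ K → K.card + J.card = 2 * ℓ + 1 → K ⊆ parts →
      (∀ A ∈ K, ∀ B ∈ K, A ≠ B → G.IsUniform ε A B ∧ γ ≤ G.edgeDensity A B) →
      ∃ A ∈ J, ∃ B ∈ J, A ≠ B ∧ (G.edgeDensity A B : ℝ) < 1 / 2 + γ) :
    ∃ w : {A // A ∈ parts} → {A // A ∈ parts} → ℝ, (∀ A B, 0 ≤ w A B) ∧ (∀ A B, w A B ≤ 1) ∧
      (∀ A B, ¬(A = B ∨ ¬G.IsUniform ε A.1 B.1) → (G.edgeDensity A.1 B.1 : ℝ) ≤ w A B + γ) ∧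
      ∑ A, ∑ B, ∑ C, w A B * w B C * w A C ≤
        (1 - 1 / (ℓ : ℝ)) * (1 - 2 / (ℓ : ℝ)) * (parts.card : ℝ) ^ 3 := by
  obtain ⟨w, hw⟩ : ∃ w : {A // A ∈ parts} → {A // A ∈ parts} → ℝ, ∀ A B, w A B =
      if A = B ∨ ¬G.IsUniform ε A.1 B.1 then 0 else
      if (G.edgeDensity A.1 B.1 : ℝ) < γ then 0 else
      if (G.edgeDensity A.1 B.1 : ℝ) < 1 / 2 + γ then 1 / 2 else 1 := ⟨_, fun _ _ => rfl⟩
  have hws : ∀ A B, w A B = w B A := by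
    intro A B
    have h : (A = B ∨ ¬G.IsUniform ε A.1 B.1) ↔ (B = A ∨ ¬G.IsUniform ε B.1 A.1) := by
      rw [eq_comm, SimpleGraph.isUniform_comm]
    rw [hw, hw, G.edgeDensity_comm A.1 B.1, if_congr h rfl rfl]
  have hw3 : ∀ A B, w A B = 0 ∨ w A B = 1 / 2 ∨ w A B = 1 := by
    intro A B
    rw [hw]
    split_ifs <;> simp
  have hne : ∀ A B, w A B ≠ 0 → G.IsUniform ε A.1 B.1 ∧ γ ≤ G.edgeDensity A.1 B.1 := by
    intro A B h
    rw [hw] at h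
    split_ifs at h with h1 h2
    · exact absurd rfl h
    · exact absurd rfl h
    all_goals exact ⟨not_not.1 (not_or.1 h1).2, not_lt.1 h2⟩
  have hone : ∀ A B, w A B = 1 → (1 : ℝ) / 2 + γ ≤ G.edgeDensity A.1 B.1 := by
    intro A B h
    rw [hw] at h
    split_ifs at h with h1 h2 h3
    · norm_num at h
    · norm_num at h
    · norm_num at h
    · exact not_lt.1 h3
  refine ⟨w, fun A B => ?_, fun A B => ?_, fun A B h => ?_, ?_⟩
  · rcases hw3 A B with h | h | h <;> rw [h] <;> norm_num
  · rcases hw3 A B with h | h | h <;> rw [h] <;> norm_num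
  · have h5 : (G.edgeDensity A.1 B.1 : ℝ) ≤ 1 := by
      exact_mod_cast G.edgeDensity_le_one A.1 B.1
    rw [hw, if_neg h]
    split_ifs <;> linarith
  have hT := weighted_turan hℓ hws (fun A => by rw [hw]; simp) hw3 (by
    intro K J hJK hK hJ hc
    obtain ⟨A, hA, B, hB, hAB, hlt⟩ := hno (K.image Subtype.val) (J.image Subtype.val)
      (Finset.image_subset_image hJK)
      (by rwa [Finset.card_image_of_injective _ Subtype.val_injective,
        Finset.card_image_of_injective _ Subtype.val_injective])
      (by
        intro A hA
        obtain ⟨A, -, rfl⟩ := Finset.mem_image.1 hA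
        exact A.2)
      (by
        intro A hA B hB hAB
        obtain ⟨A', hA', rfl⟩ := Finset.mem_image.1 hA
        obtain ⟨B', hB', rfl⟩ := Finset.mem_image.1 hB
        exact hne _ _ (hK A' hA' B' hB' (fun h => hAB (by rw [h]))))
    obtain ⟨A', hA', rfl⟩ := Finset.mem_image.1 hA
    obtain ⟨B', hB', rfl⟩ := Finset.mem_image.1 hB
    exact absurd (hone _ _ (hJ A' hA' B' hB' (fun h => hAB (by rw [h])))) (not_le.2 hlt))
  rwa [Fintype.card_coe] at hT

open Classical in
/-- A graph with more triangles than the balanced complete `ℓ`-partite graph has a system of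
pairwise regular and dense vertex sets, some of them of pairwise density above `1 / 2`, whose
weighted size is `2 * ℓ + 1`. -/
theorem exists_regular_clique {ℓ : ℕ} (hℓ : 3 ≤ ℓ) {δ γ ε : ℝ} (hδ : 0 < δ) (hδ1 : δ ≤ 1)
    (hγ : 0 < γ) (hγδ : 100 * γ ≤ δ) (hε : 0 < ε) (hεδ : 100 * ε ≤ δ) :
    ∃ M N₀ : ℕ, 0 < M ∧ ∀ n ≥ N₀, ∀ G : SimpleGraph (Fin n),
      ((1 - 1 / (ℓ : ℝ)) * (1 - 2 / (ℓ : ℝ)) + δ) * (n : ℝ) ^ 3 ≤ ordTri G →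
      ∃ K J : Finset (Finset (Fin n)), J ⊆ K ∧ K.card + J.card = 2 * ℓ + 1 ∧
        (∀ A ∈ K, n ≤ M * A.card) ∧
        (∀ A ∈ K, ∀ B ∈ K, A ≠ B → G.IsUniform ε A B ∧ γ ≤ G.edgeDensity A B) ∧
        (∀ A ∈ J, ∀ B ∈ J, A ≠ B → 1 / 2 + γ ≤ G.edgeDensity A B) := by
  set Bd : ℝ := (1 - 1 / (ℓ : ℝ)) * (1 - 2 / (ℓ : ℝ)) with hBd
  have hℓ' : (3 : ℝ) ≤ ℓ := by exact_mod_cast hℓ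
  have hB0 : 0 ≤ Bd ∧ Bd ≤ 1 := by
    have h1 : 1 / (ℓ : ℝ) ≤ 1 := by rw [div_le_one (by linarith)]; linarith
    have h2 : 2 / (ℓ : ℝ) ≤ 1 := by rw [div_le_one (by linarith)]; linarith
    have h3 : 0 ≤ 1 / (ℓ : ℝ) := by positivity
    have h4 : 0 ≤ 2 / (ℓ : ℝ) := by positivity
    constructor <;> rw [hBd] <;> nlinarith
  obtain ⟨l, hl0, hl⟩ : ∃ l : ℕ, 0 < l ∧ 1 / ε ≤ l :=
    ⟨⌈1 / ε⌉₊, Nat.ceil_pos.2 (by positivity), Nat.le_ceil _⟩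
  obtain ⟨Mb, hMb0, hreg⟩ := exists_regular_partition hε l
  -- The factor `2` pays for rounding down `n / k`, which is at least `1`. The bound `28 * Mb / δ`
  -- makes the extra vertex per part negligible, giving the factor `1 + δ/28`.
  refine ⟨2 * Mb, max (max l Mb) ⌈28 * Mb / δ⌉₊, by omega, fun n hn G hG => ?_⟩
  have hnl : l ≤ n := (le_max_left _ _).trans ((le_max_left _ _).trans hn)
  have hnM : Mb ≤ n := (le_max_right _ _).trans ((le_max_left _ _).trans hn)
  have hnτ : (Mb : ℝ) ≤ δ / 28 * n := by
    have : 28 * Mb / δ ≤ n := Nat.ceil_le.1 ((le_max_right _ _).trans hn)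
    rw [div_le_iff₀ hδ] at this
    linarith
  obtain ⟨P, hPe, hPl, hPM, hPU⟩ := hreg n hnl G
  by_contra hno
  push Not at hno
  set k := P.parts.card with hk
  have hk0 : 0 < k := hl0.trans_le hPl
  have hkl : 1 / ε ≤ k := hl.trans (by exact_mod_cast hPl)
  have hkr : (0 : ℝ) < k := by exact_mod_cast hk0
  obtain ⟨w, hw0, hw1, hw, hT⟩ := exists_weights hℓ G ε hγ.le P.parts (by
    intro K J hJK hc hK hKU
    obtain ⟨A, hA, B, hB, hAB, hlt⟩ := hno K J hJK hc (by
      intro A hA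
      have h1 := hPe.average_le_card_part (hK hA)
      rw [Finset.card_univ, Fintype.card_fin, ← hk] at h1
      have h2 : 1 ≤ n / k := (Nat.one_le_div_iff hk0).2 (hPM.trans hnM)
      have h3 : n < n / k * k + k := Nat.lt_div_mul_add hk0
      calc n ≤ 2 * (n / k * k) := by nlinarith
        _ ≤ 2 * (A.card * Mb) := by gcongr
        _ = _ := by ring) hKU
    exact ⟨A, hA, B, hB, hAB, hlt⟩)
  set s : ℝ := (n / k : ℕ) + 1 with hs
  have hs0 : 0 < s := by positivity
  have hcard : ∀ A : {A // A ∈ P.parts}, (A.1.card : ℝ) ≤ s := by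
    intro A
    have h1 := hPe.card_part_le_average_add_one A.2
    rw [Finset.card_univ, Fintype.card_fin, ← hk] at h1
    rw [hs]
    exact_mod_cast h1
  have htot : (ordTri G : ℝ) ≤ s ^ 3 * (Bd * (k : ℝ) ^ 3 + (7 * γ + 12 * ε) * (k : ℝ) ^ 3 +
      3 * ((k + ε * (k : ℝ) ^ 2) * k)) := by
    exact ordTri_le_of_weights hε.le hγ.le (by linarith) hPU hs0.le hcard hw0 hw1 hw hT
  have hsk : s * k ≤ n * (1 + δ / 28) := by
    have h1 : (((n / k) * k : ℕ) : ℝ) ≤ n := by exact_mod_cast Nat.div_mul_le_self n k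
    have h2 : (k : ℝ) ≤ Mb := by exact_mod_cast hPM
    push_cast at h1
    rw [hs, add_mul, one_mul]
    linarith
  have hn0 : (0 : ℝ) < n := by exact_mod_cast (by omega : 0 < n)
  exact absurd (hG.trans htot) (not_le.2 (density_increment_arith hB0.1 hB0.2 hδ hδ1 hγδ hε
    hεδ hkl hkr hs0.le hsk hn0))

/-! ### Embedding cliques into regular systems. -/

section Embedding
variable {V : Type*} {G : SimpleGraph V}

open Classical in
-- Each of the other parts rules out at most `ε|A|` vertices of low degree, so most of `S A` is
-- typical for all parts simultaneously.
theorem card_sub_le_card_typical {K : Finset (Finset V)} {A : Finset V} {S : Finset V → Finset V}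
    {ε : ℝ} {N : ℕ} (hA : A ∈ K) (hN : K.card ≤ N) (hS : ∀ B ∈ K, S B ⊆ B)
    (hU : ∀ B ∈ K, B ≠ A → G.IsUniform ε A B) (hε : 0 ≤ ε)
    (hSc : ∀ B ∈ K, B.card * ε ≤ (S B).card) :
    ((S A).card : ℝ) - N * (A.card * ε) ≤ ((S A).filter fun x => ∀ B ∈ K.erase A,
      (G.edgeDensity A B - ε) * (S B).card ≤ (((S B).filter fun y => G.Adj x y).card : ℝ)).card := by
  set T := (S A).filter fun x => ∀ B ∈ K.erase A,
      (G.edgeDensity A B - ε) * (S B).card ≤ (((S B).filter fun y => G.Adj x y).card : ℝ) with hT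
  have h1 : S A ⊆ T ∪ (K.erase A).biUnion fun B => (S A).filter fun x =>
      (((S B).filter fun y => G.Adj x y).card : ℝ) < (G.edgeDensity A B - ε) * (S B).card := by
    intro x hx
    by_cases h : x ∈ T
    · exact Finset.mem_union_left _ h
    · refine Finset.mem_union_right _ ?_
      rw [hT, Finset.mem_filter, not_and] at h
      have h2 := h hx
      push Not at h2
      obtain ⟨B, hB, hlt⟩ := h2
      exact Finset.mem_biUnion.2 ⟨B, hB, Finset.mem_filter.2 ⟨hx, hlt⟩⟩
  have h2 := (Finset.card_le_card h1).trans (Finset.card_union_le _ _)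
  have h3 : (((K.erase A).biUnion fun B => (S A).filter fun x =>
      (((S B).filter fun y => G.Adj x y).card : ℝ) < (G.edgeDensity A B - ε) * (S B).card).card : ℝ)
      ≤ N * (A.card * ε) := by
    have h4 : (((K.erase A).biUnion fun B => (S A).filter fun x =>
        (((S B).filter fun y => G.Adj x y).card : ℝ) <
          (G.edgeDensity A B - ε) * (S B).card).card : ℝ) ≤ ∑ B ∈ K.erase A, (A.card * ε) := by
      refine (Nat.cast_le.2 Finset.card_biUnion_le).trans ?_
      push_cast
      refine Finset.sum_le_sum fun B hB => ?_
      obtain ⟨hBA, hB⟩ := Finset.mem_erase.1 hB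
      exact card_low_degree_le (hU B hB hBA) (hS A hA) (hS B hB) (hSc B hB)
    refine h4.trans ?_
    rw [Finset.sum_const, nsmul_eq_mul]
    have h5 : ((K.erase A).card : ℝ) ≤ N := by
      exact_mod_cast (Finset.card_erase_le).trans hN
    exact mul_le_mul_of_nonneg_right h5 (by positivity)
  have h4 : ((S A).card : ℝ) ≤ T.card + ((K.erase A).biUnion fun B => (S A).filter fun x =>
      (((S B).filter fun y => G.Adj x y).card : ℝ) < (G.edgeDensity A B - ε) * (S B).card).card := by
    exact_mod_cast h2
  linarith

open Classical in
/-- A system of regular dense pairs, in a graph with small independence number, spans a clique with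
one vertex in every set and a second vertex in every set of the subsystem `J` of pairs of density
above `1 / 2`. -/
theorem exists_clique_of_regular {ε γ : ℝ} {N : ℕ} (hε : 0 < ε) (hεγ : 2 * ε ≤ γ) (hγ : γ ≤ 1)
    (m : ℕ) : ∀ (K J : Finset (Finset V)) (S : Finset V → Finset V), K.card = m → m ≤ N → J ⊆ K →
    (∀ A ∈ K, S A ⊆ A) →
    (∀ A ∈ K, ((N : ℝ) + 1) * (A.card * ε) ≤ (γ / 2) ^ m * (S A).card) →
    (∀ A ∈ K, ∀ I : Finset V, G.IsIndepSet (I : Set V) → (I.card : ℝ) < A.card * ε) →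
    (∀ A ∈ K, ∀ B ∈ K, A ≠ B → G.IsUniform ε A B ∧ γ ≤ G.edgeDensity A B) →
    (∀ A ∈ J, ∀ B ∈ J, A ≠ B → 1 / 2 + γ ≤ G.edgeDensity A B) →
    ∃ Q : Finset V, G.IsNClique (K.card + J.card) Q ∧ ∀ x ∈ Q, ∃ A ∈ K, x ∈ S A := by
  induction m with
  | zero =>
    intro K J S hK _ hJ _ _ _ _ _
    obtain rfl := Finset.card_eq_zero.1 hK
    obtain rfl := Finset.subset_empty.1 hJ
    exact ⟨∅, by simp [SimpleGraph.isNClique_iff], by simp⟩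
  | succ m ih =>
    intro K J S hK hmN hJ hS hSc hα hU hD
    have hγ0 : 0 < γ := by linarith
    have hpow : (γ / 2) ^ (m + 1) ≤ 1 := pow_le_one₀ (by positivity) (by linarith)
    have hSc1 : ∀ A ∈ K, ((N : ℝ) + 1) * (A.card * ε) ≤ (S A).card := fun A hA =>
      (hSc A hA).trans (mul_le_of_le_one_left (by positivity) hpow)
    have hSc2 : ∀ A ∈ K, A.card * ε ≤ (S A).card := fun A hA => by
      refine le_trans ?_ (hSc1 A hA)
      exact le_mul_of_one_le_left (by positivity) (by linarith [(N.cast_nonneg : (0 : ℝ) ≤ N)])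
    have htyp : ∀ A ∈ K, (A.card : ℝ) * ε ≤ ((S A).filter fun x => ∀ B ∈ K.erase A,
        (G.edgeDensity A B - ε) * (S B).card ≤
          (((S B).filter fun y => G.Adj x y).card : ℝ)).card := by
      intro A hA
      have h1 := card_sub_le_card_typical (G := G) (ε := ε) (N := N) hA (hK.le.trans hmN) hS
        (fun B hB hBA => (hU A hA B hB hBA.symm).1) hε.le hSc2
      have h2 := hSc1 A hA
      linarith
    have hstep : ∀ A ∈ K, ∀ S' : Finset V → Finset V, (∀ B ∈ K.erase A, S' B ⊆ S B) →
        (∀ B ∈ K.erase A, γ / 2 * (S B).card ≤ (S' B).card) →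
        ∃ Q : Finset V, G.IsNClique ((K.erase A).card + (J.erase A).card) Q ∧
          ∀ x ∈ Q, ∃ B ∈ K.erase A, x ∈ S' B := by
      intro A hA S' hS' hc
      refine ih (K.erase A) (J.erase A) S' (by rw [Finset.card_erase_of_mem hA, hK]; rfl) (by omega)
        (Finset.erase_subset_erase _ hJ)
        (fun B hB => (hS' B hB).trans (hS B (Finset.mem_of_mem_erase hB))) (fun B hB => ?_)
        (fun B hB => hα B (Finset.mem_of_mem_erase hB))
        (fun B hB C hC => hU B (Finset.mem_of_mem_erase hB) C (Finset.mem_of_mem_erase hC))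
        (fun B hB C hC => hD B (Finset.mem_of_mem_erase hB) C (Finset.mem_of_mem_erase hC))
      refine (hSc B (Finset.mem_of_mem_erase hB)).trans ?_
      rw [pow_succ, mul_assoc]
      exact mul_le_mul_of_nonneg_left (hc B hB) (by positivity)
    -- The parts outside `J` are used up first, one vertex each. Two vertices of a part of `J` need
    -- common neighbours in every remaining part, which density above `1/2` guarantees only when all
    -- remaining parts lie in `J`.
    by_cases hJK : J = K
    · subst hJK
      obtain ⟨A, hA⟩ : J.Nonempty := Finset.card_pos.1 (by omega)
      have h1 := htyp A hA
      set T := (S A).filter fun x => ∀ B ∈ J.erase A,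
        (G.edgeDensity A B - ε) * (S B).card ≤ (((S B).filter fun y => G.Adj x y).card : ℝ) with hT
      have hTi : ¬G.IsIndepSet (T : Set V) := fun h => by linarith [hα A hA T h]
      obtain ⟨x, hx, y, hy, hxy⟩ : ∃ x ∈ T, ∃ y ∈ T, G.Adj x y := by
        by_contra! h
        exact hTi fun x hx y hy _ => h x hx y hy
      obtain ⟨hxA, hx⟩ := Finset.mem_filter.1 hx
      obtain ⟨hyA, hy⟩ := Finset.mem_filter.1 hy
      obtain ⟨Q, hQ, hQS⟩ := hstep A hA (fun B => ((S B).filter fun z => G.Adj x z) ∩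
        (S B).filter fun z => G.Adj y z) (fun B _ => Finset.inter_subset_left.trans
          (Finset.filter_subset _ _)) (by
        intro B hB
        have h2 := hx B hB
        have h3 := hy B hB
        obtain ⟨hBA, hB⟩ := Finset.mem_erase.1 hB
        have h4 := hD A hA B hB hBA.symm
        have h5 := Finset.card_union_add_card_inter ((S B).filter fun z => G.Adj x z)
          ((S B).filter fun z => G.Adj y z)
        have h6 : (((S B).filter fun z => G.Adj x z) ∪ (S B).filter fun z => G.Adj y z).card ≤
            (S B).card := Finset.card_le_card (Finset.union_subset (Finset.filter_subset _ _)
              (Finset.filter_subset _ _))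
        have h5' : (((((S B).filter fun z => G.Adj x z) ∪ (S B).filter fun z => G.Adj y z).card : ℕ)
          : ℝ) + (((S B).filter fun z => G.Adj x z) ∩ (S B).filter fun z => G.Adj y z).card =
          ((S B).filter fun z => G.Adj x z).card + ((S B).filter fun z => G.Adj y z).card := by
          exact_mod_cast h5
        have h6' : (((((S B).filter fun z => G.Adj x z) ∪ (S B).filter fun z => G.Adj y z).card : ℕ)
          : ℝ) ≤ (S B).card := by exact_mod_cast h6
        have h7 : (0 : ℝ) ≤ (S B).card := by positivity
        -- Two neighbourhoods of proportion at least `1/2 + γ - ε` overlap in proportion at least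
        -- `2γ - 2ε ≥ γ ≥ γ/2`.
        nlinarith)
      have hQx : ∀ z ∈ Q, G.Adj x z ∧ G.Adj y z := by
        intro z hz
        obtain ⟨B, -, hz⟩ := hQS z hz
        obtain ⟨h2, h3⟩ := Finset.mem_inter.1 hz
        exact ⟨(Finset.mem_filter.1 h2).2, (Finset.mem_filter.1 h3).2⟩
      refine ⟨insert x (insert y Q), ?_, ?_⟩
      · have h2 := (hQ.insert fun z hz => (hQx z hz).2).insert (a := x) (by
          intro z hz
          rcases Finset.mem_insert.1 hz with rfl | hz
          · exact hxy
          · exact (hQx z hz).1)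
        convert h2 using 1
        rw [Finset.card_erase_of_mem hA]
        omega
      · intro z hz
        rcases Finset.mem_insert.1 hz with rfl | hz
        · exact ⟨A, hA, hxA⟩
        rcases Finset.mem_insert.1 hz with rfl | hz
        · exact ⟨A, hA, hyA⟩
        obtain ⟨B, hB, hz⟩ := hQS z hz
        exact ⟨B, Finset.mem_of_mem_erase hB,
          (Finset.mem_filter.1 (Finset.mem_inter.1 hz).1).1⟩
    · obtain ⟨A, hA, hAJ⟩ : ∃ A ∈ K, A ∉ J := by
        by_contra! h
        exact hJK (Finset.Subset.antisymm hJ h)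
      have h1 := htyp A hA
      -- The empty set is independent, so the strict bound on independent sets already shows that
      -- `A` is nonempty.
      have h0 : (0 : ℝ) < A.card * ε := by
        simpa using hα A hA ∅ (by simp [SimpleGraph.isIndepSet_iff])
      obtain ⟨x, hx⟩ := Finset.card_pos.1 (by exact_mod_cast h0.trans_le h1)
      obtain ⟨hxA, hx⟩ := Finset.mem_filter.1 hx
      obtain ⟨Q, hQ, hQS⟩ := hstep A hA (fun B => (S B).filter fun z => G.Adj x z)
        (fun B _ => Finset.filter_subset _ _) (by
        intro B hB
        have h2 := hx B hB
        obtain ⟨hBA, hB⟩ := Finset.mem_erase.1 hB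
        have h4 := (hU A hA B hB hBA.symm).2
        have h7 : (0 : ℝ) ≤ (S B).card := by positivity
        refine le_trans (mul_le_mul_of_nonneg_right ?_ h7) h2
        linarith)
      rw [Finset.erase_eq_of_notMem hAJ] at hQ
      refine ⟨insert x Q, ?_, ?_⟩
      · have h2 := hQ.insert (a := x) (by
          intro z hz
          obtain ⟨B, -, hz⟩ := hQS z hz
          exact (Finset.mem_filter.1 hz).2)
        convert h2 using 1
        rw [Finset.card_erase_of_mem hA]
        omega
      · intro z hz
        rcases Finset.mem_insert.1 hz with rfl | hz
        · exact ⟨A, hA, hxA⟩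
        obtain ⟨B, hB, hz⟩ := hQS z hz
        exact ⟨B, Finset.mem_of_mem_erase hB, (Finset.mem_filter.1 hz).1⟩

open Classical in
/-- A system of `q` pairwise regular dense pairs spans many cliques of size `q`. -/
theorem card_cliques_of_regular [Fintype V] [DecidableEq V] {ε γ : ℝ} {N : ℕ} (hε : 0 < ε)
    (hεγ : 2 * ε ≤ γ) (hγ : γ ≤ 1) (q : ℕ) : ∀ A S : Fin q → Finset V, q ≤ N → (∀ i, S i ⊆ A i) →
    (∀ i, ((N : ℝ) + 1) * ((A i).card * ε) ≤ (γ / 2) ^ q * (S i).card) →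
    (∀ i j, i ≠ j → G.IsUniform ε (A i) (A j) ∧ γ ≤ G.edgeDensity (A i) (A j)) →
    ∏ i, ((A i).card * ε) ≤ ((Finset.univ.filter fun f : Fin q → V =>
      (∀ i, f i ∈ S i) ∧ ∀ i j, i ≠ j → G.Adj (f i) (f j)).card : ℝ) := by
  induction q with
  | zero =>
    intro A S _ _ _ _
    simp
  | succ q ih =>
    intro A S hqN hS hSc hU
    have hγ0 : 0 < γ := by linarith
    have hpow : (γ / 2) ^ (q + 1) ≤ 1 := pow_le_one₀ (by positivity) (by linarith)
    have hSc1 : ∀ i, ((N : ℝ) + 1) * ((A i).card * ε) ≤ (S i).card := fun i =>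
      (hSc i).trans (mul_le_of_le_one_left (by positivity) hpow)
    have hSc2 : ∀ i, (A i).card * ε ≤ (S i).card := fun i => by
      refine le_trans ?_ (hSc1 i)
      exact le_mul_of_one_le_left (by positivity) (by linarith [(N.cast_nonneg : (0 : ℝ) ≤ N)])
    set T := (S 0).filter fun x => ∀ i : Fin q, (G.edgeDensity (A 0) (A i.succ) - ε) *
      (S i.succ).card ≤ (((S i.succ).filter fun y => G.Adj x y).card : ℝ) with hT
    have hTc : (A 0).card * ε ≤ T.card := by
      have h1 : S 0 ⊆ T ∪ Finset.univ.biUnion fun i : Fin q => (S 0).filter fun x =>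
          (((S i.succ).filter fun y => G.Adj x y).card : ℝ) <
            (G.edgeDensity (A 0) (A i.succ) - ε) * (S i.succ).card := by
        intro x hx
        by_cases h : x ∈ T
        · exact Finset.mem_union_left _ h
        · refine Finset.mem_union_right _ ?_
          rw [hT, Finset.mem_filter, not_and] at h
          have h2 := h hx
          push Not at h2
          obtain ⟨i, hlt⟩ := h2
          exact Finset.mem_biUnion.2 ⟨i, Finset.mem_univ _, Finset.mem_filter.2 ⟨hx, hlt⟩⟩
      have h2 := (Finset.card_le_card h1).trans (Finset.card_union_le _ _)
      have h3 : ((Finset.univ.biUnion fun i : Fin q => (S 0).filter fun x =>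
          (((S i.succ).filter fun y => G.Adj x y).card : ℝ) <
            (G.edgeDensity (A 0) (A i.succ) - ε) * (S i.succ).card).card : ℝ) ≤
          ∑ i : Fin q, ((A 0).card * ε) := by
        refine (Nat.cast_le.2 Finset.card_biUnion_le).trans ?_
        push_cast
        refine Finset.sum_le_sum fun i _ => ?_
        exact card_low_degree_le (hU 0 i.succ (Fin.succ_ne_zero i).symm).1 (hS 0) (hS i.succ)
          (hSc2 _)
      rw [Finset.sum_const, Finset.card_univ, Fintype.card_fin, nsmul_eq_mul] at h3
      have h4 : ((S 0).card : ℝ) ≤ T.card + (Finset.univ.biUnion fun i : Fin q =>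
          (S 0).filter fun x => (((S i.succ).filter fun y => G.Adj x y).card : ℝ) <
            (G.edgeDensity (A 0) (A i.succ) - ε) * (S i.succ).card).card := by
        exact_mod_cast h2
      have h5 := hSc1 0
      have h6 : (q : ℝ) * ((A 0).card * ε) ≤ N * ((A 0).card * ε) := by
        gcongr
        omega
      linarith
    have hx : ∀ x ∈ T, ∏ i : Fin q, ((A i.succ).card * ε) ≤
        ((Finset.univ.filter fun f : Fin q → V => (∀ i, f i ∈ (S i.succ).filter fun y => G.Adj x y) ∧
          ∀ i j, i ≠ j → G.Adj (f i) (f j)).card : ℝ) := by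
      intro x hx
      obtain ⟨hxS, hx⟩ := Finset.mem_filter.1 hx
      refine ih (fun i => A i.succ) (fun i => (S i.succ).filter fun y => G.Adj x y) (by omega)
        (fun i => (Finset.filter_subset _ _).trans (hS i.succ)) (fun i => ?_)
        (fun i j hij => hU _ _ (fun h => hij (Fin.succ_injective _ h)))
      refine (hSc i.succ).trans ?_
      rw [pow_succ, mul_assoc]
      refine mul_le_mul_of_nonneg_left (le_trans ?_ (hx i)) (by positivity)
      refine mul_le_mul_of_nonneg_right ?_ (by positivity)
      linarith [(hU 0 i.succ (Fin.succ_ne_zero i).symm).2]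
    rw [Fin.prod_univ_succ]
    have hsum : ((Finset.univ.filter fun f : Fin (q + 1) → V =>
        (∀ i, f i ∈ S i) ∧ ∀ i j, i ≠ j → G.Adj (f i) (f j)).card : ℝ) ≥
        ∑ x ∈ T, ((Finset.univ.filter fun f : Fin q → V =>
          (∀ i, f i ∈ (S i.succ).filter fun y => G.Adj x y) ∧
          ∀ i j, i ≠ j → G.Adj (f i) (f j)).card : ℝ) := by
      rw [← Nat.cast_sum, ← Finset.card_sigma]
      refine Nat.cast_le.2 (Finset.card_le_card_of_injOn
        (fun p : (Σ _ : V, Fin q → V) => (Fin.cons p.1 p.2 : Fin (q + 1) → V)) ?_ ?_)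
      · rintro ⟨x, f⟩ h
        simp only [Finset.coe_sigma, Set.mem_sigma_iff, Finset.mem_coe, Finset.mem_filter,
          Finset.mem_univ, true_and] at h
        simp only [Finset.coe_filter, Finset.mem_univ, true_and, Set.mem_ofPred_eq]
        obtain ⟨h1, h2, h3⟩ := h
        refine ⟨fun i => ?_, fun i j hij => ?_⟩
        · refine Fin.cases ?_ (fun i => ?_) i
          · exact (Finset.mem_filter.1 h1).1
          · exact (h2 i).1
        · revert hij
          refine Fin.cases ?_ (fun i => ?_) i <;> refine Fin.cases ?_ (fun j => ?_) j <;> intro hij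
          · exact absurd rfl hij
          · exact (h2 j).2
          · exact (h2 i).2.symm
          · exact h3 i j (fun h => hij (by rw [h]))
      · rintro ⟨x, f⟩ _ ⟨y, g⟩ _ h
        obtain ⟨rfl, rfl⟩ := Fin.cons_inj.1 h
        rfl
    refine le_trans ?_ hsum
    refine le_trans ?_ (Finset.sum_le_sum hx)
    rw [Finset.sum_const, nsmul_eq_mul]
    exact mul_le_mul_of_nonneg_right hTc (Finset.prod_nonneg fun i _ => by positivity)

end Embedding

/-! ### Dependent random choice and boxes of edges. -/

section RandomChoice
variable {V : Type*} [Fintype V] {G : SimpleGraph V}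

open Classical in
-- The vertices of `S` without neighbours in `S` are independent, and each other vertex is the first
-- end of an ordered edge.
theorem card_le_indepNum_add_card_edges (S : Finset V) :
    S.card ≤ G.indepNum + ((S ×ˢ S).filter fun p => G.Adj p.1 p.2).card := by
  have h1 : S ⊆ (S.filter fun x => ∀ y ∈ S, ¬G.Adj x y) ∪
      ((S ×ˢ S).filter fun p => G.Adj p.1 p.2).image Prod.fst := by
    intro x hx
    by_cases h : ∀ y ∈ S, ¬G.Adj x y
    · exact Finset.mem_union_left _ (Finset.mem_filter.2 ⟨hx, h⟩)
    · push Not at h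
      obtain ⟨y, hy, hxy⟩ := h
      exact Finset.mem_union_right _ (Finset.mem_image.2 ⟨(x, y),
        Finset.mem_filter.2 ⟨Finset.mk_mem_product hx hy, hxy⟩, rfl⟩)
  refine (Finset.card_le_card h1).trans ((Finset.card_union_le _ _).trans
    (Nat.add_le_add ?_ Finset.card_image_le))
  refine SimpleGraph.IsIndepSet.card_le_indepNum fun x hx y hy _ => ?_
  exact (Finset.mem_filter.1 hx).2 y (Finset.mem_filter.1 hy).1

open Classical in
/-- Dependent random choice: some edge has many common neighbours in a dense bipartite relation. -/
theorem exists_edge_common {Y : Type*} [Fintype Y] [Nonempty Y] [Nonempty V] (R : V → Y → Prop)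
    {d β : ℝ} {t : ℕ} (ht : 0 < t) (hd : 0 ≤ d) (hβ : 0 ≤ β)
    (hR : d * (Fintype.card V * Fintype.card Y) ≤ ∑ x, ((Finset.univ.filter (R x)).card : ℝ))
    (h : (G.indepNum : ℝ) + (Fintype.card V : ℝ) ^ 2 * β ^ t < Fintype.card V * d ^ t) :
    ∃ x y, G.Adj x y ∧
      β * Fintype.card Y ≤ ((Finset.univ.filter fun z => R x z ∧ R y z).card : ℝ) := by
  by_contra! hno
  set n : ℝ := (Fintype.card V : ℝ)
  set m : ℝ := (Fintype.card Y : ℝ)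
  have hn : 0 < n := by simp only [n]; exact_mod_cast Fintype.card_pos
  have hm : 0 < m := by simp only [m]; exact_mod_cast Fintype.card_pos
  have hpow : ∀ P : Y → Prop, (Finset.univ.filter fun τ : Fin t → Y => ∀ i, P (τ i)).card =
      (Finset.univ.filter P).card ^ t := by
    intro P
    have : (Finset.univ.filter fun τ : Fin t → Y => ∀ i, P (τ i)) =
        Fintype.piFinset fun _ : Fin t => Finset.univ.filter P := by
      ext τ
      simp [Fintype.mem_piFinset]
    rw [this, Fintype.card_piFinset]
    simp
  -- `S τ` is the common neighbourhood of a `t`-tuple. By the power mean inequality its average size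
  -- is at least `n d^t`; if every edge had few common neighbours, it would span fewer than `n² β^t`
  -- ordered edges on average or at most that many, so its size would be at most `α + n² β^t` on
  -- average.
  set S : (Fin t → Y) → Finset V := fun τ => Finset.univ.filter fun x => ∀ i, R x (τ i) with hS
  have h1 : ∑ τ, (S τ).card = ∑ x, (Finset.univ.filter (R x)).card ^ t := by
    simp only [hS, Finset.card_filter]
    rw [Finset.sum_comm]
    refine Finset.sum_congr rfl fun x _ => ?_
    rw [← Finset.card_filter, ← Finset.card_filter, hpow]
  have h2 : ∑ τ, ((S τ ×ˢ S τ).filter fun p => G.Adj p.1 p.2).card =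
      ∑ p : V × V, if G.Adj p.1 p.2 then
        (Finset.univ.filter fun z => R p.1 z ∧ R p.2 z).card ^ t else 0 := by
    have : ∀ τ, ((S τ ×ˢ S τ).filter fun p => G.Adj p.1 p.2).card =
        ∑ p : V × V, if (∀ i, R p.1 (τ i) ∧ R p.2 (τ i)) ∧ G.Adj p.1 p.2 then 1 else 0 := by
      intro τ
      rw [← Finset.card_filter]
      congr 1
      ext p
      simp [hS, forall_and]
    simp only [this]
    rw [Finset.sum_comm]
    refine Finset.sum_congr rfl fun p _ => ?_
    by_cases hp : G.Adj p.1 p.2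
    · simp only [hp, and_true, if_true]
      rw [← Finset.card_filter]
      convert hpow fun z => R p.1 z ∧ R p.2 z
    · simp [hp]
  have h3 : ∑ τ, ((S τ).card : ℝ) ≤ ∑ τ : Fin t → Y, ((G.indepNum : ℝ) +
      ((S τ ×ˢ S τ).filter fun p => G.Adj p.1 p.2).card) :=
    Finset.sum_le_sum fun τ _ => by exact_mod_cast card_le_indepNum_add_card_edges (S τ)
  have h4 : n * (d * m) ^ t ≤ ∑ τ, ((S τ).card : ℝ) := by
    have e : ∑ τ, ((S τ).card : ℝ) = ∑ x, ((Finset.univ.filter (R x)).card : ℝ) ^ t := by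
      exact_mod_cast h1
    rw [e]
    obtain ⟨t, rfl⟩ := Nat.exists_eq_succ_of_ne_zero ht.ne'
    have := pow_sum_div_card_le_sum_pow (s := Finset.univ)
      (f := fun x : V => ((Finset.univ.filter (R x)).card : ℝ)) (fun _ _ => by positivity) t
    refine le_trans ?_ this
    rw [Finset.card_univ, le_div_iff₀ (by positivity)]
    calc n * (d * m) ^ (t + 1) * n ^ t = (d * (n * m)) ^ (t + 1) := by ring
      _ ≤ _ := by gcongr
  have h5 : (∑ τ, (((S τ ×ˢ S τ).filter fun p => G.Adj p.1 p.2).card : ℝ)) ≤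
      n ^ 2 * (β * m) ^ t := by
    rw [← Nat.cast_sum, h2]
    push_cast
    have : ∀ p : V × V, (if G.Adj p.1 p.2 then
        ((Finset.univ.filter fun z => R p.1 z ∧ R p.2 z).card : ℝ) ^ t else 0) ≤ (β * m) ^ t := by
      intro p
      split_ifs with hp
      · exact pow_le_pow_left₀ (by positivity) (hno _ _ hp).le _
      · positivity
    refine (Finset.sum_le_sum fun p _ => this p).trans (le_of_eq ?_)
    rw [Finset.sum_const, Finset.card_univ, Fintype.card_prod, nsmul_eq_mul]
    push_cast
    ring
  rw [Finset.sum_add_distrib, Finset.sum_const, Finset.card_univ, nsmul_eq_mul] at h3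
  have h6 : ((Fintype.card (Fin t → Y) : ℕ) : ℝ) = m ^ t := by
    rw [Fintype.card_fun, Fintype.card_fin]
    push_cast
    rfl
  rw [h6] at h3
  have h7 : n * (d * m) ^ t ≤ m ^ t * G.indepNum + n ^ 2 * (β * m) ^ t := by linarith
  have h8 : m ^ t * (n * d ^ t) ≤ m ^ t * (G.indepNum + n ^ 2 * β ^ t) := by
    rw [mul_pow, mul_pow] at h7
    linarith
  exact absurd (le_of_mul_le_mul_left h8 (by positivity)) (not_le.2 h)

open Classical in
/-- A dense set of `j`-tuples contains a box whose sides are edges. -/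
theorem exists_edge_box [Nonempty V] {q : ℕ} {a L : ℝ} (ha : 2 ≤ a) (hL : 1 ≤ L)
    (hn : (Fintype.card V : ℝ) = Real.exp L)
    (hα : (G.indepNum : ℝ) + 1 <
      Fintype.card V * Real.exp (-(2 * a * L ^ (((q : ℝ) - 1) / q)))) (j : ℕ) :
    ∀ A : Finset (Fin j → V), j ≤ q →
      Real.exp (-(a * L ^ (((q : ℝ) - j) / q))) * (Fintype.card V : ℝ) ^ j ≤ A.card →
      ∃ x y : Fin j → V, (∀ i, G.Adj (x i) (y i)) ∧
        ∀ z : Fin j → V, (∀ i, z i = x i ∨ z i = y i) → z ∈ A := by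
  induction j with
  | zero =>
    intro A _ hA
    have h0 : (0 : ℝ) < A.card := lt_of_lt_of_le (by positivity) hA
    obtain ⟨f, hf⟩ := Finset.card_pos.1 (by exact_mod_cast h0)
    exact ⟨f, f, fun i => i.elim0, fun z _ => by rwa [Subsingleton.elim z f]⟩
  | succ j ih =>
    intro A hj hA
    have hq : (0 : ℝ) < q := by exact_mod_cast (by omega : 0 < q)
    have hL0 : 0 < L := by linarith
    set X : ℝ := L ^ ((j : ℝ) / q) with hX
    have hX1 : 1 ≤ X := Real.one_le_rpow hL (by positivity)
    -- With `t ≈ L^{j/q}` and `β = exp(-2L/t)` one has `n² β^t = 1`, and `d^t ≥ exp(-2a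
    -- L^{(q-1)/q})` whatever `j` is. So one bound on the independence number serves all stages, and
    -- `β` is at least the density required at level `j`.
    set t := ⌈X⌉₊ with ht
    have ht0 : 0 < t := Nat.ceil_pos.2 (by linarith)
    have ht0' : (0 : ℝ) < t := by exact_mod_cast ht0
    have htX : X ≤ t := Nat.le_ceil _
    have ht2 : (t : ℝ) ≤ 2 * X := by linarith [Nat.ceil_lt_add_one (by linarith : 0 ≤ X)]
    have hcons : ∑ x, ((Finset.univ.filter fun z : Fin j → V =>
        (Fin.cons x z : Fin (j + 1) → V) ∈ A).card : ℝ) = A.card := by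
      rw [← Nat.cast_sum, ← Finset.card_sigma]
      norm_cast
      refine Finset.card_bij (fun p _ => (Fin.cons p.1 p.2 : Fin (j + 1) → V)) ?_ ?_ ?_
      · rintro ⟨x, z⟩ h
        exact (Finset.mem_filter.1 (Finset.mem_sigma.1 h).2).2
      · rintro ⟨x, f⟩ _ ⟨y, g⟩ _ h
        obtain ⟨rfl, rfl⟩ := Fin.cons_inj.1 h
        rfl
      · intro f hf
        refine ⟨⟨f 0, Fin.tail f⟩, ?_, Fin.cons_self_tail f⟩
        simp only [Finset.mem_sigma, Finset.mem_univ, true_and, Finset.mem_filter]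
        rwa [Fin.cons_self_tail]
    have hcard : (Fintype.card (Fin j → V) : ℝ) = (Fintype.card V : ℝ) ^ j := by
      rw [Fintype.card_fun, Fintype.card_fin]
      push_cast
      rfl
    obtain ⟨x, y, hxy, hc⟩ := exists_edge_common (G := G)
      (fun (x : V) (z : Fin j → V) => (Fin.cons x z : Fin (j + 1) → V) ∈ A)
      (d := Real.exp (-(a * L ^ (((q : ℝ) - (j + 1 : ℕ)) / q)))) (β := Real.exp (-(2 * L / t)))
      ht0 (by positivity) (by positivity) (by
        rw [hcard]
        refine le_trans (le_of_eq ?_) (hA.trans (le_of_eq (hcons.symm.trans ?_)))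
        · ring
        · congr!) (by
        have e1 : (Fintype.card V : ℝ) ^ 2 * Real.exp (-(2 * L / t)) ^ t = 1 := by
          rw [hn, ← Real.exp_nat_mul, ← Real.exp_nat_mul, ← Real.exp_add, ← Real.exp_zero]
          congr 1
          field_simp
          push_cast
          ring
        rw [e1]
        refine hα.trans_le (mul_le_mul_of_nonneg_left ?_ (by positivity))
        rw [← Real.exp_nat_mul, Real.exp_le_exp]
        have e2 : L ^ (((q : ℝ) - 1) / q) = X * L ^ (((q : ℝ) - (j + 1 : ℕ)) / q) := by
          rw [hX, ← Real.rpow_add hL0]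
          congr 1
          push_cast
          field_simp
          ring
        rw [e2]
        have h3 : 0 ≤ a * L ^ (((q : ℝ) - (j + 1 : ℕ)) / q) := by positivity
        nlinarith [mul_le_mul_of_nonneg_right ht2 h3])
    obtain ⟨x', y', hadj, hbox⟩ := ih (Finset.univ.filter fun z : Fin j → V =>
      (Fin.cons x z : Fin (j + 1) → V) ∈ A ∧ (Fin.cons y z : Fin (j + 1) → V) ∈ A) (by omega) (by
        rw [hcard] at hc
        refine le_trans (mul_le_mul_of_nonneg_right ?_ (by positivity))
          (hc.trans (le_of_eq (by congr!)))
        rw [Real.exp_le_exp, neg_le_neg_iff, div_le_iff₀ ht0']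
        have e2 : L = X * L ^ (((q : ℝ) - j) / q) := by
          rw [hX, ← Real.rpow_add hL0]
          have : (j : ℝ) / q + (q - j) / q = 1 := by field_simp; ring
          rw [this, Real.rpow_one]
        have h3 : 0 ≤ L ^ (((q : ℝ) - j) / q) := by positivity
        calc 2 * L = 2 * (X * L ^ (((q : ℝ) - j) / q)) := by rw [← e2]
          _ ≤ a * (t * L ^ (((q : ℝ) - j) / q)) := by gcongr
          _ = _ := by ring)
    refine ⟨Fin.cons x x', Fin.cons y y', fun i => ?_, fun z hz => ?_⟩
    · refine Fin.cases ?_ (fun i => ?_) i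
      · exact hxy
      · exact hadj i
    · have h1 := (Finset.mem_filter.1 (hbox (Fin.tail z) fun i => by
        have h := hz i.succ
        rwa [Fin.cons_succ, Fin.cons_succ] at h)).2
      have h2 : z 0 = x ∨ z 0 = y := by simpa using hz 0
      rw [← Fin.cons_self_tail z]
      rcases h2 with h | h <;> rw [h]
      exacts [h1.1, h1.2]

end RandomChoice

/-- Two of the `2q` endpoints either form one of the given edges or belong to different coordinates,
and then lie in a common transversal. -/
theorem not_cliqueFree_of_edge_box {V : Type*} {G : SimpleGraph V} {q : ℕ} {x y : Fin q → V}
    (hxy : ∀ i, G.Adj (x i) (y i))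
    (hbox : ∀ z : Fin q → V, (∀ i, z i = x i ∨ z i = y i) → ∀ i j, i ≠ j → G.Adj (z i) (z j)) :
    ¬G.CliqueFree (2 * q) := by
  set f : Fin q × Bool → V := fun p => if p.2 then x p.1 else y p.1 with hf
  have hadj : ∀ p p' : Fin q × Bool, p ≠ p' → G.Adj (f p) (f p') := by
    rintro ⟨i, b⟩ ⟨j, b'⟩ h
    by_cases hij : i = j
    · subst hij
      have hb : b ≠ b' := fun hb => h (by rw [hb])
      cases b <;> cases b' <;> simp_all [SimpleGraph.adj_comm]
    · have h1 := hbox (fun k => if k = i then f (i, b) else f (k, b')) (fun k => by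
        by_cases hk : k = i
        · subst hk
          cases b <;> simp [hf]
        · cases b' <;> simp [hf, hk]) i j hij
      simpa [Ne.symm hij] using h1
  have hinj : Function.Injective f := fun p p' h => by
    by_contra hne
    exact (hadj p p' hne).ne h
  intro hfree
  classical
  refine hfree (Finset.univ.image f) ⟨?_, ?_⟩
  · intro u hu v hv huv
    obtain ⟨p, -, rfl⟩ := Finset.mem_image.1 hu
    obtain ⟨p', -, rfl⟩ := Finset.mem_image.1 hv
    exact hadj p p' fun h => huv (by rw [h])
  · rw [Finset.card_image_of_injective _ hinj, Finset.card_univ, Fintype.card_prod,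
      Fintype.card_fin, Fintype.card_bool, mul_comm]

open Classical in
-- The edge-box lemma is applied to the set of ordered `q`-cliques, where the density needed at the
-- top level is the constant `exp(-a) ≤ d`.
theorem not_cliqueFree_of_many_cliques {q : ℕ} (hq : 2 ≤ q) {d : ℝ} (hd : 0 < d) :
    ∃ C : ℝ, 0 < C ∧ ∃ N₀ : ℕ, ∀ n ≥ N₀, ∀ G : SimpleGraph (Fin n),
      d * (n : ℝ) ^ q ≤ ((Finset.univ.filter fun f : Fin q → Fin n =>
        ∀ i j, i ≠ j → G.Adj (f i) (f j)).card : ℝ) →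
      (G.indepNum : ℝ) ≤ n * Real.exp (-(C * Real.log n ^ (1 - 1 / (q : ℝ)))) →
      ¬G.CliqueFree (2 * q) := by
  have hq0 : (0 : ℝ) < q := by exact_mod_cast (by omega : 0 < q)
  set a : ℝ := max 2 (-Real.log d) with ha
  have ha2 : 2 ≤ a := le_max_left _ _
  have had : Real.exp (-a) ≤ d := by
    rw [← Real.le_log_iff_exp_le hd]
    linarith [le_max_right 2 (-Real.log d)]
  have hlarge : ∀ᶠ n : ℕ in atTop, (2 * a + 1) ^ q ≤ Real.log n :=
    (Real.tendsto_log_atTop.comp tendsto_natCast_atTop_atTop).eventually_ge_atTop _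
  obtain ⟨N₀, hN₀⟩ := eventually_atTop.1 hlarge
  -- The box lemma needs `2a`; the additional `a` absorbs the `+ 1` in its hypothesis and makes the
  -- inequality strict.
  refine ⟨3 * a, by linarith, max N₀ 1, fun n hn G hG hα => ?_⟩
  have hL := hN₀ n ((le_max_left _ _).trans hn)
  have hn1 : 1 ≤ n := (le_max_right _ _).trans hn
  have hn0 : (0 : ℝ) < n := by exact_mod_cast hn1
  set L := Real.log n with hLdef
  have hL1 : 1 ≤ L := (one_le_pow₀ (by linarith)).trans hL
  have hnL : (n : ℝ) = Real.exp L := (Real.exp_log hn0).symm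
  have : Nonempty (Fin n) := ⟨⟨0, hn1⟩⟩
  have hexp : 1 - 1 / (q : ℝ) = ((q : ℝ) - 1) / q := by field_simp
  rw [hexp] at hα
  set X := L ^ (((q : ℝ) - 1) / q) with hX
  have hX1 : 1 ≤ X := Real.one_le_rpow hL1 (div_nonneg (by
    have : (2 : ℝ) ≤ q := by exact_mod_cast hq
    linarith) hq0.le)
  have hLX : (2 * a + 1) * X ≤ L := by
    have h1 : 2 * a + 1 ≤ L ^ (1 / (q : ℝ)) := by
      have := Real.rpow_le_rpow (by positivity) hL (by positivity : 0 ≤ (q : ℝ)⁻¹)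
      rwa [Real.pow_rpow_inv_natCast (by positivity) (by omega), ← one_div] at this
    have h2 : L = L ^ (1 / (q : ℝ)) * X := by
      rw [hX, ← Real.rpow_add (by linarith)]
      have : 1 / (q : ℝ) + (q - 1) / q = 1 := by field_simp; ring
      rw [this, Real.rpow_one]
    calc (2 * a + 1) * X ≤ L ^ (1 / (q : ℝ)) * X := by gcongr
      _ = L := h2.symm
  obtain ⟨x, y, hxy, hbox⟩ := exists_edge_box (G := G) (q := q) ha2 hL1
    (by rw [Fintype.card_fin]; exact hnL) (by
      rw [Fintype.card_fin]
      have h1 : (n : ℝ) * Real.exp (-(2 * a * X)) = Real.exp (L - 2 * a * X) := by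
        rw [hnL, ← Real.exp_add]
        rfl
      have h2 : (n : ℝ) * Real.exp (-(3 * a * X)) = Real.exp (L - 2 * a * X) * Real.exp (-(a * X))
          := by
        rw [hnL, ← Real.exp_add, ← Real.exp_add]
        congr 1
        ring
      have h3 : Real.exp (-(a * X)) ≤ Real.exp (-1) := Real.exp_le_exp.2 (by nlinarith)
      have h4 : Real.exp (-1) < 1 / 2 := by
        have := Real.exp_neg_one_lt_d9
        linarith
      have h5 : Real.exp 1 ≤ Real.exp (L - 2 * a * X) := Real.exp_le_exp.2 (by linarith)
      have h6 : 2 < Real.exp 1 := by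
        have := Real.exp_one_gt_d9
        linarith
      rw [h1]
      rw [h2] at hα
      nlinarith [Real.exp_pos (L - 2 * a * X)]) q
    (Finset.univ.filter fun f : Fin q → Fin n => ∀ i j, i ≠ j → G.Adj (f i) (f j)) le_rfl (by
      rw [sub_self, zero_div, Real.rpow_zero, mul_one, Fintype.card_fin]
      exact le_trans (mul_le_mul_of_nonneg_right had (by positivity)) hG)
  exact not_cliqueFree_of_edge_box hxy fun z hz => (Finset.mem_filter.1 (hbox z hz)).2

/-! ### Upper bounds for odd cliques, even cliques and `K_6`. -/

/-- The limiting number of ordered triangles, per `n ^ 3`, in the balanced complete `ℓ`-partite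
graph. -/
noncomputable def turanDensity (ℓ : ℕ) : ℝ := (1 - 1 / (ℓ : ℝ)) * (1 - 2 / (ℓ : ℝ))

theorem turanDensity_pos {ℓ : ℕ} (hℓ : 3 ≤ ℓ) : 0 < turanDensity ℓ := by
  have h : (3 : ℝ) ≤ ℓ := by exact_mod_cast hℓ
  refine mul_pos (sub_pos.2 ?_) (sub_pos.2 ?_) <;> rw [div_lt_one (by linarith)] <;> linarith

section UpperBounds

theorem ordTri_lt_of_cliqueFree_odd {ℓ : ℕ} (hℓ : 3 ≤ ℓ) {δ : ℝ} (hδ : 0 < δ) (hδ1 : δ ≤ 1) :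
    ∃ η : ℝ, 0 < η ∧ ∃ N₀ : ℕ, ∀ n ≥ N₀, ∀ G : SimpleGraph (Fin n), G.CliqueFree (2 * ℓ + 1) →
      (G.indepNum : ℝ) ≤ η * n → (ordTri G : ℝ) < (turanDensity ℓ + δ) * (n : ℝ) ^ 3 := by
  classical
  set γ : ℝ := δ / 100 with hγ
  have hγ0 : 0 < γ := by positivity
  set N : ℕ := 2 * ℓ + 1 with hN
  set ε : ℝ := (γ / 2) ^ N / (N + 1) with hε
  have hε0 : 0 < ε := by positivity
  have hN1 : (1 : ℝ) ≤ N := by exact_mod_cast (by omega : 1 ≤ N)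
  have hpow : (γ / 2) ^ N ≤ γ / 2 := pow_le_of_le_one (by positivity) (by linarith) (by omega)
  have hεN : ((N : ℝ) + 1) * ε = (γ / 2) ^ N := by rw [hε]; field_simp
  have hεγ : 2 * ε ≤ γ := by nlinarith
  obtain ⟨M, N₀, hM, h⟩ := exists_regular_clique hℓ hδ hδ1 hγ0 (by linarith) hε0
    (by linarith : 100 * ε ≤ δ)
  have hMr : (0 : ℝ) < M := by exact_mod_cast hM
  -- Each part has at least `n / M` vertices, so independent sets have size at most `ε|A|/2`,
  -- strictly below `ε|A|`.
  refine ⟨ε / (2 * M), by positivity, max N₀ 1, fun n hn G hG hα => ?_⟩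
  by_contra! hlt
  have hn0 : (0 : ℝ) < n := by exact_mod_cast (le_max_right _ _).trans hn
  obtain ⟨K, J, hJ, hKJ, hKM, hU, hD⟩ := h n ((le_max_left _ _).trans hn) G hlt
  obtain ⟨Q, hQ, -⟩ := exists_clique_of_regular (N := N) hε0 hεγ (by linarith) K.card K J id rfl
    (by omega) hJ (fun _ _ => subset_rfl) (fun A hA => by
      have h1 : (γ / 2) ^ N ≤ (γ / 2) ^ K.card :=
        pow_le_pow_of_le_one (by positivity) (by linarith) (by omega)
      calc ((N : ℝ) + 1) * (A.card * ε) = (γ / 2) ^ N * A.card := by rw [← hεN]; ring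
        _ ≤ _ := mul_le_mul_of_nonneg_right h1 (by positivity)) (fun A hA I hI => by
      have h1 : (I.card : ℝ) ≤ G.indepNum := by exact_mod_cast hI.card_le_indepNum
      have h2 : (n : ℝ) ≤ M * A.card := by exact_mod_cast hKM A hA
      refine (h1.trans hα).trans_lt ?_
      rw [div_mul_eq_mul_div, div_lt_iff₀ (by positivity)]
      have h3 : (0 : ℝ) < M * A.card := hn0.trans_le h2
      nlinarith [mul_le_mul_of_nonneg_left h2 hε0.le, mul_pos hε0 h3]) hU hD
  rw [hKJ] at hQ
  exact hG Q hQ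

/-- Only `|K| ≥ ℓ+1` is used from the regular system: it spans a positive proportion of all
`(ℓ+1)`-tuples as cliques, and many copies of `K_{ℓ+1}` force `K_{2ℓ+2}`. -/
theorem ordTri_lt_of_cliqueFree_even {ℓ : ℕ} (hℓ : 3 ≤ ℓ) {δ : ℝ} (hδ : 0 < δ) (hδ1 : δ ≤ 1) :
    ∃ C : ℝ, 0 < C ∧ ∃ N₀ : ℕ, ∀ n ≥ N₀, ∀ G : SimpleGraph (Fin n), G.CliqueFree (2 * ℓ + 2) →
      (G.indepNum : ℝ) ≤ n * Real.exp (-(C * Real.log n ^ (1 - 1 / ((ℓ + 1 : ℕ) : ℝ)))) →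
      (ordTri G : ℝ) < (turanDensity ℓ + δ) * (n : ℝ) ^ 3 := by
  classical
  set γ : ℝ := δ / 100 with hγ
  have hγ0 : 0 < γ := by positivity
  set N : ℕ := ℓ + 1 with hN
  set ε : ℝ := (γ / 2) ^ N / (N + 1) with hε
  have hε0 : 0 < ε := by positivity
  have hN1 : (1 : ℝ) ≤ N := by exact_mod_cast (by omega : 1 ≤ N)
  have hpow : (γ / 2) ^ N ≤ γ / 2 := pow_le_of_le_one (by positivity) (by linarith) (by omega)
  have hεN : ((N : ℝ) + 1) * ε = (γ / 2) ^ N := by rw [hε]; field_simp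
  have hεγ : 2 * ε ≤ γ := by nlinarith
  obtain ⟨M, N₀, hM, h⟩ := exists_regular_clique hℓ hδ hδ1 hγ0 (by linarith) hε0
    (by linarith : 100 * ε ≤ δ)
  have hMr : (0 : ℝ) < M := by exact_mod_cast hM
  obtain ⟨C, hC, N₁, hcl⟩ := not_cliqueFree_of_many_cliques (q := N) (by omega)
    (by positivity : (0 : ℝ) < (ε / M) ^ N)
  refine ⟨C, hC, max N₀ N₁, fun n hn G hG hα => ?_⟩
  by_contra! hlt
  obtain ⟨K, J, hJ, hKJ, hKM, hU, -⟩ := h n ((le_max_left _ _).trans hn) G hlt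
  have hKN : N ≤ K.card := by
    have := Finset.card_le_card hJ
    omega
  obtain ⟨e⟩ := Function.Embedding.nonempty_of_card_le (α := Fin N) (β := K)
    (by rwa [Fintype.card_fin, Fintype.card_coe])
  have h1 := card_cliques_of_regular (G := G) (N := N) hε0 hεγ (by linarith) N
    (fun i => (e i).1) (fun i => (e i).1) le_rfl (fun _ => subset_rfl)
    (fun i => le_of_eq (by rw [← hεN]; ring)) (fun i j hij => hU _ (e i).2 _ (e j).2
      fun h => hij (e.injective (Subtype.ext h)))
  refine hcl n ((le_max_right _ _).trans hn) G ?_ hα (by rwa [hN, mul_add, mul_one])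
  calc (ε / M) ^ N * (n : ℝ) ^ N = ∏ _i : Fin N, (n / M * ε : ℝ) := by
        rw [Finset.prod_const, Finset.card_univ, Fintype.card_fin, ← mul_pow]
        ring
    _ ≤ ∏ i : Fin N, (((e i).1.card : ℝ) * ε) := by
        refine Finset.prod_le_prod (fun _ _ => by positivity) fun i _ => ?_
        refine mul_le_mul_of_nonneg_right ?_ hε0.le
        rw [div_le_iff₀ hMr, mul_comm]
        exact_mod_cast hKM _ (e i).2
    _ ≤ _ := h1
    _ ≤ _ := by
        refine Nat.cast_le.2 (Finset.card_le_card fun f hf => ?_)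
        exact Finset.mem_filter.2 ⟨Finset.mem_univ _, (Finset.mem_filter.1 hf).2.2⟩

/-- The ordered triangles are themselves the dense family of cliques, with `q = 3`, so regularity is
not needed. -/
theorem ordTri_lt_of_cliqueFree_six {δ : ℝ} (hδ : 0 < δ) :
    ∃ C : ℝ, 0 < C ∧ ∃ N₀ : ℕ, ∀ n ≥ N₀, ∀ G : SimpleGraph (Fin n), G.CliqueFree 6 →
      (G.indepNum : ℝ) ≤ n * Real.exp (-(C * Real.log n ^ (1 - 1 / ((3 : ℕ) : ℝ)))) →
      (ordTri G : ℝ) < (0 + δ) * (n : ℝ) ^ 3 := by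
  classical
  obtain ⟨C, hC, N₀, h⟩ := not_cliqueFree_of_many_cliques (q := 3) (by norm_num) hδ
  refine ⟨C, hC, N₀, fun n hn G hG hα => ?_⟩
  by_contra! hlt
  rw [zero_add] at hlt
  refine h n hn G (hlt.trans ?_) hα hG
  unfold ordTri
  refine Nat.cast_le.2 (Finset.card_le_card_of_injOn (fun p => ![p.1, p.2.1, p.2.2]) ?_ ?_)
  · rintro ⟨a, b, c⟩ hp
    simp only [Finset.coe_filter, Finset.mem_univ, true_and, Set.mem_ofPred_eq] at hp ⊢
    obtain ⟨hab, hbc, hac⟩ := hp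
    intro i j hij
    fin_cases i <;> fin_cases j <;> simp_all [SimpleGraph.adj_comm]
  · rintro ⟨a, b, c⟩ _ ⟨a', b', c'⟩ _ hp
    have h0 := congrFun hp 0
    have h1 := congrFun hp 1
    have h2 := congrFun hp 2
    simp only [Matrix.cons_val] at h0 h1 h2
    rw [h0, h1, h2]

end UpperBounds

/-! ### Comparison of the phase function with the thresholds. -/

section Phase
variable {ω : ℕ → ℝ}

/-- As `ω` is unbounded, `ω(n) log 2` eventually exceeds any constant `C`. -/
theorem eventually_phaseFun_le (hω : Tendsto ω atTop atTop) (q : ℕ) (C : ℝ) :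
    ∀ᶠ n : ℕ in atTop,
      phaseFun ω q n ≤ n * Real.exp (-(C * Real.log n ^ (1 - 1 / (q : ℝ)))) := by
  have hlog : 0 < Real.log 2 := Real.log_pos (by norm_num)
  filter_upwards [hω.eventually_ge_atTop (C / Real.log 2)] with n hn
  refine mul_le_mul_of_nonneg_left ?_ (by positivity)
  rw [Real.rpow_def_of_pos (by norm_num), Real.exp_le_exp, mul_neg, neg_le_neg_iff, ← mul_assoc]
  rw [div_le_iff₀ hlog, mul_comm] at hn
  exact mul_le_mul_of_nonneg_right hn (Real.rpow_nonneg (Real.log_natCast_nonneg n) _)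

theorem eventually_ramseyTuran_phaseFun_le (hω : Tendsto ω atTop atTop) {q t : ℕ} {B δ : ℝ}
    (hB : 0 ≤ B) (hδ : 0 < δ)
    (h : ∃ C : ℝ, 0 < C ∧ ∃ N₀ : ℕ, ∀ n ≥ N₀, ∀ G : SimpleGraph (Fin n), G.CliqueFree t →
      (G.indepNum : ℝ) ≤ n * Real.exp (-(C * Real.log n ^ (1 - 1 / (q : ℝ)))) →
      (ordTri G : ℝ) < (B + δ) * (n : ℝ) ^ 3) :
    ∀ᶠ n : ℕ in atTop,
      (ramseyTuran 3 t n (phaseFun ω q n) : ℝ) ≤ (B / 6 + δ) * (n : ℝ) ^ 3 := by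
  obtain ⟨C, -, N₀, h⟩ := h
  filter_upwards [eventually_phaseFun_le hω q C, eventually_ge_atTop N₀] with n hn hn₀
  refine ramseyTuran_le (by positivity) fun G hG hα => ?_
  refine (h n hn₀ G hG (hα.trans hn)).le.trans ?_
  rw [← mul_assoc]
  exact mul_le_mul_of_nonneg_right (by linarith) (by positivity)

theorem eventually_rpow_add_le {s s' : ℝ} (hs : 0 < s) (hs' : s < s') {ε : ℝ} (hε : 0 < ε) (c : ℝ)
    (hc : 0 ≤ c) : ∀ᶠ n : ℕ in atTop, 6 * (n : ℝ) ^ s + c ≤ ε * (n : ℝ) ^ s' := by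
  have h1 : Tendsto (fun m : ℕ => (m : ℝ) ^ (s' - s)) atTop atTop :=
    (tendsto_rpow_atTop (by linarith)).comp tendsto_natCast_atTop_atTop
  filter_upwards [h1.eventually_ge_atTop ((6 + c) / ε), eventually_ge_atTop 1] with n hn hn1
  have hnr : (1 : ℝ) ≤ n := by exact_mod_cast hn1
  have hns : 1 ≤ (n : ℝ) ^ s := Real.one_le_rpow hnr hs.le
  rw [div_le_iff₀ hε] at hn
  have e : (n : ℝ) ^ s' = (n : ℝ) ^ (s' - s) * (n : ℝ) ^ s := by
    rw [← Real.rpow_add (by linarith)]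
    simp
  calc 6 * (n : ℝ) ^ s + c ≤ (6 + c) * (n : ℝ) ^ s := by nlinarith
    _ ≤ ((n : ℝ) ^ (s' - s) * ε) * (n : ℝ) ^ s := by gcongr
    _ = _ := by rw [e]; ring

/-- The exponents `1/(ℓ+1)` and `1 - 1/(ℓ+1)` add to `1`, so slow growth makes the loss in the
exponent `o(log n)`. -/
theorem eventually_rpow_le_phaseFun {ℓ : ℕ}
    (hω : ω =o[atTop] fun n : ℕ => (Real.log (n : ℝ)) ^ (1 / ((ℓ : ℝ) + 1))) {s : ℝ} (hs : s < 1) :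
    ∀ᶠ n : ℕ in atTop, (n : ℝ) ^ s ≤ phaseFun ω (ℓ + 1) n := by
  have hlog : 0 < Real.log 2 := Real.log_pos (by norm_num)
  have hlog1 : Real.log 2 ≤ 1 := by linarith [Real.log_two_lt_d9]
  filter_upwards [hω.bound (by linarith : 0 < 1 - s), eventually_gt_atTop 1] with n hn hn1
  have hnr : (1 : ℝ) < n := by exact_mod_cast hn1
  have hL : 0 < Real.log n := Real.log_pos hnr
  set L := Real.log n with hLdef
  rw [Real.norm_eq_abs, Real.norm_eq_abs, abs_of_nonneg (Real.rpow_nonneg hL.le _)] at hn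
  have h1 := (le_abs_self _).trans hn
  have e : (n : ℝ) = Real.exp L := (Real.exp_log (by linarith)).symm
  unfold phaseFun
  rw [Real.rpow_def_of_pos (by linarith : (0 : ℝ) < n), Real.rpow_def_of_pos (by norm_num)]
  rw [← hLdef]
  nth_rewrite 1 [e]
  rw [← Real.exp_add, Real.exp_le_exp]
  have h2 : L ^ (1 / ((ℓ : ℝ) + 1)) * L ^ (1 - 1 / ((ℓ + 1 : ℕ) : ℝ)) = L := by
    rw [← Real.rpow_add hL]
    push_cast
    simp
  have h3 : ω n * L ^ (1 - 1 / ((ℓ + 1 : ℕ) : ℝ)) ≤ (1 - s) * L := by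
    calc ω n * L ^ (1 - 1 / ((ℓ + 1 : ℕ) : ℝ)) ≤
          (1 - s) * L ^ (1 / ((ℓ : ℝ) + 1)) * L ^ (1 - 1 / ((ℓ + 1 : ℕ) : ℝ)) := by gcongr
      _ = _ := by rw [mul_assoc, h2]
  have h4 : Real.log 2 * (ω n * L ^ (1 - 1 / ((ℓ + 1 : ℕ) : ℝ))) ≤ Real.log 2 * ((1 - s) * L) :=
    mul_le_mul_of_nonneg_left h3 hlog.le
  have h5 : Real.log 2 * ((1 - s) * L) ≤ 1 * ((1 - s) * L) :=
    mul_le_mul_of_nonneg_right hlog1 (mul_nonneg (by linarith) hL.le)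
  linarith

end Phase

/-! ### The limiting density for odd cliques. -/

section Density

theorem tendsto_join_density {ℓ : ℕ} (hℓ : 3 ≤ ℓ) :
    Tendsto (fun n : ℕ => (ℓ.descFactorial 3 * ((n / ℓ : ℕ) : ℝ) ^ 3) / (6 * (n : ℝ) ^ 3)) atTop
      (𝓝 (turanDensity ℓ / 6)) := by
  have hℓ0 : (0 : ℝ) < ℓ := by exact_mod_cast (by omega : 0 < ℓ)
  have h1 : Tendsto (fun n : ℕ => ((n / ℓ : ℕ) : ℝ) / n) atTop (𝓝 (1 / (ℓ : ℝ))) := by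
    have := (tendsto_nat_floor_mul_div_atTop (by positivity : 0 ≤ 1 / (ℓ : ℝ))).comp
      (tendsto_natCast_atTop_atTop (R := ℝ))
    refine this.congr fun n => ?_
    rw [Function.comp_apply, one_div_mul_eq_div, Nat.floor_div_eq_div]
  have h2 : Tendsto (fun n : ℕ => (ℓ.descFactorial 3 : ℝ) / 6 * (((n / ℓ : ℕ) : ℝ) / n) ^ 3) atTop
      (𝓝 ((ℓ.descFactorial 3 : ℝ) / 6 * (1 / (ℓ : ℝ)) ^ 3)) := (h1.pow 3).const_mul _
  have e : (ℓ.descFactorial 3 : ℝ) / 6 * (1 / (ℓ : ℝ)) ^ 3 = turanDensity ℓ / 6 := by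
    obtain ⟨k, rfl⟩ := Nat.exists_eq_add_of_le hℓ
    have : (3 + k).descFactorial 3 = (k + 1) * ((k + 2) * (k + 3)) := by
      rw [show 3 + k = k + 3 by ring]
      simp [Nat.descFactorial]
    rw [this, turanDensity]
    push_cast at hℓ0 ⊢
    field_simp
    ring
  rw [e] at h2
  refine h2.congr fun n => ?_
  rw [div_pow, div_mul_div_comm]

theorem eventually_le_ramseyTuran {ℓ : ℕ} (hℓ : 3 ≤ ℓ) : ∃ s : ℝ, 0 < s ∧ s < 1 ∧ ∀ δ > 0,
    ∀ᶠ n : ℕ in atTop, ∀ x, 6 * (n : ℝ) ^ s + ℓ ≤ x →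
      (turanDensity ℓ / 6 - δ) * (n : ℝ) ^ 3 ≤ ramseyTuran 3 (2 * ℓ + 1) n x := by
  obtain ⟨s, hs0, hs1, h⟩ := join_le_ramseyTuran ℓ (by omega)
  refine ⟨s, hs0, hs1, fun δ hδ => ?_⟩
  filter_upwards [(tendsto_join_density hℓ).eventually_const_le
    (by linarith : turanDensity ℓ / 6 - δ < turanDensity ℓ / 6), eventually_gt_atTop 0]
    with n hn hn0 x hx
  have hnr : (0 : ℝ) < n := by exact_mod_cast hn0
  rw [le_div_iff₀ (by positivity)] at hn
  have h1 : (ℓ.descFactorial 3 * ((n / ℓ : ℕ) : ℝ) ^ 3) ≤ 6 * ramseyTuran 3 (2 * ℓ + 1) n x := by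
    exact_mod_cast h n x hx
  linarith

/-- The density that defines `RT(K_3, K_{2ℓ+1}, o(n))` is that of the balanced complete `ℓ`-partite
graph. -/
theorem tendsto_rtDensity_odd {ℓ : ℕ} (hℓ : 3 ≤ ℓ) :
    Tendsto (rtDensity (2 * ℓ + 1)) (𝓝[>] (0 : ℝ)) (𝓝 (turanDensity ℓ / 6)) := by
  have hlow : ∀ ε > 0, turanDensity ℓ / 6 ≤ rtDensity (2 * ℓ + 1) ε := by
    intro ε hε
    obtain ⟨s, hs0, hs1, h⟩ := eventually_le_ramseyTuran hℓ
    refine le_of_forall_pos_sub_le fun δ hδ => ?_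
    refine ge_of_tendsto (tendsto_rtDensity (by omega) hε) ?_
    filter_upwards [h δ hδ, eventually_rpow_add_le hs0 hs1 hε ℓ (by positivity),
      eventually_gt_atTop 0] with n h1 h2 hn0
    have hnr : (0 : ℝ) < n := by exact_mod_cast hn0
    rw [Real.rpow_one] at h2
    rw [le_div_iff₀ (by positivity)]
    exact h1 _ h2
  refine tendsto_order.2 ⟨fun b hb => ?_, fun b hb => ?_⟩
  · filter_upwards [self_mem_nhdsWithin] with ε hε
    exact hb.trans_le (hlow ε hε)
  · set δ := min 1 (b - turanDensity ℓ / 6) with hδ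
    have hδ0 : 0 < δ := lt_min one_pos (by linarith)
    obtain ⟨η, hη, N₀, h⟩ := ordTri_lt_of_cliqueFree_odd hℓ hδ0 (min_le_left _ _)
    filter_upwards [Ioo_mem_nhdsGT hη] with ε hε
    have h1 : rtDensity (2 * ℓ + 1) ε ≤ (turanDensity ℓ + δ) / 6 := by
      refine le_of_tendsto (tendsto_rtDensity (by omega) hε.1) ?_
      filter_upwards [eventually_ge_atTop N₀, eventually_gt_atTop 0] with n hn hn0
      have hnr : (0 : ℝ) < n := by exact_mod_cast hn0
      rw [div_le_iff₀ (by positivity)]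
      have hB := (turanDensity_pos hℓ).le
      refine ramseyTuran_le (by positivity) fun G hG hα => ?_
      refine (h n hn G hG (hα.trans ?_)).le.trans (le_of_eq (by ring))
      exact mul_le_mul_of_nonneg_right hε.2.le hnr.le
    have h2 : δ ≤ b - turanDensity ℓ / 6 := min_le_right _ _
    linarith

end Density

/-! ### Asymptotic bookkeeping and the main theorem. -/

theorem isLittleO_sub_of_forall_eventually {f : ℕ → ℝ} {B : ℝ}
    (hu : ∀ δ > 0, ∀ᶠ n : ℕ in atTop, f n ≤ (B + δ) * (n : ℝ) ^ 3)
    (hl : ∀ δ > 0, ∀ᶠ n : ℕ in atTop, (B - δ) * (n : ℝ) ^ 3 ≤ f n) :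
    (fun n : ℕ => f n - (n : ℝ) ^ 3 * B) =o[atTop] fun n : ℕ => (n : ℝ) ^ 3 := by
  refine isLittleO_iff.2 fun δ hδ => ?_
  filter_upwards [hu δ hδ, hl δ hδ] with n h1 h2
  have h3 : (0 : ℝ) ≤ (n : ℝ) ^ 3 := by positivity
  rw [Real.norm_eq_abs, Real.norm_eq_abs, abs_of_nonneg h3, abs_le]
  constructor <;> linarith

/-- A nonzero limiting density is what turns an additive error `o(n^3)` into a factor `1 + o(1)`. -/
theorem isEquivalent_of_isLittleO_sub {f h : ℕ → ℝ} {B : ℝ} (hB : B ≠ 0)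
    (hf : (fun n : ℕ => f n - (n : ℝ) ^ 3 * B) =o[atTop] fun n : ℕ => (n : ℝ) ^ 3)
    (hh : (fun n : ℕ => h n - (n : ℝ) ^ 3 * B) =o[atTop] fun n : ℕ => (n : ℝ) ^ 3) :
    f ~[atTop] h := by
  have key : ∀ {u : ℕ → ℝ}, (fun n : ℕ => u n - (n : ℝ) ^ 3 * B) =o[atTop]
      (fun n : ℕ => (n : ℝ) ^ 3) → u ~[atTop] fun n : ℕ => (n : ℝ) ^ 3 * B := by
    intro u hu
    have h1 : (fun n : ℕ => (n : ℝ) ^ 3) =O[atTop] fun n : ℕ => (n : ℝ) ^ 3 * B := by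
      refine IsBigO.of_bound (1 / |B|) (Eventually.of_forall fun n => le_of_eq ?_)
      have : |B| ≠ 0 := abs_ne_zero.2 hB
      rw [norm_mul, Real.norm_eq_abs B]
      field_simp
    exact hu.trans_isBigO h1
  exact (key hf).trans (key hh).symm

theorem isLittleO_of_ramseyTuran_le {f : ℕ → ℝ} (h0 : ∀ n, 0 ≤ f n)
    (hu : ∀ δ > 0, ∀ᶠ n : ℕ in atTop, f n ≤ δ * (n : ℝ) ^ 3) :
    f =o[atTop] fun n : ℕ => (n : ℝ) ^ 3 := by
  refine isLittleO_iff.2 fun δ hδ => ?_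
  filter_upwards [hu δ hδ] with n h1
  rwa [Real.norm_eq_abs, Real.norm_eq_abs, abs_of_nonneg (h0 n), abs_of_nonneg (by positivity)]

theorem theorem5p3 (ω : ℕ → ℝ) (hω : Tendsto ω atTop atTop) :
    -- the cases `K_5` and `K_6`
    ((fun n : ℕ => (ramseyTuran 3 5 n (phaseFun ω 3 n) : ℝ)) =o[atTop]
        (fun n : ℕ => (n : ℝ) ^ 3) ∧
      (fun n : ℕ => (ramseyTuran 3 6 n (phaseFun ω 3 n) : ℝ)) =o[atTop]
        (fun n : ℕ => (n : ℝ) ^ 3)) ∧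
    ∀ ℓ : ℕ, 3 ≤ ℓ →
      -- `ω` grows slowly: `g_{ℓ+1}(n) = n ^ (1 - o(1))`
      (ω =o[atTop] fun n : ℕ => (Real.log (n : ℝ)) ^ (1 / ((ℓ : ℝ) + 1))) →
      -- `RT(K_3, K_{2ℓ+1}, o(n))` is well defined
      (∃ h : ℕ → ℝ, IsRamseyTuranLittleO 3 (2 * ℓ + 1) h) ∧
      ∀ h : ℕ → ℝ, IsRamseyTuranLittleO 3 (2 * ℓ + 1) h →
        -- odd cliques are stable
        ((fun n : ℕ => (ramseyTuran 3 (2 * ℓ + 1) n (phaseFun ω (ℓ + 1) n) : ℝ)) ~[atTop] h) ∧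
        -- even cliques exhibit a jump
        ((fun n : ℕ => (ramseyTuran 3 (2 * ℓ + 2) n (phaseFun ω (ℓ + 1) n) : ℝ)) ~[atTop] h) := by
  have hmono : ∀ {t : ℕ} (n : ℕ) (x : ℝ),
      (ramseyTuran 3 t n x : ℝ) ≤ ramseyTuran 3 (t + 1) n x := fun n x => by
    exact_mod_cast ramseyTuran_mono (Nat.le_succ _) le_rfl
  have h6 : ∀ δ > 0, ∀ᶠ n : ℕ in atTop,
      (ramseyTuran 3 6 n (phaseFun ω 3 n) : ℝ) ≤ δ * (n : ℝ) ^ 3 := by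
    intro δ hδ
    have := eventually_ramseyTuran_phaseFun_le hω le_rfl hδ (ordTri_lt_of_cliqueFree_six hδ)
    simpa using this
  refine ⟨⟨isLittleO_of_ramseyTuran_le (fun n => by positivity) fun δ hδ =>
    (h6 δ hδ).mono fun n hn => (hmono n _).trans hn,
    isLittleO_of_ramseyTuran_le (fun n => by positivity) h6⟩, fun ℓ hℓ hslow => ⟨?_, ?_⟩⟩
  · refine ⟨fun n => (n : ℝ) ^ 3 * (turanDensity ℓ / 6), rtDensity (2 * ℓ + 1), turanDensity ℓ / 6,
      ?_, tendsto_rtDensity_odd hℓ, by simp⟩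
    filter_upwards [self_mem_nhdsWithin] with ε hε
    exact tendsto_rtDensity (by omega) hε
  · rintro h ⟨φ, c, hφ, hc, hh⟩
    -- Uniqueness of limits identifies any admissible `φ` and `c` with the computed ones.
    have hφ' : φ =ᶠ[𝓝[>] (0 : ℝ)] rtDensity (2 * ℓ + 1) := by
      filter_upwards [hφ, self_mem_nhdsWithin] with ε h1 hε
      exact tendsto_nhds_unique h1 (tendsto_rtDensity (by omega) hε)
    obtain rfl : c = turanDensity ℓ / 6 :=
      tendsto_nhds_unique (hc.congr' hφ') (tendsto_rtDensity_odd hℓ)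
    have hB := turanDensity_pos hℓ
    have hup : ∀ δ > 0, ∀ᶠ n : ℕ in atTop,
        (ramseyTuran 3 (2 * ℓ + 2) n (phaseFun ω (ℓ + 1) n) : ℝ) ≤
          (turanDensity ℓ / 6 + δ) * (n : ℝ) ^ 3 := by
      intro δ hδ
      have h1 : 0 < min 1 δ := lt_min one_pos hδ
      filter_upwards [eventually_ramseyTuran_phaseFun_le hω hB.le h1
        (ordTri_lt_of_cliqueFree_even hℓ h1 (min_le_left _ _))] with n hn
      refine hn.trans (mul_le_mul_of_nonneg_right ?_ (by positivity))
      linarith [min_le_right 1 δ]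
    have hlow : ∀ δ > 0, ∀ᶠ n : ℕ in atTop, (turanDensity ℓ / 6 - δ) * (n : ℝ) ^ 3 ≤
        (ramseyTuran 3 (2 * ℓ + 1) n (phaseFun ω (ℓ + 1) n) : ℝ) := by
      obtain ⟨s, hs0, hs1, hs⟩ := eventually_le_ramseyTuran hℓ
      intro δ hδ
      -- The exponent `(1 + s)/2` lies strictly between `s` and `1`: above the independence number
      -- of the join, below the phase function.
      filter_upwards [hs δ hδ, eventually_rpow_add_le hs0 (by linarith : s < (1 + s) / 2) one_pos ℓ
        (by positivity), eventually_rpow_le_phaseFun hslow (by linarith : (1 + s) / 2 < 1)]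
        with n h1 h2 h3
      exact h1 _ (h2.trans (by rwa [one_mul]))
    -- Since the count increases with the forbidden clique, the upper bound for `K_{2ℓ+2}` and the
    -- lower bound for `K_{2ℓ+1}` squeeze both functions.
    refine ⟨isEquivalent_of_isLittleO_sub (by positivity) (isLittleO_sub_of_forall_eventually
      (fun δ hδ => (hup δ hδ).mono fun n hn => (hmono n _).trans hn) hlow) hh,
      isEquivalent_of_isLittleO_sub (by positivity) (isLittleO_sub_of_forall_eventually hup
      fun δ hδ => (hlow δ hδ).mono fun n hn => hn.trans (hmono n _)) hh⟩
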